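/- Let $q\in\mathbb{C}$ be nonzero and not a root of unity, and let $N\ge 1$. Put $$R(u,v)=(u-v)\sum_{i\ne j}E_{ii}\otimes E_{jj}+(q^{-1}u-qv)\sum_iE_{ii}\otimes E_{ii}+(q^{-1}-q)u\sum_{i>j}E_{ij}\otimes E_{ji}+(q^{-1}-q)v\sum_{i<j}E_{ij}\otimes E_{ji},$$ and let $R^t(u,v)$ be its transpose in the first tensor factor. Let $\mathrm U_q(\widehat{\mathfrak{gl}}_N)$ be the unital associative $\mathbb{C}$-algebra with generators $t_{ij}^{(r)},\bar t_{ij}^{\,(r)}$ ($1\le i,j\le N$, $r\ge 0$), combined into the matrices $T(u)=\big(\sum_{r\ge0} t_{ij}^{(r)}u^{-r}\big)$ and $\overline T(u)=\big(\sum_{r\ge0}\bar t_{ij}^{\,(r)}u^{r}\big)$, and the defining relations $t_{ij}^{(0)}=\bar t_{ji}^{\,(0)}=0$ for $i<j$, $t_{ii}^{(0)}\bar t_{ii}^{\,(0)}=\bar t_{ii}^{\,(0)}t_{ii}^{(0)}=1$, and $$R(u,v)T_1(u)T_2(v)=T_2(v)T_1(u)R(u,v),\quad R(u,v)\overline T_1(u)\overline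 T_2(v)=\overline T_2(v)\overline T_1(u)R(u,v),\quad R(u,v)\overline T_1(u)T_2(v)=T_2(v)\overline T_1(u)R(u,v).$$ In the orthogonal case ($N$ arbitrary) let $G=1$; in the symplectic case ($N=2n$) let $G=q\sum_{k=1}^nE_{2k-1,2k}-\sum_{k=1}^nE_{2k,2k-1}$. Let $S(u)=T(u)\,G\,\overline T(u^{-1})^t$ with entries $s_{ij}(u)=\sum_{r\ge0}s_{ij}^{(r)}u^{-r}$. The twisted $q$-Yangian $\mathrm Y^{\rm tw}_q$ (that is, $\mathrm Y^{\rm tw}_q(\mathfrak o_N)$ or $\mathrm Y^{\rm tw}_q(\mathfrak{sp}_{2n})$) is the subalgebra of $\mathrm U_q(\widehat{\mathfrak{gl}}_N)$ generated by all the $s_{ij}^{(r)}$ and, in the symplectic case, also by the inverses $(s_{2k-1,2k}^{(0)})^{-1}$, $1\le k\le n$. Let $P^q=\sum_iE_{ii}\otimes E_{ii}+q\sum_{i>j}E_{ij}\otimes E_{ji}+q^{-1}\sum_{i<j}E_{ij}\otimes E_{ji}$, let $\sigma\mapsto P^q_\sigma$ be the action of $\mathfrak S_N$ on $(\mathbb{C}^N)^{\otimes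 N}$ in which $(i,i+1)$ acts by $P^q$ in the factors $i,i+1$, and let $A^q_N=\sum_{\sigma\in\mathfrak S_N}\operatorname{sgn}\sigma\cdot P^q_\sigma$. Put $u_i=q^{-2i+2}u$ and $R^t_{ij}=R^t_{ij}(u_i^{-1},u_j)$. Then there is a unique Laurent series $\operatorname{sdet}S(u)$ in $u^{-1}$ over $\mathrm U_q(\widehat{\mathfrak{gl}}_N)$ (the Sklyanin determinant) such that both $$A^q_N\,S_1(u_1)R^t_{12}\cdots R^t_{1N}\,S_2(u_2)R^t_{23}\cdots R^t_{2N}\,S_3(u_3)\cdots R^t_{N-1,N}S_N(u_N)$$ and $$S_N(u_N)R^t_{N-1,N}\cdots S_3(u_3)\,R^t_{2N}\cdots R^t_{23}\,S_2(u_2)\,R^t_{1N}\cdots R^t_{12}\,S_1(u_1)\,A^q_N$$ are equal to $A^q_N\operatorname{sdet}S(u)$. Let $$\gamma_N(u)=\prod_{1\le i<j\le N}\big(q^{2i-2}u^{-1}-q^{-2j+2}u\big)\cdot\varepsilon(u),$$ where $\varepsilon(u)=1$ in the orthogonal case and $\varepsilon(u)=\dfrac{q^{n-2}-q^nu^2}{q^{2n-2}-q^{-2n}u^2}$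 in the symplectic case, expanded as a Laurent series in $u^{-1}$. Then $$c(u)=\gamma_N(u)^{-1}\operatorname{sdet}S(u)=1+\sum_{k=1}^\infty c_k\,u^{-k},$$ where all the $c_k$ belong to the center of $\mathrm Y^{\rm tw}_q$, and the elements $c_k$, $k\ge1$, are algebraically independent over $\mathbb{C}$. -/

import Mathlib

open scoped Kronecker

noncomputable section

namespace TwistedQYangian

/-! ## The trigonometric `R`-matrix

Indices run over `Fin N`, so the index `i` of `{1, …, N}` is `i - 1` here. A matrix
`∑ r_{ij,kl} E_ij ⊗ E_kl` in `End ℂ^N ⊗ End ℂ^N` has the entry `r_{ij,kl}` in row `(i, k)` and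
column `(j, l)`. -/

/-- `R(u, v) = (u - v) ∑_{i≠j} E_ii ⊗ E_jj + (q⁻¹u - qv) ∑_i E_ii ⊗ E_ii
  + (q⁻¹ - q) u ∑_{i>j} E_ij ⊗ E_ji + (q⁻¹ - q) v ∑_{i<j} E_ij ⊗ E_ji`,
for central elements `u`, `v` of a `ℂ`-algebra `A`. -/
def Rmat {A : Type*} [Ring A] [Algebra ℂ A] (q : ℂ) (N : ℕ) (u v : A) :
    Matrix (Fin N × Fin N) (Fin N × Fin N) A :=
  fun a b =>
    if a = b then
      if a.1 = a.2 then q⁻¹ • u - q • v else u - v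
    else if a.1 = b.2 ∧ a.2 = b.1 then
      (q⁻¹ - q) • (if a.2 < a.1 then u else v)
    else 0

/-- `R^t(u, v)`: the transposition of `R(u, v)` in the first tensor factor. -/
def Rt {A : Type*} [Ring A] [Algebra ℂ A] (q : ℂ) (N : ℕ) (u v : A) :
    Matrix (Fin N × Fin N) (Fin N × Fin N) A :=
  fun a b => Rmat q N u v (b.1, a.2) (a.1, b.2)

/-! ## The quantum affine algebra `U_q(ĝl_N)` -/

/-- The generators `t_ij^(r)` and `t̄_ij^(r)`, `r ≥ 0`. -/
inductive Gen (N : ℕ) : Type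
  | t (i j : Fin N) (r : ℕ) : Gen N
  | tbar (i j : Fin N) (r : ℕ) : Gen N

/-- The coefficient of `u^m` in `T(u) = ∑_{r≥0} T^(r) u^{-r}`. -/
def freeT (N : ℕ) (m : ℤ) : Matrix (Fin N) (Fin N) (FreeAlgebra ℂ (Gen N)) :=
  fun i j => if m ≤ 0 then FreeAlgebra.ι ℂ (Gen.t i j (-m).toNat) else 0

/-- The coefficient of `u^m` in `T̄(u) = ∑_{r≥0} T̄^(r) u^r`. -/
def freeTbar (N : ℕ) (m : ℤ) : Matrix (Fin N) (Fin N) (FreeAlgebra ℂ (Gen N)) :=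
  fun i j => if 0 ≤ m then FreeAlgebra.ι ℂ (Gen.tbar i j m.toNat) else 0

/-- The coefficient of `u^m v^n` in `R(u, v) X₁(u) Y₂(v)`, where `R(u, v) = u R(1, 0) + v R(0, 1)`
and `X(u) = ∑_m X m u^m`, `Y(v) = ∑_n Y n v^n`. -/
def rttLeft {A : Type*} [Ring A] [Algebra ℂ A] (q : ℂ) {N : ℕ}
    (X Y : ℤ → Matrix (Fin N) (Fin N) A) (m n : ℤ) :
    Matrix (Fin N × Fin N) (Fin N × Fin N) A :=
  Rmat q N 1 0 * (X (m - 1) ⊗ₖ 1) * (1 ⊗ₖ Y n) + Rmat q N 0 1 * (X m ⊗ₖ 1) * (1 ⊗ₖ Y (n - 1))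

/-- The coefficient of `u^m v^n` in `Y₂(v) X₁(u) R(u, v)`. -/
def rttRight {A : Type*} [Ring A] [Algebra ℂ A] (q : ℂ) {N : ℕ}
    (X Y : ℤ → Matrix (Fin N) (Fin N) A) (m n : ℤ) :
    Matrix (Fin N × Fin N) (Fin N × Fin N) A :=
  (1 ⊗ₖ Y n) * (X (m - 1) ⊗ₖ 1) * Rmat q N 1 0 + (1 ⊗ₖ Y (n - 1)) * (X m ⊗ₖ 1) * Rmat q N 0 1

/-- The defining relations of `U_q(ĝl_N)`. -/
inductive Rel (q : ℂ) (N : ℕ) : FreeAlgebra ℂ (Gen N) → FreeAlgebra ℂ (Gen N) → Prop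
  | t_zero (i j : Fin N) (h : i < j) : Rel q N (FreeAlgebra.ι ℂ (Gen.t i j 0)) 0
  | tbar_zero (i j : Fin N) (h : i < j) : Rel q N (FreeAlgebra.ι ℂ (Gen.tbar j i 0)) 0
  | t_mul_tbar (i : Fin N) :
      Rel q N (FreeAlgebra.ι ℂ (Gen.t i i 0) * FreeAlgebra.ι ℂ (Gen.tbar i i 0)) 1
  | tbar_mul_t (i : Fin N) :
      Rel q N (FreeAlgebra.ι ℂ (Gen.tbar i i 0) * FreeAlgebra.ι ℂ (Gen.t i i 0)) 1
  | rtt (m n : ℤ) (a b : Fin N × Fin N) :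
      Rel q N (rttLeft q (freeT N) (freeT N) m n a b) (rttRight q (freeT N) (freeT N) m n a b)
  | rtbtb (m n : ℤ) (a b : Fin N × Fin N) :
      Rel q N (rttLeft q (freeTbar N) (freeTbar N) m n a b)
        (rttRight q (freeTbar N) (freeTbar N) m n a b)
  | rtbt (m n : ℤ) (a b : Fin N × Fin N) :
      Rel q N (rttLeft q (freeTbar N) (freeT N) m n a b)
        (rttRight q (freeTbar N) (freeT N) m n a b)

/-- The quantum affine algebra `U_q(ĝl_N)`. -/
def QAffine (q : ℂ) (N : ℕ) : Type := RingQuot (Rel q N)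

instance instRingQAffine (q : ℂ) (N : ℕ) : Ring (QAffine q N) :=
  inferInstanceAs (Ring (RingQuot (Rel q N)))

instance instAlgebraQAffine (q : ℂ) (N : ℕ) : Algebra ℂ (QAffine q N) :=
  inferInstanceAs (Algebra ℂ (RingQuot (Rel q N)))

/-- The quotient map onto `U_q(ĝl_N)`. -/
def toQAffine (q : ℂ) (N : ℕ) : FreeAlgebra ℂ (Gen N) →ₐ[ℂ] QAffine q N :=
  RingQuot.mkAlgHom ℂ (Rel q N)

/-- The element `t_ij^(r)` of `U_q(ĝl_N)`. -/
def tGen (q : ℂ) {N : ℕ} (i j : Fin N) (r : ℕ) : QAffine q N :=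
  toQAffine q N (FreeAlgebra.ι ℂ (Gen.t i j r))

/-- The element `t̄_ij^(r)` of `U_q(ĝl_N)`. -/
def tbarGen (q : ℂ) {N : ℕ} (i j : Fin N) (r : ℕ) : QAffine q N :=
  toQAffine q N (FreeAlgebra.ι ℂ (Gen.tbar i j r))

/-! ## The twisted `q`-Yangians -/

/-- `orth N` stands for `𝔬_N`, and `symp n` for `𝔰𝔭_{2n}`; both are attached to `𝔤𝔩_N`, with
`N = 2n` in the second case. -/
inductive TwistType : ℕ → Type
  | orth (N : ℕ) : TwistType N
  | symp (n : ℕ) : TwistType (2 * n)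

/-- `G = 1` for `𝔬_N`, and `G = q ∑_k E_{2k-1,2k} - ∑_k E_{2k,2k-1}` for `𝔰𝔭_{2n}`
(odd indices of `{1, …, 2n}` have even value in `Fin (2 * n)`). -/
def Gmat (q : ℂ) : {N : ℕ} → TwistType N → Matrix (Fin N) (Fin N) ℂ
  | _, .orth _ => 1
  | _, .symp _ => fun i j =>
      if Even i.val ∧ j.val = i.val + 1 then q
      else if Even j.val ∧ i.val = j.val + 1 then -1
      else 0

/-- `T(u)`; the variable of the power series is `u⁻¹`. -/
def Tser (q : ℂ) (N : ℕ) : Matrix (Fin N) (Fin N) (PowerSeries (QAffine q N)) :=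
  fun i j => PowerSeries.mk (tGen q i j)

/-- `T̄(u⁻¹)`; the variable of the power series is `u⁻¹`. -/
def TbarInvSer (q : ℂ) (N : ℕ) : Matrix (Fin N) (Fin N) (PowerSeries (QAffine q N)) :=
  fun i j => PowerSeries.mk (tbarGen q i j)

/-- `S(u) = T(u) G T̄(u⁻¹)^t`; the variable of the power series is `u⁻¹`. -/
def Sser (q : ℂ) {N : ℕ} (κ : TwistType N) :
    Matrix (Fin N) (Fin N) (PowerSeries (QAffine q N)) :=
  Tser q N * (Gmat q κ).map (algebraMap ℂ (PowerSeries (QAffine q N))) *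
    (TbarInvSer q N).transpose

/-- `s_ij^(r)`, the coefficient of `u^{-r}` in `s_ij(u)`. -/
def sCoeff (q : ℂ) {N : ℕ} (κ : TwistType N) (i j : Fin N) (r : ℕ) : QAffine q N :=
  PowerSeries.coeff r (Sser q κ i j)

/-- The generators of the twisted `q`-Yangian: all `s_ij^(r)` and, for `𝔰𝔭_{2n}`, also the
inverses of `s_{i i'}^(0)` with `(i, i') = (2k-1, 2k)`. -/
def yangianGens (q : ℂ) : {N : ℕ} → (κ : TwistType N) → Set (QAffine q N)
  | _, .orth N => {x | ∃ i j r, x = sCoeff q (.orth N) i j r}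
  | _, .symp n => {x | ∃ i j r, x = sCoeff q (.symp n) i j r} ∪
      {x | ∃ i j : Fin (2 * n), Even i.val ∧ j.val = i.val + 1 ∧
        sCoeff q (.symp n) i j 0 * x = 1 ∧ x * sCoeff q (.symp n) i j 0 = 1}

/-- The twisted `q`-Yangian `Y_q^tw(𝔬_N)` or `Y_q^tw(𝔰𝔭_{2n})`, as a subalgebra of
`U_q(ĝl_N)`. -/
def Ytw (q : ℂ) {N : ℕ} (κ : TwistType N) : Subalgebra ℂ (QAffine q N) :=
  Algebra.adjoin ℂ (yangianGens q κ)

/-! ## The `q`-antisymmetrizer -/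

/-- The number of inversions of a multi-index (or of a permutation). -/
def inv {r N : ℕ} (a : Fin r → Fin N) : ℕ :=
  (Finset.univ.filter fun p : Fin r × Fin r => p.1 < p.2 ∧ a p.2 < a p.1).card

/-- The operator `P^q_σ` on `(ℂ^N)^{⊗ r}`, in the basis of the `e_a = e_{a_1} ⊗ ⋯ ⊗ e_{a_r}`:
`P^q_σ e_a = q^{inv(a ∘ σ⁻¹) - inv(a)} e_{a ∘ σ⁻¹}`. By `Pq_one`, `Pq_mul` and `Pq_swap` below
this is the action of the symmetric group with `s_i ↦ P^q_{i,i+1}`, so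
`P^q_σ = P^q_{s_{i_1}} ⋯ P^q_{s_{i_l}}` for every decomposition `σ = s_{i_1} ⋯ s_{i_l}`. -/
def Pq (q : ℂ) (N : ℕ) {r : ℕ} (σ : Equiv.Perm (Fin r)) :
    Matrix (Fin r → Fin N) (Fin r → Fin N) ℂ :=
  fun a b => if a = b ∘ σ.symm then q ^ ((inv a : ℤ) - (inv b : ℤ)) else 0

/-- The `q`-antisymmetrizer `A^q_r = ∑_σ sgn σ · P^q_σ`. -/
def Aq (q : ℂ) (N r : ℕ) : Matrix (Fin r → Fin N) (Fin r → Fin N) ℂ :=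
  ∑ σ : Equiv.Perm (Fin r), ((Equiv.Perm.sign σ : ℤ) : ℂ) • Pq q N σ

/-- The matrix `M` in `End ℂ^N ⊗ End ℂ^N`, acting in the `i`-th and `j`-th factors (`i ≠ j`) of
`(ℂ^N)^{⊗ r}`. -/
def onTwo {A : Type*} [Zero A] {r N : ℕ} (i j : Fin r)
    (M : Matrix (Fin N × Fin N) (Fin N × Fin N) A) :
    Matrix (Fin r → Fin N) (Fin r → Fin N) A :=
  fun a b => if ∀ k, k ≠ i → k ≠ j → a k = b k then M (a i, a j) (b i, b j) else 0

/-- The matrix `M` in `End ℂ^N`, acting in the `i`-th factor of `(ℂ^N)^{⊗ r}`. -/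
def onOne {A : Type*} [Zero A] {r N : ℕ} (i : Fin r) (M : Matrix (Fin N) (Fin N) A) :
    Matrix (Fin r → Fin N) (Fin r → Fin N) A :=
  fun a b => if ∀ k, k ≠ i → a k = b k then M (a i) (b i) else 0

/-- The `q`-permutation operator
`P^q = ∑_i E_ii ⊗ E_ii + q ∑_{i>j} E_ij ⊗ E_ji + q⁻¹ ∑_{i<j} E_ij ⊗ E_ji`. -/
def qPerm (q : ℂ) (N : ℕ) : Matrix (Fin N × Fin N) (Fin N × Fin N) ℂ :=
  fun a b =>
    if a.1 = b.2 ∧ a.2 = b.1 then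
      if a.1 = a.2 then 1 else if a.2 < a.1 then q else q⁻¹
    else 0

theorem Pq_one (q : ℂ) (N r : ℕ) : Pq q N (1 : Equiv.Perm (Fin r)) = 1 := by
  ext a b
  by_cases h : a = b
  · subst h
    have : a = a ∘ (1 : Equiv.Perm (Fin r)).symm := rfl
    simp [Pq, ← this]
  · have : ¬ a = b ∘ (1 : Equiv.Perm (Fin r)).symm := h
    simp [Pq, this, Matrix.one_apply_ne h]

theorem Pq_mul (q : ℂ) (hq : q ≠ 0) (N r : ℕ) (σ τ : Equiv.Perm (Fin r)) :
    Pq q N (σ * τ) = Pq q N σ * Pq q N τ := by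
  ext a b
  rw [Matrix.mul_apply, Finset.sum_eq_single (b ∘ τ.symm)]
  · have e : b ∘ (σ * τ).symm = (b ∘ τ.symm) ∘ σ.symm := rfl
    simp only [Pq, e]
    split_ifs with h
    · rw [← zpow_add₀ hq]
      congr 1
      ring
    · simp
  · intro c _ hc
    simp [Pq, hc]
  · simp

theorem inv_comp_swap {r N : ℕ} (a : Fin r → Fin N) (i j : Fin r) (h : j.val = i.val + 1) :
    (inv (a ∘ Equiv.swap i j) : ℤ) - inv a =
      (if a i < a j then 1 else 0) - (if a j < a i then 1 else 0) := by
  have hij : i ≠ j := fun e => by simp [e] at h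
  have key : ∀ b : Fin r → Fin N, (inv b : ℤ) =
      ∑ p : Fin r × Fin r, if p.1 < p.2 ∧ b p.2 < b p.1 then (1 : ℤ) else 0 := by
    intro b
    simp [inv]
  have re : (inv (a ∘ Equiv.swap i j) : ℤ) = ∑ p : Fin r × Fin r,
      if Equiv.swap i j p.1 < Equiv.swap i j p.2 ∧ a p.2 < a p.1 then (1 : ℤ) else 0 := by
    rw [key, ← Equiv.sum_comp ((Equiv.swap i j).prodCongr (Equiv.swap i j))]
    simp
  rw [re, key a, ← Finset.sum_sub_distrib]
  rw [← Finset.sum_subset (Finset.subset_univ {(j, i), (i, j)})]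
  · rw [Finset.sum_pair (by simp [hij])]
    have h1 : i < j := by rw [Fin.lt_def]; omega
    have h2 : ¬ j < i := by rw [Fin.lt_def]; omega
    simp [h1, h2]
    ring
  · rintro ⟨x, y⟩ _ hxy
    have hs : (Equiv.swap i j x < Equiv.swap i j y) ↔ x < y := by
      simp only [Finset.mem_insert, Finset.mem_singleton, Prod.mk.injEq, not_or, not_and] at hxy
      simp only [Equiv.swap_apply_def, Fin.lt_def, Fin.ext_iff] at *
      split_ifs <;> omega
    simp only [hs, sub_self]

theorem Pq_swap (q : ℂ) (N r : ℕ) (i j : Fin r) (h : j.val = i.val + 1) :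
    Pq q N (Equiv.swap i j) = onTwo i j (qPerm q N) := by
  have hij : i ≠ j := fun e => by simp [e] at h
  ext a b
  have hiff : a = b ∘ (Equiv.swap i j).symm ↔
      ((∀ k, k ≠ i → k ≠ j → a k = b k) ∧ a i = b j ∧ a j = b i) := by
    constructor
    · rintro rfl
      refine ⟨fun k hi hj => ?_, ?_, ?_⟩
      · simp [Equiv.swap_apply_of_ne_of_ne hi hj]
      · simp
      · simp
    · rintro ⟨h1, h2, h3⟩
      funext k
      by_cases hi : k = i
      · subst hi; simpa using h2
      · by_cases hj : k = j
        · subst hj; simpa using h3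
        · simpa [Equiv.swap_apply_of_ne_of_ne hi hj] using h1 k hi hj
  by_cases hab : a = b ∘ (Equiv.swap i j).symm
  · obtain ⟨h1, h2, h3⟩ := hiff.1 hab
    have hinv := inv_comp_swap b i j h
    rw [Equiv.symm_swap] at hab
    rw [← hab] at hinv
    simp only [Pq, Equiv.symm_swap, ← hab, if_true, hinv, onTwo, if_pos h1, qPerm, h2, h3,
      and_self]
    rcases lt_trichotomy (b i) (b j) with hlt | heq | hgt
    · simp [hlt, hlt.not_gt, hlt.ne']
    · simp [heq]
    · simp [hgt, hgt.not_gt, hgt.ne]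
  · have : ¬ ((∀ k, k ≠ i → k ≠ j → a k = b k) ∧ a i = b j ∧ a j = b i) := fun hh => hab (hiff.2 hh)
    simp only [Pq, if_neg hab, onTwo, qPerm]
    split_ifs <;> first | rfl | (exfalso; tauto)

/-! ## The Sklyanin determinant

All series are Laurent series in `u⁻¹`. -/

/-- The monomial `c u` (`c ∈ ℂ`). -/
def uMon {A : Type*} [Ring A] [Algebra ℂ A] (c : ℂ) : LaurentSeries A :=
  HahnSeries.single (-1) (algebraMap ℂ A c)

/-- The monomial `c u⁻¹` (`c ∈ ℂ`). -/
def uInvMon {A : Type*} [Ring A] [Algebra ℂ A] (c : ℂ) : LaurentSeries A :=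
  HahnSeries.single 1 (algebraMap ℂ A c)

/-- `S(c u) = ∑_r S^(r) c^{-r} u^{-r}`. -/
def Sat (q : ℂ) {N : ℕ} (κ : TwistType N) (c : ℂ) :
    Matrix (Fin N) (Fin N) (LaurentSeries (QAffine q N)) :=
  fun i j => HahnSeries.ofPowerSeries ℤ (QAffine q N)
    (PowerSeries.mk fun r => (c⁻¹) ^ r • sCoeff q κ i j r)

/-- `u_i = c_i u` with `c_i = q^{-2i+2}`, where `i` is counted from `1`. -/
def shift (q : ℂ) {N : ℕ} (i : Fin N) : ℂ := q ^ (-2 * (i.val : ℤ))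

/-- `S_i(u_i)` on the `i`-th factor of `(ℂ^N)^{⊗ N}`. -/
def Sfac (q : ℂ) {N : ℕ} (κ : TwistType N) (i : Fin N) :
    Matrix (Fin N → Fin N) (Fin N → Fin N) (LaurentSeries (QAffine q N)) :=
  onOne i (Sat q κ (shift q i))

/-- `R_ij^t = R_ij^t(u_i⁻¹, u_j)` on `(ℂ^N)^{⊗ N}`. -/
def RtFac (q : ℂ) {N : ℕ} (i j : Fin N) :
    Matrix (Fin N → Fin N) (Fin N → Fin N) (LaurentSeries (QAffine q N)) :=
  onTwo i j (Rt q N (uInvMon (shift q i)⁻¹) (uMon (shift q j)))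

/-- The indices `j > i`, in increasing order. -/
def above {N : ℕ} (i : Fin N) : List (Fin N) := (List.finRange N).filter fun j => i < j

/-- `A^q_N` with entries viewed as constant series. -/
def AqSer (q : ℂ) (N : ℕ) :
    Matrix (Fin N → Fin N) (Fin N → Fin N) (LaurentSeries (QAffine q N)) :=
  (Aq q N N).map (algebraMap ℂ (LaurentSeries (QAffine q N)))

/-- `A^q_N S_1(u) R_12^t ⋯ R_1N^t S_2(u q⁻²) R_23^t ⋯ R_2N^t S_3(u q⁻⁴) ⋯ R_{N-1,N}^t
S_N(u q^{-2N+2})`. -/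
def sdetLeft (q : ℂ) {N : ℕ} (κ : TwistType N) :
    Matrix (Fin N → Fin N) (Fin N → Fin N) (LaurentSeries (QAffine q N)) :=
  AqSer q N *
    ((List.finRange N).map fun i => Sfac q κ i * ((above i).map fun j => RtFac q i j).prod).prod

/-- `S_N(u q^{-2N+2}) R_{N-1,N}^t ⋯ S_3(u q⁻⁴) R_2N^t ⋯ R_23^t S_2(u q⁻²) R_1N^t ⋯ R_12^t S_1(u)
A^q_N`. -/
def sdetRight (q : ℂ) {N : ℕ} (κ : TwistType N) :
    Matrix (Fin N → Fin N) (Fin N → Fin N) (LaurentSeries (QAffine q N)) :=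
  ((List.finRange N).reverse.map fun i =>
      ((above i).reverse.map fun j => RtFac q i j).prod * Sfac q κ i).prod *
    AqSer q N

/-- `d = sdet S(u)`: both products above are equal to `A^q_N` times `d`. -/
def IsSklyaninDet (q : ℂ) {N : ℕ} (κ : TwistType N) (d : LaurentSeries (QAffine q N)) : Prop :=
  sdetLeft q κ = (AqSer q N).map (fun x => x * d) ∧
    sdetRight q κ = (AqSer q N).map (fun x => x * d)

/-- The extra factor of `γ_N(u)`: `1` for `𝔬_N`, and
`(q^{n-2} - q^n u²) / (q^{2n-2} - q^{-2n} u²)` for `𝔰𝔭_{2n}`. -/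
def gammaFactor (q : ℂ) : {N : ℕ} → TwistType N → LaurentSeries ℂ
  | _, .orth _ => 1
  | _, .symp n =>
      (HahnSeries.single 0 (q ^ ((n : ℤ) - 2)) - HahnSeries.single (-2) (q ^ (n : ℤ))) /
        (HahnSeries.single 0 (q ^ (2 * (n : ℤ) - 2)) - HahnSeries.single (-2) (q ^ (-2 * (n : ℤ))))

/-- `γ_N(u) = ∏_{i<j} (q^{2i-2} u⁻¹ - q^{-2j+2} u)` (with `i`, `j` counted from `1`) times the
extra factor, in the field of Laurent series in `u⁻¹`. -/
def gammaN (q : ℂ) {N : ℕ} (κ : TwistType N) : LaurentSeries ℂ :=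
  (∏ p : Fin N × Fin N with p.1 < p.2,
    ((uInvMon (q ^ (2 * (p.1.val : ℤ))) : LaurentSeries ℂ) - uMon (q ^ (-2 * (p.2.val : ℤ))))) *
  gammaFactor q κ

/-- `γ_N(u)⁻¹ d(u)`. -/
def normalized (q : ℂ) {N : ℕ} (κ : TwistType N) (d : LaurentSeries (QAffine q N)) :
    LaurentSeries (QAffine q N) :=
  (gammaN q κ)⁻¹.map (algebraMap ℂ (QAffine q N)) * d

end TwistedQYangian

end

noncomputable section

namespace TwistedQYangian

open Matrix Function

/-! ## Operators in chosen tensor factors -/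

section Sites

variable {B : Type*} [Ring B] {r N : ℕ}

/-! Row vectors indexed by multi-indices are functionals on (ℂ^N)^{⊗r} with values in an algebra B,
and operators act on them from the right. For r = N the functionals with φ P^q = -φ in all adjacent
factors are the B-multiples of one of them: the row η of A^q_N indexed by (1, …, N)
(`alt_eq_smul_eta`). An operator that preserves this alternation for every adjacent pair (`altPres`)
therefore multiplies η by a single element of B. Since all rows of A^q_N are proportional to η, the
first product in the theorem is governed by its action on η.

The third defining relation, transposed in the first factor, lets T̄^t pass T through R^t. As S = T
G T̄^t, all the T's can be collected on the left and all the T̄^t's on the right (`ordProd_factor`),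
which leaves in the middle the product K of the G_i and R^t_ij. Each piece preserves alternation:
the T's and T̄^t's because Ř has alternating image at u_i = q² u_{i+1} (`Xprod_mem_altPres`), and K
by cases of the Yang–Baxter equation and the reflection equation for G (`Kop_mem_altPres`). Hence
sdet S is det T · (scalar) · det T̄ with quantum determinants expanded along rows. The scalar is
read off from ηK at one multi-index, namely (1, …, N) in the orthogonal case and (1, 3, …, 2n-1, 2,
4, …, 2n) in the symplectic case, where it telescopes to γ_N.

The second product becomes one of the first kind over the opposite algebra, after transposition and
reversal of the indices. It produces determinants expanded along columns. They agree with the row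
determinants because the matrix element of X_1 ⋯ X_N between two copies of η does not change when
the order of the factors is reversed, and because ∑ η_b² is a product of q-integers, nonzero for q
not a root of unity (`colDet_eq_rowDet`).

After division by γ_N the series is det T · det T̄. Its constant term is 1 by triangularity. An
auxiliary factor of R-matrices acts on e* ⊗ η by a scalar, so each determinant commutes with T(cu)
and T̄(c⁻¹u⁻¹) for all but finitely many c, hence with every generator (`commute_rowDet`,
`commute_coeff_of_infinite`). The coefficients lie in the twisted q-Yangian because sdet S is an
entry of the first product. For independence, the homomorphisms T ↦ f(u⁻¹), T̄ ↦ 1 into a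
commutative domain send the series to the product of the f(q^{2i}u⁻¹), 0 ≤ i < N; every series with
constant term 1 has this form (`exists_prod_rescale_eq`), in particular one whose coefficients are
free variables. -/

theorem eq_of_vecMul_eq {m n : Type*} [Fintype m] [DecidableEq m] {X Y : Matrix m n B}
    (h : ∀ φ : m → B, φ ᵥ* X = φ ᵥ* Y) : X = Y := by
  ext a b
  have := congrFun (h (Pi.single a 1)) b
  simpa using this

/-- Only the rows that differ from `a` at most in the factor `i` contribute. All operator identities
below are checked in this form, as identities between values of functionals. -/
theorem vecMul_onOne (φ : (Fin r → Fin N) → B) (i : Fin r) (M : Matrix (Fin N) (Fin N) B)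
    (a : Fin r → Fin N) :
    (φ ᵥ* onOne i M) a = ∑ b, φ (update a i b) * M b (a i) := by
  rw [vecMul, dotProduct]
  symm
  refine Fintype.sum_of_injective (fun b => update a i b) (update_injective a i) _ _ ?_ ?_
  · intro c hc
    have : ¬ ∀ k, k ≠ i → c k = a k := by
      intro h
      apply hc
      refine ⟨c i, ?_⟩
      funext k
      by_cases hk : k = i
      · subst hk; simp
      · simp [hk, h k hk]
    simp only [onOne, if_neg this, mul_zero]
  · intro b
    have : ∀ k, k ≠ i → update a i b k = a k := fun k hk => update_of_ne hk _ _
    simp only [onOne, if_pos this, update_self]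

theorem vecMul_onTwo (φ : (Fin r → Fin N) → B) {i j : Fin r} (hij : i ≠ j)
    (M : Matrix (Fin N × Fin N) (Fin N × Fin N) B) (a : Fin r → Fin N) :
    (φ ᵥ* onTwo i j M) a =
      ∑ p : Fin N × Fin N, φ (update (update a i p.1) j p.2) * M p (a i, a j) := by
  rw [vecMul, dotProduct]
  symm
  refine Fintype.sum_of_injective (fun p : Fin N × Fin N => update (update a i p.1) j p.2)
    ?_ _ _ ?_ ?_
  · intro p p' h
    have h1 := congrFun h i
    have h2 := congrFun h j
    simp [hij] at h1 h2
    exact Prod.ext h1 h2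
  · intro c hc
    have : ¬ ∀ k, k ≠ i → k ≠ j → c k = a k := by
      intro h
      apply hc
      refine ⟨(c i, c j), ?_⟩
      funext k
      by_cases hk : k = j
      · subst hk; simp
      · by_cases hk' : k = i
        · subst hk'; simp [hij]
        · simp [hk, hk', h k hk' hk]
    simp only [onTwo, if_neg this, mul_zero]
  · intro p
    have : ∀ k, k ≠ i → k ≠ j → update (update a i p.1) j p.2 k = a k := fun k hk hk' => by
      simp [hk, hk']
    simp only [onTwo, if_pos this, update_self, update_of_ne hij]

theorem onTwo_mul {i j : Fin r} (hij : i ≠ j)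
    (M M' : Matrix (Fin N × Fin N) (Fin N × Fin N) B) :
    onTwo i j (M * M') = onTwo i j M * onTwo i j M' := by
  refine eq_of_vecMul_eq fun φ => ?_
  funext a
  rw [← vecMul_vecMul, vecMul_onTwo _ hij, vecMul_onTwo _ hij]
  simp_rw [vecMul_onTwo _ hij, Matrix.mul_apply, Finset.mul_sum, Finset.sum_mul]
  rw [Finset.sum_comm]
  refine Finset.sum_congr rfl fun p _ => Finset.sum_congr rfl fun p' _ => ?_
  have : update (update (update (update a i p.1) j p.2) i p'.1) j p'.2
      = update (update a i p'.1) j p'.2 := by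
    funext k
    by_cases hk : k = j
    · subst hk; simp
    · by_cases hk' : k = i
      · subst hk'; simp [hij]
      · simp [hk, hk']
  rw [this]
  simp [hij, mul_assoc]

theorem onOne_mul (i : Fin r) (M M' : Matrix (Fin N) (Fin N) B) :
    onOne i (M * M') = onOne i M * onOne i M' := by
  refine eq_of_vecMul_eq fun φ => ?_
  funext a
  rw [← vecMul_vecMul, vecMul_onOne, vecMul_onOne]
  simp_rw [vecMul_onOne, Matrix.mul_apply, Finset.mul_sum, Finset.sum_mul]
  rw [Finset.sum_comm]
  simp [mul_assoc]

theorem onOne_eq_onTwo_left {i j : Fin r} (hij : i ≠ j) (M : Matrix (Fin N) (Fin N) B) :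
    onOne i M = onTwo i j (M ⊗ₖ (1 : Matrix (Fin N) (Fin N) B)) := by
  ext a b
  simp only [onOne, onTwo, kroneckerMap_apply, Matrix.one_apply]
  by_cases h : ∀ k, k ≠ i → a k = b k
  · rw [if_pos h, if_pos fun k hk _ => h k hk, if_pos (h j hij.symm), mul_one]
  · rw [if_neg h]
    split_ifs with h1 h2
    · exact absurd (fun k hk => if hkj : k = j then hkj ▸ h2 else h1 k hk hkj) h
    · simp
    · rfl

theorem onOne_eq_onTwo_right {i j : Fin r} (hij : i ≠ j) (M : Matrix (Fin N) (Fin N) B) :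
    onOne j M = onTwo i j ((1 : Matrix (Fin N) (Fin N) B) ⊗ₖ M) := by
  ext a b
  simp only [onOne, onTwo, kroneckerMap_apply, Matrix.one_apply]
  by_cases h : ∀ k, k ≠ j → a k = b k
  · rw [if_pos h, if_pos fun k _ hk => h k hk, if_pos (h i hij), one_mul]
  · rw [if_neg h]
    split_ifs with h1 h2
    · exact absurd (fun k hk => if hki : k = i then hki ▸ h2 else h1 k hki hk) h
    · simp
    · rfl

theorem commute_onOne_onTwo {i j k : Fin r} (hij : i ≠ j) (hki : k ≠ i) (hkj : k ≠ j)
    {X : Matrix (Fin N) (Fin N) B} {M : Matrix (Fin N × Fin N) (Fin N × Fin N) B}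
    (h : ∀ a b c d, Commute (X a b) (M c d)) :
    Commute (onOne k X) (onTwo i j M) := by
  refine eq_of_vecMul_eq fun φ => ?_
  funext a
  rw [← vecMul_vecMul, ← vecMul_vecMul, vecMul_onTwo _ hij, vecMul_onOne]
  simp_rw [vecMul_onTwo _ hij, vecMul_onOne, Finset.sum_mul]
  rw [Finset.sum_comm]
  refine Finset.sum_congr rfl fun p _ => Finset.sum_congr rfl fun p' _ => ?_
  rw [update_comm hkj.symm, update_comm hki.symm]
  simp [hki, hkj, hki.symm, hkj.symm, mul_assoc, (h _ _ _ _).eq]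

theorem commute_onOne_onOne {i j : Fin r} (hij : i ≠ j) {X Y : Matrix (Fin N) (Fin N) B}
    (h : ∀ a b c d, Commute (X a b) (Y c d)) :
    Commute (onOne i X) (onOne j Y) := by
  refine eq_of_vecMul_eq fun φ => ?_
  funext a
  rw [← vecMul_vecMul, ← vecMul_vecMul, vecMul_onOne, vecMul_onOne]
  simp_rw [vecMul_onOne, Finset.sum_mul]
  rw [Finset.sum_comm]
  refine Finset.sum_congr rfl fun p _ => Finset.sum_congr rfl fun p' _ => ?_
  rw [update_comm hij]
  simp [hij, hij.symm, mul_assoc, (h _ _ _ _).eq]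

theorem commute_onTwo_onTwo {i j k l : Fin r} (hij : i ≠ j) (hkl : k ≠ l) (hki : k ≠ i)
    (hkj : k ≠ j) (hli : l ≠ i) (hlj : l ≠ j)
    {M M' : Matrix (Fin N × Fin N) (Fin N × Fin N) B}
    (h : ∀ a b c d, Commute (M a b) (M' c d)) :
    Commute (onTwo i j M) (onTwo k l M') := by
  refine eq_of_vecMul_eq fun φ => ?_
  funext a
  rw [← vecMul_vecMul, ← vecMul_vecMul, vecMul_onTwo _ hij, vecMul_onTwo _ hkl]
  simp_rw [vecMul_onTwo _ hij, vecMul_onTwo _ hkl, Finset.sum_mul]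
  rw [Finset.sum_comm]
  refine Finset.sum_congr rfl fun p _ => Finset.sum_congr rfl fun p' _ => ?_
  rw [update_comm hli, update_comm hki, update_comm hlj, update_comm hkj]
  simp [hki, hkj, hli, hlj, hki.symm, hkj.symm, hli.symm, hlj.symm, mul_assoc, (h _ _ _ _).eq]

/-- An ordered product of operators in distinct tensor factors. -/
theorem prod_onOne_apply (X : Fin r → Matrix (Fin N) (Fin N) B) (l : List (Fin r))
    (hl : l.Nodup) (a b : Fin r → Fin N) :
    (l.map fun i => onOne i (X i)).prod a b =
      if ∀ k, k ∉ l → a k = b k then (l.map fun i => X i (a i) (b i)).prod else 0 := by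
  induction l generalizing a with
  | nil =>
    simp only [List.map_nil, List.prod_nil, Matrix.one_apply, List.not_mem_nil, not_false_eq_true,
      forall_const, ← funext_iff]
  | cons i l ih =>
    obtain ⟨hi, hl⟩ := List.nodup_cons.1 hl
    rw [List.map_cons, List.prod_cons, Matrix.mul_apply, Finset.sum_eq_single (update a i (b i))]
    · rw [ih hl]
      have h1 : ∀ k, k ≠ i → a k = update a i (b i) k := fun k hk => by simp [hk]
      have h2 : (∀ k, k ∉ l → update a i (b i) k = b k) ↔ ∀ k, k ∉ i :: l → a k = b k := by
        constructor
        · intro h k hk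
          rw [List.mem_cons, not_or] at hk
          simpa [hk.1] using h k hk.2
        · intro h k hk
          by_cases hki : k = i
          · subst hki; simp
          · simpa [hki] using h k (by simp [hki, hk])
      have h3 : (l.map fun j => X j (update a i (b i) j) (b j)) = l.map fun j => X j (a j) (b j) := by
        refine List.map_congr_left fun j hj => ?_
        rw [update_of_ne (fun e : j = i => hi (e ▸ hj))]
      simp only [onOne, if_pos h1, h2, h3, update_self, List.map_cons, List.prod_cons, mul_ite,
        mul_zero]
    · intro c _ hc
      by_cases h : ∀ k, k ≠ i → a k = c k
      · rw [ih hl, if_neg, mul_zero]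
        intro h'
        apply hc
        funext k
        by_cases hk : k = i
        · subst hk; simp [h' k hi]
        · simp [hk, h k hk]
      · simp only [onOne, if_neg h, zero_mul]
    · simp

end Sites

/-! ## `q`-alternating functionals -/

section Alt

variable {r N : ℕ}

/-- The functional `φ` on `(ℂ^N)^{⊗ r}` satisfies `φ ∘ P^q = - φ` in the factors `i`, `j`. -/
def IsAlt {V : Type*} [AddCommGroup V] [Module ℂ V] (q : ℂ) (i j : Fin r)
    (φ : (Fin r → Fin N) → V) : Prop :=
  ∀ a, (a i = a j → φ a = 0) ∧ (a i < a j → φ a = -(q • φ (a ∘ Equiv.swap i j)))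

theorem IsAlt.eq_neg_inv {V : Type*} [AddCommGroup V] [Module ℂ V] {q : ℂ} (hq : q ≠ 0)
    {i j : Fin r} {φ : (Fin r → Fin N) → V} (h : IsAlt q i j φ) {a : Fin r → Fin N}
    (ha : a j < a i) : φ a = -(q⁻¹ • φ (a ∘ Equiv.swap i j)) := by
  have := (h (a ∘ Equiv.swap i j)).2 (by simpa using ha)
  rw [this, smul_neg, smul_smul, inv_mul_cancel₀ hq, neg_neg, one_smul]
  congr 1
  funext k
  simp

theorem IsAlt.sub {V : Type*} [AddCommGroup V] [Module ℂ V] {q : ℂ} {i j : Fin r}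
    {φ ψ : (Fin r → Fin N) → V} (h : IsAlt q i j φ) (h' : IsAlt q i j ψ) :
    IsAlt q i j (φ - ψ) := by
  intro a
  refine ⟨fun ha => ?_, fun ha => ?_⟩
  · simp [(h a).1 ha, (h' a).1 ha]
  · simp only [Pi.sub_apply, (h a).2 ha, (h' a).2 ha, smul_sub]
    abel

variable {B : Type*} [Ring B] [Algebra ℂ B]

/-- The operators preserving the functionals that are `q`-alternating in the factors `i`, `j`. -/
def altPres (B : Type*) [Ring B] [Algebra ℂ B] (N : ℕ) (q : ℂ) (i j : Fin r) :
    Submonoid (Matrix (Fin r → Fin N) (Fin r → Fin N) B) where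
  carrier := {X | ∀ φ, IsAlt q i j φ → IsAlt q i j (φ ᵥ* X)}
  one_mem' := fun φ h => by simpa using h
  mul_mem' := fun {X Y} hX hY φ h => by
    rw [← vecMul_vecMul]
    exact hY _ (hX _ h)

/-- The entries of X multiply the values of φ on the right and leave the factors `i`, `j` alone,
whereas alternation is a ℂ-linear condition on the values; no commutativity of the entries is
needed. -/
theorem onOne_mem_altPres (q : ℂ) {i j k : Fin r} (hki : k ≠ i) (hkj : k ≠ j)
    (X : Matrix (Fin N) (Fin N) B) : onOne k X ∈ altPres B N q i j := by
  intro φ h a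
  have hsw : ∀ b, update a k b ∘ Equiv.swap i j = update (a ∘ Equiv.swap i j) k b := by
    intro b
    funext m
    by_cases hm : m = k
    · subst hm; simp [Equiv.swap_apply_of_ne_of_ne hki hkj]
    · have : Equiv.swap i j m ≠ k := by
        intro e
        apply hm
        rw [← Equiv.swap_apply_of_ne_of_ne hki hkj] at e
        exact (Equiv.swap i j).injective e
      simp [hm, this]
  refine ⟨fun ha => ?_, fun ha => ?_⟩
  · rw [vecMul_onOne]
    refine Finset.sum_eq_zero fun b _ => ?_
    rw [(h _).1 (by simpa [hki.symm, hkj.symm] using ha), zero_mul]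
  · rw [vecMul_onOne, vecMul_onOne, Finset.smul_sum, ← Finset.sum_neg_distrib]
    refine Finset.sum_congr rfl fun b _ => ?_
    rw [(h _).2 (by simpa [hki.symm, hkj.symm] using ha), hsw]
    simp [Equiv.swap_apply_of_ne_of_ne hki hkj]

theorem onTwo_mem_altPres (q : ℂ) {i j k l : Fin r} (hkl : k ≠ l) (hki : k ≠ i) (hkj : k ≠ j)
    (hli : l ≠ i) (hlj : l ≠ j)
    (X : Matrix (Fin N × Fin N) (Fin N × Fin N) B) : onTwo k l X ∈ altPres B N q i j := by
  intro φ h a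
  have hsw : ∀ (k : Fin r) (a : Fin r → Fin N) b, k ≠ i → k ≠ j →
      update a k b ∘ Equiv.swap i j = update (a ∘ Equiv.swap i j) k b := by
    intro k a b hki hkj
    funext m
    by_cases hm : m = k
    · subst hm; simp [Equiv.swap_apply_of_ne_of_ne hki hkj]
    · have : Equiv.swap i j m ≠ k := by
        intro e
        apply hm
        rw [← Equiv.swap_apply_of_ne_of_ne hki hkj] at e
        exact (Equiv.swap i j).injective e
      simp [hm, this]
  refine ⟨fun ha => ?_, fun ha => ?_⟩
  · rw [vecMul_onTwo _ hkl]
    refine Finset.sum_eq_zero fun b _ => ?_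
    rw [(h _).1 (by simpa [hki.symm, hkj.symm, hli.symm, hlj.symm] using ha), zero_mul]
  · rw [vecMul_onTwo _ hkl, vecMul_onTwo _ hkl, Finset.smul_sum, ← Finset.sum_neg_distrib]
    refine Finset.sum_congr rfl fun b _ => ?_
    rw [(h _).2 (by simpa [hki.symm, hkj.symm, hli.symm, hlj.symm] using ha), hsw _ _ _ hli hlj,
      hsw _ _ _ hki hkj]
    simp [Equiv.swap_apply_of_ne_of_ne hki hkj, Equiv.swap_apply_of_ne_of_ne hli hlj]

end Alt

end TwistedQYangian

end

noncomputable section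

namespace TwistedQYangian

open Matrix Function

/-! ### The one-dimensional space of alternating functionals and the rank of A^q_N. -/

section Antisymmetrizer

variable {r N : ℕ} {V : Type*} [AddCommGroup V] [Module ℂ V] {q : ℂ}

/-- A functional that is alternating in all adjacent factors between `j` and `k` vanishes on the
multi-indices with equal entries in `j` and `k`. -/
theorem alt_eq_zero_of_eq (hq : q ≠ 0) {φ : (Fin r → Fin N) → V} {j : Fin r} :
    ∀ (d : ℕ) (k : Fin r), k.val = j.val + 1 + d →
      (∀ m m' : Fin r, j ≤ m → m' ≤ k → m'.val = m.val + 1 → IsAlt q m m' φ) →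
      ∀ b : Fin r → Fin N, b j = b k → φ b = 0 := by
  intro d
  induction d with
  | zero => exact fun k hk h b hb => (h j k le_rfl le_rfl (by omega) b).1 hb
  | succ d ih =>
    intro k hk h b hb
    have hk' : k.val - 1 < r := by omega
    set k' : Fin r := ⟨k.val - 1, hk'⟩ with hk'def
    have hkk : k.val = k'.val + 1 := by simp [hk'def]; omega
    have hjk' : j < k' := by rw [Fin.lt_def]; simp [hk'def]; omega
    have hjk : j < k := by rw [Fin.lt_def]; omega
    have hk'k : k' ≤ k := by rw [Fin.le_def]; omega
    -- Swapping `k` with its left neighbour brings the repeated value one factor closer to `j`, and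
    -- by alternation it changes φ only by a nonzero scalar.
    have h0 : φ (b ∘ Equiv.swap k' k) = 0 := by
      refine ih k' (by simp [hk'def]; omega) (fun m m' hm hm' => h m m' hm (hm'.trans hk'k)) _ ?_
      simp [Equiv.swap_apply_of_ne_of_ne hjk'.ne hjk.ne, hb]
    rcases lt_trichotomy (b k') (b k) with hlt | heq | hgt
    · rw [(h k' k hjk'.le le_rfl hkk b).2 hlt, h0]; simp
    · exact (h k' k hjk'.le le_rfl hkk b).1 heq
    · rw [(h k' k hjk'.le le_rfl hkk).eq_neg_inv hq hgt, h0]; simp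

/-- Adjacent transpositions generate the symmetric group, and each of them multiplies a value of φ
by -q or -q⁻¹, or fixes a multi-index where φ vanishes. -/
theorem alt_comp_perm_eq_zero (hq : q ≠ 0) {φ : (Fin r → Fin N) → V}
    (h : ∀ m m' : Fin r, m'.val = m.val + 1 → IsAlt q m m' φ) (σ : Equiv.Perm (Fin r)) :
    ∀ a, φ a = 0 → φ (a ∘ σ) = 0 := by
  rcases r with _ | r
  · intro a ha
    rwa [Subsingleton.elim (a ∘ σ) a]
  have hσ : σ ∈ Submonoid.closure (Set.range fun i : Fin r => Equiv.swap i.castSucc i.succ) := by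
    rw [Equiv.Perm.mclosure_swap_castSucc_succ]; trivial
  induction hσ using Submonoid.closure_induction with
  | one => exact fun a ha => ha
  | mem x hx =>
    obtain ⟨i, rfl⟩ := hx
    intro a ha
    have hi := h i.castSucc i.succ (by simp)
    rcases lt_trichotomy (a i.castSucc) (a i.succ) with hlt | heq | hgt
    · have := (hi a).2 hlt
      rw [ha, zero_eq_neg, smul_eq_zero] at this
      exact this.resolve_left hq
    · exact (hi _).1 (by simpa using heq.symm)
    · have := hi.eq_neg_inv hq hgt
      rw [ha, zero_eq_neg, smul_eq_zero] at this
      exact this.resolve_left (inv_ne_zero hq)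
  | mul x y _ _ hx hy =>
    intro a ha
    exact hy _ (hx _ ha)

/-- An injective multi-index of length N is a permutation of (1, …, N), so the value at `id`
controls it; a multi-index with a repetition gives 0. Hence alternating functionals are determined
by their value at `id`. -/
theorem alt_eq_zero (hq : q ≠ 0) {φ : (Fin N → Fin N) → V}
    (h : ∀ m m' : Fin N, m'.val = m.val + 1 → IsAlt q m m' φ) (h0 : φ id = 0) : φ = 0 := by
  funext a
  by_cases ha : Injective a
  · exact alt_comp_perm_eq_zero hq h
      (Equiv.ofBijective a (Finite.injective_iff_bijective.1 ha)) id h0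
  · rw [Injective] at ha
    push Not at ha
    obtain ⟨j, k, hjk, hne⟩ := ha
    wlog hlt : j < k generalizing j k
    · exact this k j hjk.symm hne.symm (lt_of_le_of_ne (not_lt.1 hlt) hne.symm)
    · exact alt_eq_zero_of_eq hq (k.val - j.val - 1) k (by rw [Fin.lt_def] at hlt; omega)
        (fun m m' _ _ hm => h m m' hm) a hjk

theorem Aq_mul_Pq_swap (hq : q ≠ 0) (N r : ℕ) {i j : Fin r} (hij : i ≠ j) :
    Aq q N r * Pq q N (Equiv.swap i j) = -Aq q N r := by
  rw [Aq, Finset.sum_mul, ← Finset.sum_neg_distrib]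
  refine Fintype.sum_equiv (Equiv.mulRight (Equiv.swap i j)) _ _ fun σ => ?_
  rw [Matrix.smul_mul, ← Pq_mul q hq, Equiv.coe_mulRight]
  simp [Equiv.Perm.sign_mul, Equiv.Perm.sign_swap hij]

theorem Pq_swap_mul_Aq (hq : q ≠ 0) (N r : ℕ) {i j : Fin r} (hij : i ≠ j) :
    Pq q N (Equiv.swap i j) * Aq q N r = -Aq q N r := by
  rw [Aq, Finset.mul_sum, ← Finset.sum_neg_distrib]
  refine Fintype.sum_equiv (Equiv.mulLeft (Equiv.swap i j)) _ _ fun σ => ?_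
  rw [Matrix.mul_smul, ← Pq_mul q hq, Equiv.coe_mulLeft]
  simp [Equiv.Perm.sign_mul, Equiv.Perm.sign_swap hij]

theorem isAlt_Aq (hq : q ≠ 0) (N : ℕ) {r : ℕ} (a : Fin r → Fin N) (i j : Fin r)
    (h : j.val = i.val + 1) : IsAlt q i j (Aq q N r a) := by
  have hij : i ≠ j := fun e => by simp [e] at h
  have key : ∀ c, Aq q N r a (c ∘ Equiv.swap i j) *
      q ^ ((if c i < c j then (1 : ℤ) else 0) - (if c j < c i then 1 else 0)) = -Aq q N r a c := by
    intro c
    have := congrFun (congrFun (Aq_mul_Pq_swap hq N r hij) a) c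
    rw [Matrix.neg_apply, Matrix.mul_apply, Finset.sum_eq_single (c ∘ Equiv.swap i j)] at this
    · rw [← this, Pq, Equiv.symm_swap, if_pos rfl, ← inv_comp_swap c i j h]
    · intro b _ hb
      simp [Pq, hb]
    · simp
  intro c
  refine ⟨fun hc => ?_, fun hc => ?_⟩
  · have hk := key c
    have hcc : c ∘ Equiv.swap i j = c := by
      rw [Equiv.comp_swap_eq_update]; simp [hc]
    rw [hcc] at hk
    simp [hc] at hk
    -- P^q fixes a pair of equal entries, so this value is its own negative.
    linear_combination (1 / 2) * hk
  · have hk := key c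
    simp [hc, hc.not_gt] at hk
    rw [smul_eq_mul]
    linear_combination hk

/-- The columns of the antisymmetrizer, read from right to left, are `q`-alternating. -/
theorem isAlt_Aq_rev (hq : q ≠ 0) (N : ℕ) {r : ℕ} (c : Fin r → Fin N) (i j : Fin r)
    (h : j.val = i.val + 1) : IsAlt q i j (fun a => Aq q N r (a ∘ Fin.rev) c) := by
  have hr : i.rev.val = j.rev.val + 1 := by simp [Fin.val_rev]; omega
  have hij : j.rev ≠ i.rev := fun e => by simp [e] at hr
  have key : ∀ a, q ^ ((if a i.rev < a j.rev then (1 : ℤ) else 0) -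
      (if a j.rev < a i.rev then 1 else 0)) * Aq q N r (a ∘ Equiv.swap j.rev i.rev) c =
        -Aq q N r a c := by
    intro a
    have := congrFun (congrFun (Pq_swap_mul_Aq hq N r hij) a) c
    rw [Matrix.neg_apply, Matrix.mul_apply,
      Finset.sum_eq_single (a ∘ Equiv.swap j.rev i.rev)] at this
    · have hi := inv_comp_swap a j.rev i.rev hr
      have haa : a = (a ∘ Equiv.swap j.rev i.rev) ∘ Equiv.swap j.rev i.rev := by
        funext k; simp
      rw [← this, Pq, Equiv.symm_swap, if_pos haa]
      congr 2
      linarith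
    · intro b _ hb
      rw [Pq, if_neg, zero_mul]
      rintro rfl
      apply hb
      funext k
      simp
    · simp
  intro a
  have hsw : (a ∘ Fin.rev) ∘ Equiv.swap j.rev i.rev = (a ∘ Equiv.swap i j) ∘ Fin.rev := by
    funext k
    simp only [Function.comp_apply, Equiv.swap_apply_def, Fin.rev_eq_iff]
    split_ifs <;> simp_all
  have hk := key (a ∘ Fin.rev)
  rw [hsw] at hk
  refine ⟨fun ha => ?_, fun ha => ?_⟩
  · have hcc : a ∘ Equiv.swap i j = a := by
      rw [Equiv.comp_swap_eq_update]; simp [ha]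
    rw [hcc] at hk
    simp [ha] at hk
    linear_combination (1 / 2) * hk
  · simp [ha, ha.not_gt] at hk
    simp only [smul_eq_mul]
    linear_combination hk

theorem inv_id (N : ℕ) : inv (id : Fin N → Fin N) = 0 := by
  rw [inv, Finset.card_eq_zero, Finset.filter_eq_empty_iff]
  rintro p _ ⟨h1, h2⟩
  exact absurd h1 h2.not_gt

/-- The row of the antisymmetrizer indexed by `(1, …, N)`. -/
def etaC (q : ℂ) (N : ℕ) (c : Fin N → Fin N) : ℂ := Aq q N N id c

/-- In the row `id` of the sum over 𝔖_N and the column `w`, only the summand σ = w has a nonzero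
entry. -/
theorem etaC_perm (q : ℂ) (N : ℕ) (w : Equiv.Perm (Fin N)) :
    etaC q N w = ((Equiv.Perm.sign w : ℤ) : ℂ) * q ^ (-(inv (w : Fin N → Fin N) : ℤ)) := by
  rw [etaC, Aq, Matrix.sum_apply, Finset.sum_eq_single w]
  · have : (id : Fin N → Fin N) = w ∘ w.symm := by funext k; simp
    simp only [Matrix.smul_apply, Pq, smul_eq_mul]
    rw [if_pos this, inv_id]
    simp
  · intro σ _ hσ
    simp only [Matrix.smul_apply, Pq, smul_eq_mul]
    rw [if_neg, mul_zero]
    intro h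
    apply hσ
    ext k
    have := congrFun h (σ k)
    simp at this
    rw [this]
  · simp

theorem etaC_id (q : ℂ) (N : ℕ) : etaC q N id = 1 := by
  have := etaC_perm q N 1
  rw [Equiv.Perm.coe_one] at this
  simp [this, inv_id]

theorem isAlt_etaC (hq : q ≠ 0) (N : ℕ) (i j : Fin N) (h : j.val = i.val + 1) :
    IsAlt q i j (etaC q N) := isAlt_Aq hq N id i j h

/-- The difference of the two sides is alternating and vanishes at `id`, where η equals 1. -/
theorem alt_eq_smul_etaC (hq : q ≠ 0) {φ : (Fin N → Fin N) → V}
    (h : ∀ m m' : Fin N, m'.val = m.val + 1 → IsAlt q m m' φ) (a : Fin N → Fin N) :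
    φ a = etaC q N a • φ id := by
  have h0 : (φ - fun a => etaC q N a • φ id) = 0 := by
    refine alt_eq_zero hq (fun m m' hm => (h m m' hm).sub ?_) (by simp [etaC_id])
    intro a
    refine ⟨fun ha => ?_, fun ha => ?_⟩
    · simp [(isAlt_etaC hq N m m' hm a).1 ha]
    · simp only [(isAlt_etaC hq N m m' hm a).2 ha, neg_smul, smul_assoc]
  exact sub_eq_zero.1 (congrFun h0 a)

/-- This is the rank one property of A^q_N: each row is alternating, hence a multiple of η. -/
theorem Aq_apply (hq : q ≠ 0) (N : ℕ) (a c : Fin N → Fin N) :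
    Aq q N N a c = Aq q N N a id * etaC q N c := by
  rw [alt_eq_smul_etaC hq (fun m m' hm => isAlt_Aq hq N a m m' hm) c, smul_eq_mul, mul_comm]

theorem Aq_rev_apply (hq : q ≠ 0) (N : ℕ) (a : Fin N → Fin N) :
    Aq q N N (a ∘ Fin.rev) id = etaC q N a * Aq q N N Fin.rev id :=
  alt_eq_smul_etaC hq (fun m m' hm => isAlt_Aq_rev hq N id m m' hm) a

theorem etaC_ne_zero_of_injective (hq : q ≠ 0) {a : Fin N → Fin N} (ha : Injective a) :
    etaC q N a ≠ 0 := by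
  have := etaC_perm q N (Equiv.ofBijective a (Finite.injective_iff_bijective.1 ha))
  rw [Equiv.coe_ofBijective] at this
  rw [this]
  refine mul_ne_zero ?_ (zpow_ne_zero _ hq)
  rcases Int.units_eq_one_or (Equiv.Perm.sign (Equiv.ofBijective a
    (Finite.injective_iff_bijective.1 ha))) with h | h <;> simp [h]

theorem etaC_eq_zero_of_not_injective (hq : q ≠ 0) {a : Fin N → Fin N} (ha : ¬ Injective a) :
    etaC q N a = 0 := by
  rw [Injective] at ha
  push Not at ha
  obtain ⟨j, k, hjk, hne⟩ := ha
  wlog hlt : j < k generalizing j k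
  · exact this k j hjk.symm hne.symm (lt_of_le_of_ne (not_lt.1 hlt) hne.symm)
  · exact alt_eq_zero_of_eq hq (k.val - j.val - 1) k (by rw [Fin.lt_def] at hlt; omega)
      (fun m m' _ _ hm => isAlt_etaC hq N m m' hm) a hjk

end Antisymmetrizer

/-! ## The generating function of inversions -/

section Poincare

/-- The permutation of `{0, …, n}` with `0 ↦ k` whose restriction to the other entries has the
relative order of `σ`. -/
def consPerm {n : ℕ} (k : Fin (n + 1)) (σ : Equiv.Perm (Fin n)) : Equiv.Perm (Fin (n + 1)) :=
  Equiv.ofBijective (Fin.cons k (k.succAbove ∘ σ)) <| by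
    refine Finite.injective_iff_bijective.1 (Fin.cons_injective_iff.2 ⟨?_, ?_⟩)
    · rintro ⟨i, hi⟩
      exact Fin.succAbove_ne _ _ hi
    · exact Fin.succAbove_right_injective.comp σ.injective

theorem consPerm_bijective (n : ℕ) :
    Bijective (fun p : Fin (n + 1) × Equiv.Perm (Fin n) => consPerm p.1 p.2) := by
  rw [Fintype.bijective_iff_injective_and_card]
  constructor
  · rintro ⟨k, σ⟩ ⟨k', σ'⟩ h
    have h' : (Fin.cons k (k.succAbove ∘ σ) : Fin (n + 1) → Fin (n + 1)) =
        Fin.cons k' (k'.succAbove ∘ σ') := congrArg (fun e : Equiv.Perm _ => (e : _ → _)) h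
    obtain ⟨rfl, h2⟩ := Fin.cons_injective2 h'
    congr
    ext i
    have := congrFun h2 i
    rw [Function.comp_apply, Function.comp_apply] at this
    rw [Fin.succAbove_right_injective this]
  · simp [Fintype.card_perm, Nat.factorial_succ]

/-- The first entry k exceeds exactly k of the later ones, which accounts for k inversions; all
others are inversions of σ. -/
theorem inv_consPerm {n : ℕ} (k : Fin (n + 1)) (σ : Equiv.Perm (Fin n)) :
    inv (consPerm k σ : Fin (n + 1) → Fin (n + 1)) = k.val + inv (σ : Fin n → Fin n) := by
  have key : ∀ (m : ℕ) (b : Fin m → Fin m), inv b =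
      ∑ i, ∑ j, if i < j ∧ b j < b i then 1 else 0 := by
    intro m b
    rw [inv, Finset.card_filter, Fintype.sum_prod_type]
  have h0 : (consPerm k σ) 0 = k := rfl
  have hs : ∀ i : Fin n, (consPerm k σ) i.succ = k.succAbove (σ i) := fun _ => rfl
  rw [key, key, Fin.sum_univ_succ, Fin.sum_univ_succ]
  simp only [Fin.sum_univ_succ (n := n)]
  simp only [h0, hs, Fin.succAbove_lt_succAbove_iff, Fin.succ_lt_succ_iff, Fin.succ_pos, true_and,
    lt_irrefl, false_and, if_false, Fin.not_lt_zero, zero_add]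
  congr 1
  rw [Equiv.sum_comp σ (fun m => if k.succAbove m < k then 1 else 0)]
  simp only [Fin.succAbove_lt_iff_castSucc_lt]
  rw [← Finset.card_filter]
  refine (Finset.card_bij (t := Finset.range k.val) (fun i _ => i.val) ?_ ?_ ?_).trans
    (Finset.card_range _)
  · intro i hi
    simpa [Fin.lt_def] using hi
  · exact fun i _ j _ h => Fin.ext h
  · intro m hm
    rw [Finset.mem_range] at hm
    exact ⟨⟨m, by omega⟩, by simpa [Fin.lt_def] using hm, rfl⟩

/-- The Poincaré polynomial of 𝔖_n is the x-factorial; the recursion splits off the first entry of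
the permutation by `consPerm`. -/
theorem sum_pow_inv (x : ℂ) (n : ℕ) :
    ∑ w : Equiv.Perm (Fin n), x ^ inv (w : Fin n → Fin n) =
      ∏ k ∈ Finset.range n, ∑ j ∈ Finset.range (k + 1), x ^ j := by
  induction n with
  | zero => simp [inv]
  | succ n ih =>
    rw [Finset.prod_range_succ, ← ih, ← (Equiv.ofBijective _ (consPerm_bijective n)).sum_comp,
      Fintype.sum_prod_type, mul_comm, Finset.sum_mul_sum, Finset.sum_range]
    simp [inv_consPerm, pow_add]

/-- Since η_w = sgn(w) q^{-inv w}, the sum is the Poincaré polynomial of 𝔖_N at q⁻², a product of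
geometric sums that vanish only if q is a root of unity. This is the constant by which row and
column determinants are compared. -/
theorem sum_etaC_sq_ne_zero {q : ℂ} (hq0 : q ≠ 0) (hq : ∀ m : ℕ, 0 < m → q ^ m ≠ 1) (N : ℕ) :
    ∑ b, etaC q N b * etaC q N b ≠ 0 := by
  have h1 : ∑ b, etaC q N b * etaC q N b =
      ∑ w : Equiv.Perm (Fin N), (q⁻¹ ^ 2) ^ inv (w : Fin N → Fin N) := by
    symm
    refine Fintype.sum_of_injective (fun w : Equiv.Perm (Fin N) => (w : Fin N → Fin N))
      DFunLike.coe_injective _ _ ?_ ?_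
    · intro b hb
      rw [etaC_eq_zero_of_not_injective hq0, zero_mul]
      intro hi
      exact hb ⟨Equiv.ofBijective b (Finite.injective_iff_bijective.1 hi), rfl⟩
    · intro w
      rw [etaC_perm]
      have : ((Equiv.Perm.sign w : ℤ) : ℂ) * ((Equiv.Perm.sign w : ℤ) : ℂ) = 1 := by
        rcases Int.units_eq_one_or (Equiv.Perm.sign w) with h | h <;> simp [h]
      rw [mul_mul_mul_comm, this, one_mul, _root_.zpow_neg, zpow_natCast, ← pow_mul, inv_pow, mul_comm 2,
        pow_mul, sq, mul_inv]
  rw [h1, sum_pow_inv, Finset.prod_ne_zero_iff]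
  intro k _ h0
  have hg := geom_sum_mul (q⁻¹ ^ 2) (k + 1)
  rw [h0, zero_mul] at hg
  refine hq (2 * (k + 1)) (by omega) ?_
  have : (q⁻¹ ^ 2) ^ (k + 1) = 1 := by linear_combination -hg
  rw [← pow_mul, inv_pow] at this
  rw [← _root_.inv_inj, this, inv_one]

end Poincare

end TwistedQYangian

end

noncomputable section

namespace TwistedQYangian

open Matrix Function

/-! ## The action of the `R`-matrices on functionals -/

section RowFormulas

variable {Z : Type*} [Field Z] [Algebra ℂ Z] {B : Type*} [Ring B] [Algebra ℂ B] [Algebra Z B]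
  [IsScalarTower ℂ Z B] {r N : ℕ} {q : ℂ}

theorem Rmat_map {A A' F : Type*} [Ring A] [Algebra ℂ A] [Ring A'] [Algebra ℂ A']
    [FunLike F A A'] [AlgHomClass F ℂ A A'] (f : F) (q : ℂ) (N : ℕ) (u v : A) :
    (Rmat q N u v).map f = Rmat q N (f u) (f v) := by
  ext a b
  simp only [Matrix.map_apply, Rmat]
  split_ifs <;> simp

theorem Rt_map {A A' F : Type*} [Ring A] [Algebra ℂ A] [Ring A'] [Algebra ℂ A']
    [FunLike F A A'] [AlgHomClass F ℂ A A'] (f : F) (q : ℂ) (N : ℕ) (u v : A) :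
    (Rt q N u v).map f = Rt q N (f u) (f v) := by
  ext a b
  simp only [Rt, ← Rmat_map, Matrix.map_apply]

/-- `Ř(u, v)`, the product of the permutation operator and `R(u, v)`. -/
def Rch {A : Type*} [Ring A] [Algebra ℂ A] (q : ℂ) (N : ℕ) (u v : A) :
    Matrix (Fin N × Fin N) (Fin N × Fin N) A :=
  fun a b => Rmat q N u v a.swap b

theorem update_update_eq_comp_swap {i j : Fin r} (hij : i ≠ j) (a : Fin r → Fin N) :
    update (update a i (a j)) j (a i) = a ∘ Equiv.swap i j := by
  rw [Equiv.comp_swap_eq_update, update_comm hij]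

theorem mul_algebraMap_eq_smul (z : Z) (b : B) : b * algebraMap Z B z = z • b := by
  rw [Algebra.smul_def, Algebra.commutes]

/-- The scalar `q` as an element of the field `Z`. -/
local notation "Q" => algebraMap ℂ Z q

theorem vecMul_Rmat (φ : (Fin r → Fin N) → B) {i j : Fin r} (hij : i ≠ j) (x y : Z)
    (a : Fin r → Fin N) :
    (φ ᵥ* onTwo i j ((Rmat q N x y).map (algebraMap Z B))) a =
      if a i = a j then ((Q)⁻¹ * x - Q * y) • φ a
      else (x - y) • φ a +
        (((Q)⁻¹ - Q) * (if a i < a j then x else y)) • φ (a ∘ Equiv.swap i j) := by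
  rw [vecMul_onTwo _ hij]
  simp only [Matrix.map_apply, mul_algebraMap_eq_smul]
  split_ifs with h hlt
  · rw [Fintype.sum_eq_single (a i, a j)]
    · have hu : update (update a i (a i)) j (a j) = a := by simp
      simp only [hu]
      simp [Rmat, h, Algebra.smul_def]
    · rintro ⟨b, c⟩ hp
      have : ¬ (b = a j ∧ c = a i) := by
        rintro ⟨rfl, rfl⟩; exact hp (by rw [h])
      simp only [Rmat, if_neg hp, if_neg this, zero_smul]
  all_goals
    rw [Fintype.sum_eq_add (a i, a j) (a j, a i) (by simp [h])]
    · have h' : ¬ a j = a i := fun e => h e.symm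
      simp [Rmat, h, h', hlt, Algebra.smul_def, update_update_eq_comp_swap hij]
    · rintro ⟨b, c⟩ ⟨hp, hp'⟩
      have : ¬ (b = a j ∧ c = a i) := by
        rintro ⟨rfl, rfl⟩; exact hp' rfl
      simp only [Rmat, if_neg hp, if_neg this, zero_smul]

theorem vecMul_Rch (φ : (Fin r → Fin N) → B) {i j : Fin r} (hij : i ≠ j) (x y : Z)
    (a : Fin r → Fin N) :
    (φ ᵥ* onTwo i j ((Rch q N x y).map (algebraMap Z B))) a =
      if a i = a j then ((Q)⁻¹ * x - Q * y) • φ a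
      else (x - y) • φ (a ∘ Equiv.swap i j) +
        (((Q)⁻¹ - Q) * (if a i < a j then x else y)) • φ a := by
  rw [vecMul_onTwo _ hij]
  simp only [Matrix.map_apply, mul_algebraMap_eq_smul]
  rw [← (Equiv.prodComm (Fin N) (Fin N)).sum_comp]
  simp only [Equiv.prodComm_apply, Rch, Prod.fst_swap, Prod.snd_swap, Prod.swap_swap]
  split_ifs with h hlt
  · rw [Fintype.sum_eq_single (a i, a j)]
    · have hu : update (update a i (a j)) j (a i) = a := by rw [h]; simp [← h]
      simp only [hu]
      simp [Rmat, h, Algebra.smul_def]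
    · rintro ⟨b, c⟩ hp
      have : ¬ (b = a j ∧ c = a i) := by
        rintro ⟨rfl, rfl⟩; exact hp (by rw [h])
      simp only [Rmat, if_neg hp, if_neg this, zero_smul]
  all_goals
    rw [Fintype.sum_eq_add (a i, a j) (a j, a i) (by simp [h])]
    · have h' : ¬ a j = a i := fun e => h e.symm
      simp [Rmat, h, h', hlt, Algebra.smul_def, update_update_eq_comp_swap hij]
    · rintro ⟨b, c⟩ ⟨hp, hp'⟩
      have : ¬ (b = a j ∧ c = a i) := by
        rintro ⟨rfl, rfl⟩; exact hp' rfl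
      simp only [Rmat, if_neg hp, if_neg this, zero_smul]

/-- The entry of `R^t(x, y)` in row `(d, d)` and column `(c, c)`. -/
def rtCoeff (q : ℂ) (x y : Z) (d c : Fin N) : Z :=
  if d = c then (algebraMap ℂ Z q)⁻¹ * x - algebraMap ℂ Z q * y
  else ((algebraMap ℂ Z q)⁻¹ - algebraMap ℂ Z q) * (if d < c then x else y)

/-- R^t is diagonal on pairs of distinct entries and mixes the pairs (d, d) only among themselves.
This is why products of R^t become scalars at multi-indices without repetitions. -/
theorem vecMul_Rt (φ : (Fin r → Fin N) → B) {i j : Fin r} (hij : i ≠ j) (x y : Z)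
    (a : Fin r → Fin N) :
    (φ ᵥ* onTwo i j ((Rt q N x y).map (algebraMap Z B))) a =
      if a i = a j then ∑ d, rtCoeff q x y d (a i) • φ (update (update a i d) j d)
      else (x - y) • φ a := by
  rw [vecMul_onTwo _ hij]
  simp only [Matrix.map_apply, mul_algebraMap_eq_smul]
  split_ifs with h
  · symm
    refine Fintype.sum_of_injective (fun d : Fin N => (d, d)) (fun d d' h => (Prod.ext_iff.1 h).1)
      _ _ ?_ ?_
    · rintro ⟨b, c⟩ hp
      have hbc : b ≠ c := by rintro rfl; exact hp ⟨b, rfl⟩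
      simp [Rt, Rmat, h, hbc, hbc.symm]
      intro h1 h2
      exact absurd (h1.symm.trans h2.symm) hbc
    · intro d
      simp only [Rt, Rmat, rtCoeff, h, Prod.mk.injEq, eq_comm (a := d)]
      congr 1
      by_cases hd : a j = d <;> simp [hd, Algebra.smul_def]
  · rw [Fintype.sum_eq_single (a i, a j)]
    · simp [Rt, Rmat, h]
    · rintro ⟨b, c⟩ hp
      simp only [ne_eq, Prod.mk.injEq, not_and] at hp
      simp only [Rt, Rmat, Prod.mk.injEq]
      rw [if_neg (fun e => hp e.1.symm e.2), if_neg (fun e => h e.1), zero_smul]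

end RowFormulas

/-! ### Ř on alternating functionals, and cases of the Yang–Baxter equation. -/

section Alternation

variable {Z : Type*} [Field Z] [Algebra ℂ Z] {B : Type*} [Ring B] [Algebra ℂ B] [Algebra Z B]
  [IsScalarTower ℂ Z B] {r N : ℕ} {q : ℂ}

/-- The scalar `q` as an element of the field `Z`. -/
local notation "Q" => algebraMap ℂ Z q

theorem algebraMap_ne_zero_of_ne_zero (hq : q ≠ 0) : Q ≠ 0 :=
  (map_ne_zero (algebraMap ℂ Z)).2 hq

theorem smul_eq_algebraMap_smul (c : ℂ) (b : B) : c • b = algebraMap ℂ Z c • b :=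
  (algebraMap_smul Z c b).symm

/-- Alternating functionals are eigenvectors of `Ř(x, y)`. -/
theorem IsAlt.vecMul_Rch (hq : q ≠ 0) {i j : Fin r} (hij : i ≠ j) {φ : (Fin r → Fin N) → B}
    (h : IsAlt q i j φ) (x y : Z) :
    φ ᵥ* onTwo i j ((Rch q N x y).map (algebraMap Z B)) = ((Q)⁻¹ * y - Q * x) • φ := by
  have hQ : Q ≠ 0 := algebraMap_ne_zero_of_ne_zero hq
  funext a
  rw [TwistedQYangian.vecMul_Rch _ hij, Pi.smul_apply]
  rcases lt_trichotomy (a i) (a j) with hlt | heq | hgt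
  · have h1 := (h a).2 hlt
    rw [smul_eq_algebraMap_smul (Z := Z)] at h1
    rw [if_neg hlt.ne, if_pos hlt, h1]
    match_scalars
    field_simp
    ring
  · rw [if_pos heq, (h a).1 heq, smul_zero, smul_zero]
  · have h1 := h.eq_neg_inv hq hgt
    rw [smul_eq_algebraMap_smul (Z := Z), map_inv₀] at h1
    rw [if_neg hgt.ne', if_neg hgt.not_gt, h1]
    match_scalars
    field_simp
    ring

/-- The image of `Ř(x, q⁻² x)` consists of alternating functionals. -/
theorem isAlt_vecMul_Rch (hq : q ≠ 0) {i j : Fin r} (hij : i ≠ j) (φ : (Fin r → Fin N) → B)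
    {x y : Z} (hxy : x = Q ^ 2 * y) :
    IsAlt q i j (φ ᵥ* onTwo i j ((Rch q N x y).map (algebraMap Z B))) := by
  have hQ : Q ≠ 0 := algebraMap_ne_zero_of_ne_zero hq
  intro a
  refine ⟨fun ha => ?_, fun ha => ?_⟩
  · rw [vecMul_Rch _ hij, if_pos ha, hxy]
    match_scalars
    field_simp
    ring
  · have hs : (a ∘ Equiv.swap i j) ∘ Equiv.swap i j = a := by funext k; simp
    rw [vecMul_Rch _ hij, vecMul_Rch _ hij, if_neg ha.ne, if_pos ha, if_neg (by simpa using ha.ne'),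
      if_neg (by simpa using ha.not_gt), hs, hxy, smul_eq_algebraMap_smul (Z := Z)]
    match_scalars <;> field_simp <;> ring

/-! ### Three factors -/

/-- The multi-index `a` with the entries in `i`, `j`, `k` replaced by `l`, `m`, `n`. -/
def set3 (a : Fin r → Fin N) (i j k : Fin r) (l m n : Fin N) : Fin r → Fin N :=
  update (update (update a i l) j m) k n

variable {i j k : Fin r}

theorem set3_self (a : Fin r → Fin N) : set3 a i j k (a i) (a j) (a k) = a := by
  simp [set3]

theorem set3_apply (hij : i ≠ j) (hik : i ≠ k) (hjk : j ≠ k) (a : Fin r → Fin N) (l m n : Fin N) :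
    set3 a i j k l m n i = l ∧ set3 a i j k l m n j = m ∧ set3 a i j k l m n k = n := by
  simp [set3, hij, hik, hjk]

theorem set3_comp_swap (hij : i ≠ j) (hik : i ≠ k) (hjk : j ≠ k) (a : Fin r → Fin N) (l m n : Fin N) :
    set3 a i j k l m n ∘ Equiv.swap i j = set3 a i j k m l n ∧
    set3 a i j k l m n ∘ Equiv.swap i k = set3 a i j k n m l ∧
    set3 a i j k l m n ∘ Equiv.swap j k = set3 a i j k l n m := by
  refine ⟨?_, ?_, ?_⟩ <;>
  · funext s
    by_cases h1 : s = i
    · subst h1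
      simp [set3, hij, hik, hjk, hij.symm, hik.symm, hjk.symm, Equiv.swap_apply_of_ne_of_ne]
    by_cases h2 : s = j
    · subst h2
      simp [set3, hij, hik, hjk, hij.symm, hik.symm, hjk.symm, Equiv.swap_apply_of_ne_of_ne]
    by_cases h3 : s = k
    · subst h3
      simp [set3, hij, hik, hjk, hij.symm, hik.symm, hjk.symm, Equiv.swap_apply_of_ne_of_ne]
    simp [set3, h1, h2, h3, Equiv.swap_apply_of_ne_of_ne]

theorem set3_update (hij : i ≠ j) (hik : i ≠ k) (hjk : j ≠ k) (a : Fin r → Fin N) (l m n d : Fin N) :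
    update (update (set3 a i j k l m n) i d) j d = set3 a i j k d d n ∧
    update (update (set3 a i j k l m n) i d) k d = set3 a i j k d m d := by
  refine ⟨?_, ?_⟩ <;>
  · funext s
    by_cases h1 : s = i
    · subst h1; simp [set3, hij, hik]
    by_cases h2 : s = j
    · subst h2; simp [set3, hij.symm, hjk]
    by_cases h3 : s = k
    · subst h3; simp [set3, hik.symm, hjk.symm]
    simp [set3, h1, h2, h3]

/-- With the other factors frozen, alternation becomes a condition on functions of three values, so
that the Yang–Baxter checks reduce to scalar identities for each relative order of those values. -/
theorem isAlt_iff_set3 (hij : i ≠ j) (hik : i ≠ k) (hjk : j ≠ k) {V : Type*} [AddCommGroup V] [Module ℂ V] {φ : (Fin r → Fin N) → V} :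
    IsAlt q j k φ ↔ ∀ a l m, φ (set3 a i j k l m m) = 0 ∧
      ∀ n, m < n → φ (set3 a i j k l m n) = -(q • φ (set3 a i j k l n m)) := by
  constructor
  · intro h a l m
    refine ⟨(h _).1 ?_, fun n hmn => ?_⟩
    · rw [(set3_apply hij hik hjk a l m m).2.1, (set3_apply hij hik hjk a l m m).2.2]
    · rw [(h _).2, (set3_comp_swap hij hik hjk a l m n).2.2]
      rwa [(set3_apply hij hik hjk a l m n).2.1, (set3_apply hij hik hjk a l m n).2.2]
  · intro h a
    refine ⟨fun ha => ?_, fun ha => ?_⟩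
    · have := (h a (a i) (a j)).1
      rwa [show set3 a i j k (a i) (a j) (a j) = a by
        conv_lhs => rw [show set3 a i j k (a i) (a j) (a j) = set3 a i j k (a i) (a j) (a k) by
          rw [ha]]
        exact set3_self a] at this
    · have := (h a (a i) (a j)).2 (a k) ha
      rwa [← (set3_comp_swap hij hik hjk a (a i) (a j) (a k)).2.2, set3_self] at this

/-- A case of the Yang–Baxter equation: `R_ik(x, q⁻² y) R_ij(x, y)` preserves the functionals that
are alternating in `j`, `k`. -/
theorem Rmat_mul_Rmat_mem_altPres (hq : q ≠ 0) (hij : i ≠ j) (hik : i ≠ k) (hjk : j ≠ k)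
    {x y y' : Z} (hy : y = Q ^ 2 * y') :
    onTwo i k ((Rmat q N x y').map (algebraMap Z B)) *
      onTwo i j ((Rmat q N x y).map (algebraMap Z B)) ∈ altPres B N q j k := by
  have hQ : Q ≠ 0 := algebraMap_ne_zero_of_ne_zero hq
  intro φ h
  rw [isAlt_iff_set3 hij hik hjk] at h ⊢
  intro a
  set g : Fin N → Fin N → Fin N → B := fun l m n => φ (set3 a i j k l m n) with hg
  have g0 : ∀ l m, g l m m = 0 := fun l m => (h a l m).1
  have g1 : ∀ l m n, m < n → g l m n = -(Q • g l n m) := fun l m n hmn => by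
    rw [← smul_eq_algebraMap_smul]; exact (h a l m).2 n hmn
  -- The composite written out in terms of φ; alternation of the image is then verified case by case
  -- according to the order of `l`, `m`, `n`.
  have hf : ∀ l m n, (φ ᵥ* (onTwo i k ((Rmat q N x y').map (algebraMap Z B)) *
      onTwo i j ((Rmat q N x y).map (algebraMap Z B)))) (set3 a i j k l m n) =
      if l = m then ((Q)⁻¹ * x - Q * y) • (
        if l = n then ((Q)⁻¹ * x - Q * y') • g l m n
        else (x - y') • g l m n + (((Q)⁻¹ - Q) * (if l < n then x else y')) • g n m l)
      else (x - y) • (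
        if l = n then ((Q)⁻¹ * x - Q * y') • g l m n
        else (x - y') • g l m n + (((Q)⁻¹ - Q) * (if l < n then x else y')) • g n m l) +
        (((Q)⁻¹ - Q) * (if l < m then x else y)) • (
        if m = n then ((Q)⁻¹ * x - Q * y') • g m l n
        else (x - y') • g m l n + (((Q)⁻¹ - Q) * (if m < n then x else y')) • g n l m) := by
    intro l m n
    have e := fun l m n => set3_apply hij hik hjk a l m n
    have s := fun l m n => set3_comp_swap hij hik hjk a l m n
    rw [← vecMul_vecMul, vecMul_Rmat _ hij, (s l m n).1, vecMul_Rmat _ hik, vecMul_Rmat _ hik,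
      (s l m n).2.1, (s m l n).2.1, (e l m n).1, (e l m n).2.1, (e l m n).2.2, (e m l n).1,
      (e m l n).2.2]
  intro l m
  refine ⟨?_, fun n hmn => ?_⟩
  · rw [hf]
    rcases lt_trichotomy l m with h1 | rfl | h1
    · simp only [h1.ne, h1, g0, g1 m l m h1, if_true, if_false]
      subst hy
      match_scalars
      field_simp
      ring
    · simp only [g0, if_true, smul_zero]
    · rw [show g m l m = -((Q)⁻¹ • g m m l) by rw [g1 m m l h1]; match_scalars; field_simp]
      simp only [h1.ne', h1.not_gt, g0, if_true, if_false]
      subst hy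
      match_scalars
      field_simp
      ring
  · rw [smul_eq_algebraMap_smul (Z := Z), hf, hf]
    subst hy
    rcases lt_trichotomy l m with h1 | rfl | h1
    · have h2 := h1.trans hmn
      simp only [h1.ne, h1, h2, h2.ne, hmn, hmn.ne, hmn.ne', hmn.not_gt, if_true, if_false,
        g1 l m n hmn, g1 m l n h2, g1 n l m h1]
      match_scalars <;> field_simp <;> ring
    · simp only [hmn, hmn.ne, hmn.ne', hmn.not_gt, if_true, if_false, g1 l l n hmn, g0]
      match_scalars <;> field_simp <;> ring
    · have g1' : ∀ a b c, c < b → g a b c = -((Q)⁻¹ • g a c b) := fun a b c hbc => by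
        rw [g1 a c b hbc]; match_scalars; field_simp
      rcases lt_trichotomy l n with h2 | rfl | h2
      · simp only [h1.ne', h1.not_gt, h2, h2.ne, hmn, hmn.ne, hmn.ne', hmn.not_gt, if_true,
          if_false, g1 l m n hmn, g1 m l n h2, g1' n l m h1]
        match_scalars <;> field_simp <;> ring
      · simp only [hmn, hmn.ne, hmn.ne', hmn.not_gt, if_true, if_false, g1 l m l hmn, g0]
        match_scalars <;> field_simp <;> ring
      · simp only [h1.ne', h1.not_gt, h2.not_gt, h2.ne', hmn, hmn.ne, hmn.ne', hmn.not_gt, if_true,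
          if_false, g1 l m n hmn, g1' m l n h2, g1' n l m h1]
        match_scalars <;> field_simp <;> ring

/-- A case of the Yang–Baxter equation: `R_ij^t(x, y) R_ik^t(x, q⁻² y)` preserves the functionals
that are alternating in `j`, `k`. -/
theorem Rt_mul_Rt_mem_altPres (hq : q ≠ 0) (hij : i ≠ j) (hik : i ≠ k) (hjk : j ≠ k)
    {x y y' : Z} (hy : y = Q ^ 2 * y') :
    onTwo i j ((Rt q N x y).map (algebraMap Z B)) *
      onTwo i k ((Rt q N x y').map (algebraMap Z B)) ∈ altPres B N q j k := by
  have hQ : Q ≠ 0 := algebraMap_ne_zero_of_ne_zero hq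
  intro φ h
  rw [isAlt_iff_set3 hij hik hjk] at h ⊢
  intro a
  set g : Fin N → Fin N → Fin N → B := fun l m n => φ (set3 a i j k l m n) with hg
  have g0 : ∀ l m, g l m m = 0 := fun l m => (h a l m).1
  have g1 : ∀ l m n, m < n → g l m n = -(Q • g l n m) := fun l m n hmn => by
    rw [← smul_eq_algebraMap_smul]; exact (h a l m).2 n hmn
  have g1' : ∀ a b c, c < b → g a b c = -((Q)⁻¹ • g a c b) := fun a b c hbc => by
    rw [g1 a c b hbc]; match_scalars; field_simp
  have hf1 : ∀ l m n, (φ ᵥ* onTwo i j ((Rt q N x y).map (algebraMap Z B))) (set3 a i j k l m n) =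
      if l = m then ∑ d, rtCoeff q x y d l • g d d n else (x - y) • g l m n := by
    intro l m n
    have e := set3_apply hij hik hjk a l m n
    rw [vecMul_Rt _ hij, e.1, e.2.1]
    simp only [(set3_update hij hik hjk a l m n _).1, hg]
  set ψ := φ ᵥ* (onTwo i j ((Rt q N x y).map (algebraMap Z B)) *
      onTwo i k ((Rt q N x y').map (algebraMap Z B))) with hψ
  have hne : ∀ l m n, l ≠ n → ψ (set3 a i j k l m n) = (x - y') •
      if l = m then ∑ d, rtCoeff q x y d l • g d d n else (x - y) • g l m n := by
    intro l m n hln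
    have e := set3_apply hij hik hjk a l m n
    rw [hψ, ← vecMul_vecMul, vecMul_Rt _ hik, e.1, e.2.2, if_neg hln, hf1]
  -- When the entries in `i` and `k` agree, R_ik^t sums over d, and R_ij^t is then a scalar unless d
  -- = m. Rewriting φ(d, m, d) through φ(d, d, m) by alternation collects everything into one
  -- coefficient for each d, so the remaining identities can be checked for each d separately.
  have heq : ∀ m n, ψ (set3 a i j k n m n) = ∑ d, (rtCoeff q x y' m n * rtCoeff q x y d m +
      rtCoeff q x y' d n * (x - y) * (if m < d then -Q else -(Q)⁻¹)) • g d d m := by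
    intro m n
    have e := set3_apply hij hik hjk a n m n
    rw [hψ, ← vecMul_vecMul, vecMul_Rt _ hik, e.1, e.2.2, if_pos rfl]
    simp only [(set3_update hij hik hjk a n m n _).2, hf1]
    have hsplit : ∀ d, rtCoeff q x y' d n •
        (if d = m then ∑ e, rtCoeff q x y e d • g e e d else (x - y) • g d m d) =
        (if d = m then rtCoeff q x y' m n • ∑ e, rtCoeff q x y e m • g e e m else 0) +
        (rtCoeff q x y' d n * (x - y)) • g d m d := by
      intro d
      split_ifs with hd
      · subst hd
        rw [g0, smul_zero, add_zero]
      · rw [zero_add, smul_smul]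
    rw [Finset.sum_congr rfl fun d _ => hsplit d, Finset.sum_add_distrib, Finset.sum_ite_eq',
      if_pos (Finset.mem_univ _), Finset.smul_sum, ← Finset.sum_add_distrib]
    refine Finset.sum_congr rfl fun d _ => ?_
    rcases lt_trichotomy m d with h1 | rfl | h1
    · rw [if_pos h1, g1 d m d h1]; match_scalars; ring
    · simp only [g0, smul_zero, add_zero]
    · rw [if_neg h1.not_gt, g1' d m d h1]; match_scalars; ring
  intro l m
  refine ⟨?_, fun n hmn => ?_⟩
  · by_cases hlm : l = m
    · subst hlm
      rw [heq]
      refine Finset.sum_eq_zero fun d _ => ?_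
      rcases lt_trichotomy l d with h1 | rfl | h1
      · rw [show (rtCoeff q x y' l l * rtCoeff q x y d l + rtCoeff q x y' d l * (x - y) *
          if l < d then -Q else -(Q)⁻¹) = 0 by
            simp only [rtCoeff, h1, h1.ne', h1.not_gt, if_true, if_false]
            subst hy
            field_simp
            ring, zero_smul]
      · rw [g0, smul_zero]
      · rw [show (rtCoeff q x y' l l * rtCoeff q x y d l + rtCoeff q x y' d l * (x - y) *
          if l < d then -Q else -(Q)⁻¹) = 0 by
            simp only [rtCoeff, h1, h1.ne, h1.not_gt, if_true, if_false]
            subst hy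
            field_simp
            ring, zero_smul]
    · rw [hne l m m hlm, if_neg hlm, g0, smul_zero, smul_zero]
  · rw [smul_eq_algebraMap_smul (Z := Z)]
    by_cases hlm : l = m
    · subst hlm
      rw [hne l l n hmn.ne, if_pos rfl, heq, Finset.smul_sum, Finset.smul_sum,
        ← Finset.sum_neg_distrib]
      refine Finset.sum_congr rfl fun d _ => ?_
      subst hy
      rcases lt_trichotomy d n with h1 | rfl | h1
      · rcases lt_trichotomy d l with h2 | rfl | h2
        · simp only [rtCoeff, h1, h1.ne, h1.not_gt, h2, h2.ne, hmn.ne', hmn.not_gt, if_true,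
            if_false]
          match_scalars; field_simp; ring
        · simp only [rtCoeff, h1, h1.ne, hmn.ne', hmn.not_gt, if_true, if_false]
          match_scalars; field_simp; ring
        · simp only [rtCoeff, h1, h1.ne, h1.not_gt, h2.not_gt, h2.ne', hmn.ne', hmn.not_gt, if_true,
            if_false]
          match_scalars; field_simp; ring
      · simp only [g0, smul_zero, neg_zero]
      · have h2 := hmn.trans h1
        simp only [rtCoeff, h1, h1.ne', h1.not_gt, h2.not_gt, h2.ne', hmn.ne', hmn.not_gt, if_true,
            if_false]
        match_scalars; field_simp; ring
    · by_cases hln : l = n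
      · subst hln
        rw [hne l l m hmn.ne', if_pos rfl, heq, Finset.smul_sum, Finset.smul_sum,
          ← Finset.sum_neg_distrib]
        refine Finset.sum_congr rfl fun d _ => ?_
        subst hy
        rcases lt_trichotomy m d with h1 | rfl | h1
        · rcases lt_trichotomy l d with h2 | rfl | h2
          · simp only [rtCoeff, h1, h1.ne', h1.not_gt, h2.not_gt, h2.ne', hmn.ne, hmn, if_true,
              if_false]
            match_scalars; field_simp; ring
          · simp only [rtCoeff, h1, h1.ne', h1.not_gt, hmn.ne, hmn, if_true, if_false]
            match_scalars; field_simp; ring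
          · simp only [rtCoeff, h1, h1.ne', h1.not_gt, h2, h2.ne, hmn.ne, hmn, if_true,
              if_false]
            match_scalars; field_simp; ring
        · simp only [g0, smul_zero, neg_zero]
        · have h2 := h1.trans hmn
          simp only [rtCoeff, h1, h1.ne, h1.not_gt, h2, h2.ne, hmn.ne, hmn, if_true,
              if_false]
          match_scalars; field_simp; ring
      · rw [hne l m n hln, hne l n m hlm, if_neg hlm, if_neg hln, g1 l m n hmn]
        match_scalars; ring

end Alternation

end TwistedQYangian

end

noncomputable section

namespace TwistedQYangian

open Matrix Function

/-! ## The scalar factor of the Sklyanin determinant -/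

section Reflection

variable {Z : Type*} [Field Z] [Algebra ℂ Z] {B : Type*} [Ring B] [Algebra ℂ B] [Algebra Z B]
  [IsScalarTower ℂ Z B] {r N : ℕ} {q : ℂ}

/-- The scalar `q` as an element of the field `Z`. -/
local notation "Q" => algebraMap ℂ Z q

theorem smul_mem_altPres {i j : Fin r} (z : Z) {X : Matrix (Fin r → Fin N) (Fin r → Fin N) B}
    (hX : X ∈ altPres B N q i j) : z • X ∈ altPres B N q i j := by
  intro φ h a
  have h' := hX φ h a
  rw [vecMul_smul]
  refine ⟨fun ha => ?_, fun ha => ?_⟩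
  · rw [Pi.smul_apply, h'.1 ha, smul_zero]
  · rw [Pi.smul_apply, Pi.smul_apply, h'.2 ha, smul_neg, smul_comm]

theorem onTwo_smul (i j : Fin r) (z : Z) (M : Matrix (Fin N × Fin N) (Fin N × Fin N) B) :
    onTwo i j (z • M) = z • onTwo i j M := by
  ext a b
  simp only [onTwo, Matrix.smul_apply]
  split_ifs <;> simp

theorem Rt_swap (q : ℂ) (N : ℕ) (x y : Z) (a b : Fin N × Fin N) :
    Rt q N x y a.swap b.swap = Rt q N x y a b := by
  obtain ⟨a1, a2⟩ := a
  obtain ⟨b1, b2⟩ := b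
  simp only [Rt, Rmat, Prod.fst_swap, Prod.snd_swap, Prod.mk.injEq]
  by_cases h : b1 = a1 ∧ a2 = b2
  · obtain ⟨rfl, rfl⟩ := h
    simp [eq_comm]
  · rw [if_neg h, if_neg (fun e => h ⟨e.2.symm, e.1.symm⟩)]
    by_cases h' : b1 = b2 ∧ a2 = a1
    · obtain ⟨rfl, rfl⟩ := h'
      simp
    · rw [if_neg h', if_neg (fun e => h' ⟨e.1.symm, e.2.symm⟩)]

theorem onTwo_Rt_comm (i j : Fin r) (x y : Z) :
    onTwo i j ((Rt q N x y).map (algebraMap Z B)) =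
      onTwo j i ((Rt q N x y).map (algebraMap Z B)) := by
  ext a b
  simp only [onTwo, Matrix.map_apply]
  rw [← Rt_swap q N x y (a i, a j)]
  simp only [Prod.swap]
  congr 1
  exact propext ⟨fun h k h1 h2 => h k h2 h1, fun h k h1 h2 => h k h2 h1⟩

/-- All entries of R are linear in the two parameters, so exchanging and inverting them costs the
factor xy. Together with the symmetry of R^t under exchange of the tensor factors, this converts a
fusion statement about the second parameters into one about the first. -/
theorem Rt_eq_smul (q : ℂ) (N : ℕ) {x y : Z} (hx : x ≠ 0) (hy : y ≠ 0) :
    (Rt q N x y).map (algebraMap Z B) = (x * y) • (Rt q N y⁻¹ x⁻¹).map (algebraMap Z B) := by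
  have : Rt q N x y = (x * y) • Rt q N y⁻¹ x⁻¹ := by
    ext a b
    simp only [Rt, Rmat, Matrix.smul_apply, smul_eq_mul]
    split_ifs <;> (try simp only [Algebra.smul_def]) <;> (try rw [mul_zero]) <;> (try field_simp)
  rw [this]
  ext a b
  rw [Matrix.map_apply, Matrix.smul_apply, Matrix.smul_apply, Matrix.map_apply, smul_eq_mul,
    map_mul, Algebra.smul_def]

/-- A case of the Yang–Baxter equation: `R_ik^t(x, y) R_jk^t(q² x, y)` preserves the functionals
that are alternating in `i`, `j`. -/
theorem Rt_mul_Rt_mem_altPres_left (hq : q ≠ 0) {i j k : Fin r} (hij : i ≠ j) (hik : i ≠ k)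
    (hjk : j ≠ k) {x x' y : Z} (hx : x' = Q ^ 2 * x) (hx0 : x ≠ 0) (hy0 : y ≠ 0) :
    onTwo i k ((Rt q N x y).map (algebraMap Z B)) *
      onTwo j k ((Rt q N x' y).map (algebraMap Z B)) ∈ altPres B N q i j := by
  have hQ : Q ≠ 0 := algebraMap_ne_zero_of_ne_zero hq
  have hx0' : x' ≠ 0 := by rw [hx]; exact mul_ne_zero (pow_ne_zero _ hQ) hx0
  rw [onTwo_Rt_comm i k, onTwo_Rt_comm j k, Rt_eq_smul q N hx0 hy0, Rt_eq_smul q N hx0' hy0,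
    onTwo_smul, onTwo_smul, smul_mul_smul_comm]
  refine smul_mem_altPres _ (Rt_mul_Rt_mem_altPres hq hik.symm hjk.symm hij ?_)
  rw [hx]
  field_simp

/-- An alternating functional vanishes on pairs (d, d), so R^t acts on it simply as the scalar x -
y. -/
theorem Rt_mem_altPres {i j : Fin r} (hij : i ≠ j) (x y : Z) :
    onTwo i j ((Rt q N x y).map (algebraMap Z B)) ∈ altPres B N q i j := by
  intro φ h a
  rw [vecMul_Rt _ hij, vecMul_Rt _ hij]
  refine ⟨fun ha => ?_, fun ha => ?_⟩
  · rw [if_pos ha]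
    refine Finset.sum_eq_zero fun d _ => ?_
    rw [(h _).1 (by simp [hij]), smul_zero]
  · rw [if_neg ha.ne, if_neg (by simpa using ha.ne'), (h a).2 ha, smul_neg, smul_comm]

/-- The index paired with `i` in the symplectic case. -/
def partner {n : ℕ} (i : Fin (2 * n)) : Fin (2 * n) :=
  if h : Even i.val then ⟨i.val + 1, by obtain ⟨m, hm⟩ := h; omega⟩
  else ⟨i.val - 1, by omega⟩

theorem partner_val_of_even {n : ℕ} {i : Fin (2 * n)} (h : Even i.val) :
    (partner i).val = i.val + 1 := by simp [partner, h]

theorem partner_val_of_not_even {n : ℕ} {i : Fin (2 * n)} (h : ¬ Even i.val) :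
    (partner i).val = i.val - 1 ∧ 0 < i.val := by
  refine ⟨by simp [partner, h], Nat.pos_of_ne_zero fun e => h (by simp [e])⟩

theorem even_partner {n : ℕ} (i : Fin (2 * n)) : Even (partner i).val ↔ ¬ Even i.val := by
  by_cases h : Even i.val
  · rw [partner_val_of_even h, Nat.even_add_one]
  · obtain ⟨h1, h2⟩ := partner_val_of_not_even h
    have := Nat.even_add_one (n := i.val - 1)
    rw [Nat.sub_add_cancel h2] at this
    rw [h1]
    tauto

theorem partner_partner {n : ℕ} (i : Fin (2 * n)) : partner (partner i) = i := by
  apply Fin.ext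
  by_cases h : Even i.val
  · rw [(partner_val_of_not_even (fun e => (even_partner i).1 e h)).1, partner_val_of_even h]
    omega
  · obtain ⟨h1, h2⟩ := partner_val_of_not_even h
    rw [partner_val_of_even ((even_partner i).2 h), h1]
    omega

theorem partner_ne {n : ℕ} (i : Fin (2 * n)) : partner i ≠ i := by
  intro e
  have := even_partner i
  rw [e] at this
  tauto

/-- The nonzero entry of the column `i` of `G` in the symplectic case. -/
def gEntry (q : ℂ) {n : ℕ} (i : Fin (2 * n)) : ℂ := if Even i.val then -1 else q

theorem Gmat_symp_apply (q : ℂ) {n : ℕ} (b c : Fin (2 * n)) :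
    Gmat q (.symp n) b c = if b = partner c then gEntry q c else 0 := by
  simp only [Gmat, gEntry]
  by_cases hc : Even c.val
  · have h1 : b = partner c ↔ b.val = c.val + 1 := by
      rw [Fin.ext_iff, partner_val_of_even hc]
    have h2 : ¬ (Even b.val ∧ c.val = b.val + 1) := by
      rintro ⟨hb, e⟩
      rw [e, Nat.even_add_one] at hc
      exact hc hb
    simp [h1, h2, hc]
  · obtain ⟨h0, h0'⟩ := partner_val_of_not_even hc
    have h1 : b = partner c ↔ (Even b.val ∧ c.val = b.val + 1) := by
      constructor
      · rintro rfl
        exact ⟨(even_partner c).2 hc, by rw [h0]; omega⟩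
      · rintro ⟨_, e⟩
        rw [Fin.ext_iff, h0]
        omega
    simp only [h1, hc, false_and, if_false]

/-- `G` in the factor `i`. -/
def Gop (B : Type*) [Ring B] [Algebra ℂ B] (q : ℂ) {r N : ℕ} (κ : TwistType N) (i : Fin r) :
    Matrix (Fin r → Fin N) (Fin r → Fin N) B :=
  onOne i ((Gmat q κ).map (algebraMap ℂ B))

theorem Gop_orth (i : Fin r) : Gop B q (.orth N) i = 1 := by
  ext a b
  simp only [Gop, onOne, Gmat, Matrix.map_apply, Matrix.one_apply]
  by_cases h : a = b
  · subst h; simp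
  · rw [if_neg h]
    split_ifs with h1 h2
    · exact absurd (funext fun k => if hk : k = i then hk ▸ h2 else h1 k hk) h
    · simp
    · rfl

theorem vecMul_Gop_symp {n : ℕ} (φ : (Fin r → Fin (2 * n)) → B) (i : Fin r)
    (a : Fin r → Fin (2 * n)) :
    (φ ᵥ* Gop B q (.symp n) i) a = gEntry q (a i) • φ (update a i (partner (a i))) := by
  rw [Gop, vecMul_onOne, Fintype.sum_eq_single (partner (a i))]
  · rw [Matrix.map_apply, Gmat_symp_apply, if_pos rfl, mul_algebraMap_eq_smul]
  · intro b hb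
    rw [Matrix.map_apply, Gmat_symp_apply, if_neg hb, map_zero, mul_zero]

/-- The reflection equation for the constant matrix `G`. -/
theorem Gop_mul_Rt_mul_Gop_mem_altPres (hq : q ≠ 0) (κ : TwistType N) {i j : Fin r} (hij : i ≠ j)
    (x y : Z) :
    Gop B q κ i * onTwo i j ((Rt q N x y).map (algebraMap Z B)) * Gop B q κ j ∈
      altPres B N q i j := by
  have hQ : Q ≠ 0 := algebraMap_ne_zero_of_ne_zero hq
  cases κ with
  | orth =>
    rw [Gop_orth, Gop_orth, one_mul, mul_one]
    exact Rt_mem_altPres hij x y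
  | symp n =>
    intro φ h
    have hform : ∀ a, (φ ᵥ* (Gop B q (.symp n) i *
        onTwo i j ((Rt q (2 * n) x y).map (algebraMap Z B)) * Gop B q (.symp n) j)) a =
        gEntry q (a j) • if a i = partner (a j) then
          ∑ d, rtCoeff q x y d (a i) • gEntry q d • φ (update (update a i (partner d)) j d)
        else (x - y) • gEntry q (a i) • φ (update (update a i (partner (a i))) j (partner (a j))) := by
      intro a
      rw [← vecMul_vecMul, ← vecMul_vecMul, vecMul_Gop_symp, vecMul_Rt _ hij]
      simp only [vecMul_Gop_symp, update_self, update_of_ne hij, update_of_ne hij.symm]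
      congr 1
      refine if_congr Iff.rfl (Finset.sum_congr rfl fun d _ => ?_) ?_
      · congr 3
        rw [update_comm hij]
        simp only [update_idem]
        rw [update_comm hij]
      · rw [update_comm hij]
    intro a
    rw [hform, hform]
    have hne : ∀ c : Fin (2 * n), c ≠ partner c := fun c => (partner_ne c).symm
    refine ⟨fun ha => ?_, fun ha => ?_⟩
    · rw [ha, if_neg (hne _), (h _).1 (by simp [hij])]
      simp
    · simp only [Function.comp_apply, Equiv.swap_apply_left, Equiv.swap_apply_right]
      -- The only delicate case is that of paired entries, where R^t mixes all pairs (d, d) and G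
      -- turns them into (d', d) with d' the partner of d. The terms d = a i and d = a j are related
      -- by alternation; the others are compared one by one.
      by_cases hp : a i = partner (a j)
      · have hp' : a j = partner (a i) := by rw [hp, partner_partner]
        rw [if_pos hp, if_pos hp']
        have hei : Even (a i).val := by
          by_contra hc
          have := partner_val_of_not_even hc
          rw [← hp'] at this
          rw [Fin.lt_def] at ha
          omega
        have hej : ¬ Even (a j).val := by rw [hp', even_partner]; simpa using hei
        have hv : (a j).val = (a i).val + 1 := by rw [hp', partner_val_of_even hei]
        have hset : ∀ d, update (update (a ∘ Equiv.swap i j) i (partner d)) j d =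
            update (update a i (partner d)) j d := by
          intro d
          rw [← update_update_eq_comp_swap hij, update_comm hij]
          simp only [update_idem]
          rw [update_comm hij.symm]
          simp only [update_idem]
        simp only [hset]
        set g : Fin (2 * n) → B := fun d => φ (update (update a i (partner d)) j d) with hg
        have hgg : g (a j) = -(q • g (a i)) := by
          have := (h (update (update a i (a i)) j (a j))).2 (by simpa using ha)
          simp only [hg]
          rw [← hp, ← hp', this]
          congr 3
          rw [← update_update_eq_comp_swap hij]
          simp [update_of_ne hij]
        have hsum : ∀ c, ∑ d, rtCoeff q x y d c • gEntry q d • g d =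
            rtCoeff q x y (a i) c • gEntry q (a i) • g (a i) +
            rtCoeff q x y (a j) c • gEntry q (a j) • g (a j) +
            ∑ d, if d = a i ∨ d = a j then 0 else rtCoeff q x y d c • gEntry q d • g d := by
          intro c
          have hs : ∀ d, rtCoeff q x y d c • gEntry q d • g d =
              (if d = a i then rtCoeff q x y (a i) c • gEntry q (a i) • g (a i) else 0) +
              (if d = a j then rtCoeff q x y (a j) c • gEntry q (a j) • g (a j) else 0) +
              (if d = a i ∨ d = a j then 0 else rtCoeff q x y d c • gEntry q d • g d) := by
            intro d
            by_cases h1 : d = a i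
            · subst h1; simp [ha.ne]
            · by_cases h2 : d = a j
              · subst h2; simp [ha.ne']
              · simp [h1, h2]
          rw [Finset.sum_congr rfl fun d _ => hs d, Finset.sum_add_distrib, Finset.sum_add_distrib]
          simp
        -- The paired values a i and a j are consecutive, so any other d lies on the same side of
        -- both, and its coefficient in R^t is the same.
        have hrest : (∑ d, if d = a i ∨ d = a j then 0 else
              rtCoeff q x y d (a j) • gEntry q d • g d) =
            ∑ d, if d = a i ∨ d = a j then 0 else rtCoeff q x y d (a i) • gEntry q d • g d := by
          refine Finset.sum_congr rfl fun d _ => ?_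
          split_ifs with hd
          · rfl
          · push Not at hd
            congr 1
            have : d < a j ↔ d < a i := by
              have h1 := Fin.val_ne_of_ne hd.1
              have h2 := Fin.val_ne_of_ne hd.2
              rw [Fin.lt_def, Fin.lt_def]
              omega
            simp only [rtCoeff, hd.1, hd.2, if_false, this]
        rw [hsum, hsum, hrest, hgg]
        simp only [rtCoeff, gEntry, hei, hej, if_true, if_false, ha, ha.ne, ha.ne', ha.not_gt,
          smul_eq_algebraMap_smul (Z := Z), map_neg, map_one]
        match_scalars <;> field_simp <;> ring
      · have hp' : ¬ a j = partner (a i) := fun e => hp (by rw [e, partner_partner])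
        rw [if_neg hp, if_neg hp']
        -- Passing to partners preserves the order of values that belong to different pairs, so G
        -- does not disturb the alternation here.
        have hlt : partner (a i) < partner (a j) := by
          have e1 : (a i).val ≠ (partner (a j)).val := fun e => hp (Fin.ext e)
          have e2 : (a j).val ≠ (partner (a i)).val := fun e => hp' (Fin.ext e)
          rw [Fin.lt_def] at ha ⊢
          by_cases hi : Even (a i).val <;> by_cases hj : Even (a j).val
          · rw [partner_val_of_even hi, partner_val_of_even hj]; omega
          · have := partner_val_of_even hi
            have := partner_val_of_not_even hj
            rw [Nat.even_iff] at hi hj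
            omega
          · have := partner_val_of_even hj
            have := partner_val_of_not_even hi
            omega
          · have := partner_val_of_not_even hj
            have := partner_val_of_not_even hi
            have hne : (a i).val ≠ (a j).val := ha.ne
            omega
        rw [(h _).2 (by simpa [hij] using hlt)]
        have : update (update a i (partner (a i))) j (partner (a j)) ∘ Equiv.swap i j =
            update (update (a ∘ Equiv.swap i j) i (partner (a j))) j (partner (a i)) := by
          rw [← update_update_eq_comp_swap hij, ← update_update_eq_comp_swap hij]
          simp only [update_self, update_of_ne hij]
          funext s
          by_cases h1 : s = j
          · subst h1; simp
          · by_cases h2 : s = i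
            · subst h2; simp [hij]
            · simp [h1, h2]
        rw [this]
        simp only [smul_eq_algebraMap_smul (Z := Z)]
        match_scalars
        ring

end Reflection

end TwistedQYangian

end

noncomputable section

namespace TwistedQYangian

open Matrix Function

/-! ## The product of the `R`-matrices and of the constant matrix `G` -/

theorem drop_finRange_eq_cons {r k : ℕ} (h : k < r) :
    (List.finRange r).drop k = ⟨k, h⟩ :: (List.finRange r).drop (k + 1) := by
  rw [List.drop_eq_getElem_cons (by simpa using h)]
  simp

theorem mem_drop_finRange {r k : ℕ} {i : Fin r} : i ∈ (List.finRange r).drop k ↔ k ≤ i.val := by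
  rw [List.mem_iff_getElem]
  constructor
  · rintro ⟨n, hn, rfl⟩
    simp
  · intro h
    refine ⟨i.val - k, by simp; omega, ?_⟩
    ext
    simp
    omega

theorem nodup_drop_finRange (r k : ℕ) : ((List.finRange r).drop k).Nodup :=
  (List.nodup_finRange r).sublist (List.drop_sublist _ _)

theorem above_eq_drop {N : ℕ} (i : Fin N) : above i = (List.finRange N).drop (i.val + 1) := by
  have h : List.finRange N = (List.finRange N).take (i.val + 1) ++
      (List.finRange N).drop (i.val + 1) := (List.take_append_drop _ _).symm
  rw [above]
  conv_lhs => rw [h]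
  rw [List.filter_append, List.filter_eq_nil_iff.2, List.filter_eq_self.2, List.nil_append]
  · intro j hj
    rw [mem_drop_finRange] at hj
    rw [decide_eq_true_eq, Fin.lt_def]; omega
  · intro j hj
    rw [List.mem_take_iff_getElem] at hj
    obtain ⟨n, hn, rfl⟩ := hj
    rw [decide_eq_true_eq, Fin.lt_def]
    simp at hn ⊢
    omega

theorem List.prod_map_mul_of_commute {M ι : Type*} [Monoid M] (f g : ι → M) (l : List ι)
    (hl : l.Nodup) (h : ∀ i ∈ l, ∀ j ∈ l, i ≠ j → Commute (f i) (g j)) :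
    (l.map f).prod * (l.map g).prod = (l.map fun i => f i * g i).prod := by
  induction l with
  | nil => simp
  | cons i l ih =>
    obtain ⟨hi, hl⟩ := List.nodup_cons.1 hl
    have hc : Commute (l.map f).prod (g i) := by
      refine Commute.list_prod_left _ _ fun x hx => ?_
      obtain ⟨j, hj, rfl⟩ := List.mem_map.1 hx
      exact h j (by simp [hj]) i (by simp) (fun e => hi (e ▸ hj))
    simp only [List.map_cons, List.prod_cons]
    rw [← ih hl fun j hj k hk => h j (by simp [hj]) k (by simp [hk])]
    simp only [mul_assoc]
    rw [← mul_assoc (l.map f).prod, hc.eq]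
    simp only [mul_assoc]

section Kop

variable {Z : Type*} [Field Z] [Algebra ℂ Z] {B : Type*} [Ring B] [Algebra ℂ B] [Algebra Z B]
  [IsScalarTower ℂ Z B] {r N : ℕ} {q : ℂ}

/-- The scalar `q` as an element of the field `Z`. -/
local notation "Q" => algebraMap ℂ Z q

/-- `R_ij^t(x_i⁻¹, x_j)`. -/
def Rop (B : Type*) [Ring B] [Algebra Z B] (q : ℂ) (N : ℕ) (x : Fin r → Z) (i j : Fin r) :
    Matrix (Fin r → Fin N) (Fin r → Fin N) B :=
  onTwo i j ((Rt q N (x i)⁻¹ (x j)).map (algebraMap Z B))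

/-- The product of all `G_i` and `R_ij^t(x_i⁻¹, x_j)` with `i`, `j` in a list. -/
def Kop (B : Type*) [Ring B] [Algebra ℂ B] [Algebra Z B] (q : ℂ) {N : ℕ} (κ : TwistType N)
    (x : Fin r → Z) : List (Fin r) → Matrix (Fin r → Fin N) (Fin r → Fin N) B
  | [] => 1
  | i :: l => Gop B q κ i * (l.map (Rop B q N x i)).prod * Kop B q κ x l

theorem Kop_mem_altPres_of_not_mem (κ : TwistType N) (x : Fin r → Z) {m m' : Fin r}
    (l : List (Fin r)) (hl : l.Nodup) (hm : m ∉ l) (hm' : m' ∉ l) :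
    Kop B q κ x l ∈ altPres B N q m m' := by
  induction l with
  | nil => exact one_mem _
  | cons i l ih =>
    obtain ⟨hi, hl⟩ := List.nodup_cons.1 hl
    rw [List.mem_cons, not_or] at hm hm'
    refine mul_mem (mul_mem (onOne_mem_altPres q (Ne.symm hm.1) (Ne.symm hm'.1) _) ?_)
      (ih hl hm.2 hm'.2)
    refine list_prod_mem fun X hX => ?_
    obtain ⟨j, hj, rfl⟩ := List.mem_map.1 hX
    refine onTwo_mem_altPres q (fun e : i = j => hi (e ▸ hj)) (Ne.symm hm.1) (Ne.symm hm'.1) ?_ ?_ _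
    · rintro rfl; exact hm.2 hj
    · rintro rfl; exact hm'.2 hj

/-- The factors for `m` and `m'` are adjacent in the product and form the fused pair R_im^t R_im'^t
with x_m = q² x_m', covered by `Rt_mul_Rt_mem_altPres`; the other factors do not touch `m`, `m'`. -/
theorem prod_Rop_mem_altPres (hq : q ≠ 0) {x : Fin r → Z}
    (hx : ∀ m m' : Fin r, m'.val = m.val + 1 → x m = Q ^ 2 * x m') {m m' : Fin r}
    (hm : m'.val = m.val + 1) (i : Fin r) :
    ∀ k ≤ m.val, i.val < k →
      (((List.finRange r).drop k).map (Rop B q N x i)).prod ∈ altPres B N q m m' := by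
  intro k hk
  induction hk using Nat.decreasingInduction with
  | self =>
    intro hi
    have him : i ≠ m := fun e => by rw [e] at hi; omega
    have him' : i ≠ m' := fun e => by rw [e] at hi; omega
    have hmm' : m ≠ m' := fun e => by rw [e] at hm; omega
    have e1 := drop_finRange_eq_cons m.isLt
    have e2 := drop_finRange_eq_cons m'.isLt
    rw [← hm] at e1
    rw [e1, e2]
    simp only [Fin.eta, List.map_cons, List.prod_cons]
    rw [← mul_assoc]
    refine mul_mem (Rt_mul_Rt_mem_altPres hq him him' hmm' (hx m m' hm)) ?_
    refine list_prod_mem fun X hX => ?_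
    obtain ⟨j, hj, rfl⟩ := List.mem_map.1 hX
    rw [mem_drop_finRange] at hj
    refine onTwo_mem_altPres q ?_ him him' ?_ ?_ _ <;>
    · rintro rfl; omega
  | of_succ k hk ih =>
    intro hi
    have hkr : k < r := by have := m.isLt; omega
    rw [drop_finRange_eq_cons hkr, List.map_cons, List.prod_cons]
    refine mul_mem (onTwo_mem_altPres q ?_ ?_ ?_ ?_ ?_ _) (ih (by omega)) <;>
    · intro e
      have := congrArg Fin.val e
      try dsimp only at this
      omega

theorem commute_scalar {s : Type*} (M : s → s → Z) (b : B) (c d : s) :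
    Commute (algebraMap Z B (M c d)) b := Algebra.commutes _ _

/-- Rows above `m` are handled by `prod_Rop_mem_altPres`. The rows `m` and `m'` are interleaved, by
commuting operators in disjoint factors, into (G_m R_mm'^t G_m') ∏_j (R_mj^t R_m'j^t): the bracket
is the reflection equation, and each pair is a Yang–Baxter equation fused in the first parameters.
The later rows do not involve `m`, `m'`. -/
theorem Kop_mem_altPres (hq : q ≠ 0) (κ : TwistType N) {x : Fin r → Z} (hx0 : ∀ i, x i ≠ 0)
    (hx : ∀ m m' : Fin r, m'.val = m.val + 1 → x m = Q ^ 2 * x m') {m m' : Fin r}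
    (hm : m'.val = m.val + 1) :
    ∀ k ≤ m.val, Kop B q κ x ((List.finRange r).drop k) ∈ altPres B N q m m' := by
  have hQ : Q ≠ 0 := algebraMap_ne_zero_of_ne_zero hq
  intro k hk
  induction hk using Nat.decreasingInduction with
  | self =>
    have hmm' : m ≠ m' := fun e => by rw [e] at hm; omega
    have e1 := drop_finRange_eq_cons m.isLt
    have e2 := drop_finRange_eq_cons m'.isLt
    have hnd := nodup_drop_finRange r (m'.val + 1)
    have hmem : ∀ j, j ∈ (List.finRange r).drop (m'.val + 1) → m ≠ j ∧ m' ≠ j := by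
      intro j hj
      rw [mem_drop_finRange] at hj
      constructor <;>
      · rintro rfl; omega
    rw [← hm] at e1
    rw [e1, e2]
    generalize (List.finRange r).drop (m'.val + 1) = l at hnd hmem
    simp only [Fin.eta, Kop, List.map_cons, List.prod_cons]
    have hc : Commute (l.map (Rop B q N x m)).prod (Gop B q κ m') := by
      refine Commute.list_prod_left _ _ fun X hX => ?_
      obtain ⟨j, hj, rfl⟩ := List.mem_map.1 hX
      exact (commute_onOne_onTwo (hmem j hj).1 hmm'.symm (hmem j hj).2
        fun a b c d => (commute_scalar _ _ _ _).symm).symm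
    have hp := List.prod_map_mul_of_commute (Rop B q N x m) (Rop B q N x m') l hnd
      fun j hj k hk hjk => commute_onTwo_onTwo (hmem j hj).1 (hmem k hk).2 hmm'.symm
        (hmem j hj).2 (hmem k hk).1.symm hjk.symm fun a b c d => commute_scalar _ _ _ _
    have : Gop B q κ m * (Rop B q N x m m' * (l.map (Rop B q N x m)).prod) *
        (Gop B q κ m' * (l.map (Rop B q N x m')).prod * Kop B q κ x l) =
        (Gop B q κ m * Rop B q N x m m' * Gop B q κ m') *
          (l.map fun i => Rop B q N x m i * Rop B q N x m' i).prod * Kop B q κ x l := by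
      rw [← hp]
      simp only [mul_assoc]
      rw [← mul_assoc (l.map (Rop B q N x m)).prod (Gop B q κ m'), hc.eq]
      simp only [mul_assoc]
    rw [this]
    refine mul_mem (mul_mem (Gop_mul_Rt_mul_Gop_mem_altPres hq κ hmm' _ _) ?_)
      (Kop_mem_altPres_of_not_mem κ x l hnd (fun h => (hmem m h).1 rfl)
        (fun h => (hmem m' h).2 rfl))
    refine list_prod_mem fun X hX => ?_
    obtain ⟨j, hj, rfl⟩ := List.mem_map.1 hX
    refine Rt_mul_Rt_mem_altPres_left hq hmm' (hmem j hj).1 (hmem j hj).2 ?_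
      (inv_ne_zero (hx0 m)) (hx0 j)
    rw [hx m m' hm]
    have := hx0 m'
    field_simp
  | of_succ k hk ih =>
    have hkr : k < r := by have := m.isLt; omega
    rw [drop_finRange_eq_cons hkr, Kop]
    refine mul_mem (mul_mem (onOne_mem_altPres q ?_ ?_ _)
      (prod_Rop_mem_altPres hq hx hm _ (k + 1) hk (by simp))) ih <;>
    · intro e
      have := congrArg Fin.val e
      try dsimp only at this
      omega

/-- A product of `R_ij^t` acts by a scalar where the entry in `i` differs from the other ones. -/
theorem vecMul_prod_Rop_of_ne (x : Fin r → Z) (i : Fin r) (l : List (Fin r))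
    (φ : (Fin r → Fin N) → B) (a : Fin r → Fin N) (h : ∀ j ∈ l, i ≠ j ∧ a i ≠ a j) :
    (φ ᵥ* (l.map (Rop B q N x i)).prod) a = (l.map fun j => (x i)⁻¹ - x j).prod • φ a := by
  induction l generalizing φ with
  | nil => simp
  | cons j l ih =>
    rw [List.map_cons, List.prod_cons, ← vecMul_vecMul, ih _ fun k hk => h k (by simp [hk]), Rop,
      vecMul_Rt _ (h j (by simp)).1, if_neg (h j (by simp)).2, List.map_cons, List.prod_cons,
      smul_smul, mul_comm]

/-- The product of all `x_i⁻¹ - x_j` with `i` before `j` in a list. -/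
def pairProd (x : Fin r → Z) : List (Fin r) → Z
  | [] => 1
  | i :: l => (l.map fun j => (x i)⁻¹ - x j).prod * pairProd x l

theorem vecMul_Kop_orth (x : Fin r → Z) (l : List (Fin r)) (hl : l.Nodup)
    (φ : (Fin r → Fin N) → B) {a : Fin r → Fin N} (ha : Injective a) :
    (φ ᵥ* Kop B q (.orth N) x l) a = pairProd x l • φ a := by
  induction l generalizing φ with
  | nil => simp [Kop, pairProd]
  | cons i l ih =>
    obtain ⟨hi, hl⟩ := List.nodup_cons.1 hl
    rw [Kop, Gop_orth, one_mul, ← vecMul_vecMul, ih hl, vecMul_prod_Rop_of_ne, pairProd,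
      smul_smul, mul_comm]
    intro j hj
    have : i ≠ j := fun e => hi (e ▸ hj)
    exact ⟨this, fun e => this (ha e)⟩

end Kop

end TwistedQYangian

end

noncomputable section

namespace TwistedQYangian

open Matrix Function

/-! ### The symplectic case -/

section Symp

variable {Z : Type*} [Field Z] [Algebra ℂ Z] {B : Type*} [Ring B] [Algebra ℂ B] [Algebra Z B]
  [IsScalarTower ℂ Z B] {r n : ℕ} {q : ℂ}

/-- The scalar `q` as an element of the field `Z`. -/
local notation "Q" => algebraMap ℂ Z q

/-- The scalar contributed by the first half of the rows in the symplectic case. -/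
def sympRow (q : ℂ) (x : Fin r → Z) (k k' : Fin r) : Z :=
  ((algebraMap ℂ Z q)⁻¹ ^ 2 * (x k)⁻¹ - algebraMap ℂ Z q ^ 2 * x k') *
    (((List.finRange r).drop (k'.val + 1)).map fun j => (x k)⁻¹ - x j).prod

theorem alt_eq_zero_of_eq_of_ne {N : ℕ} {V : Type*} [AddCommGroup V] [Module ℂ V] (hq : q ≠ 0)
    {φ : (Fin r → Fin N) → V} {k : Fin r}
    (h : ∀ m m' : Fin r, k ≤ m → m'.val = m.val + 1 → IsAlt q m m' φ) {i j : Fin r} (hi : k ≤ i)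
    (hj : k ≤ j) (hij : i ≠ j) {b : Fin r → Fin N} (hb : b i = b j) : φ b = 0 := by
  wlog hlt : i < j generalizing i j
  · exact this hj hi hij.symm hb.symm (lt_of_le_of_ne (not_lt.1 hlt) hij.symm)
  · exact alt_eq_zero_of_eq hq (j.val - i.val - 1) j (by rw [Fin.lt_def] at hlt; omega)
      (fun m m' hm _ => h m m' (hi.trans hm)) b hb

/-- The equal entries c in `k`, `k'` make R_kk'^t sum over all (d, d), and G_k changes these to (d',
d) with d' the partner of d. Every pair {d, d'} other than that of c occurs among the later entries,
so alternation kills its terms. The two surviving terms combine to (q⁻² x_k⁻¹ - q² x_k') times one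
value of φ, and the later R^t act diagonally. -/
theorem vecMul_row_symp_adjacent (hq : q ≠ 0) (x : Fin r → Z) {k k' : Fin r}
    (hk : k'.val = k.val + 1) {φ : (Fin r → Fin (2 * n)) → B}
    (hφ : ∀ m m' : Fin r, k ≤ m → m'.val = m.val + 1 → IsAlt q m m' φ) {c : Fin (2 * n)}
    (hc : Even c.val) {b : Fin r → Fin (2 * n)} (hbk : b k = c) (hbk' : b k' = c)
    (hb : ∀ j, k' < j → b j ≠ c)
    (hd : ∀ d, d ≠ c → d ≠ partner c → ∃ j, k' < j ∧ (b j = d ∨ b j = partner d)) :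
    (φ ᵥ* (Gop B q (.symp n) k *
      (((List.finRange r).drop (k.val + 1)).map (Rop B q (2 * n) x k)).prod)) b =
      sympRow q x k k' • φ (update b k' (partner c)) := by
  have hQ : Q ≠ 0 := algebraMap_ne_zero_of_ne_zero hq
  have hkk : k ≠ k' := fun e => by rw [e] at hk; omega
  have hkk' : k < k' := by rw [Fin.lt_def]; omega
  have e1 : (List.finRange r).drop (k.val + 1) = k' :: (List.finRange r).drop (k'.val + 1) := by
    rw [← hk, drop_finRange_eq_cons k'.isLt]
  rw [e1, List.map_cons, List.prod_cons, ← mul_assoc, ← vecMul_vecMul, vecMul_prod_Rop_of_ne]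
  · rw [← vecMul_vecMul, Rop, vecMul_Rt _ hkk, hbk, hbk', if_pos rfl,
      Fintype.sum_eq_add c (partner c) (partner_ne c).symm]
    · have hpc : ¬ Even (partner c).val := by rw [even_partner]; simpa using hc
      have hlt : c < partner c := by rw [Fin.lt_def, partner_val_of_even hc]; omega
      simp only [vecMul_Gop_symp, update_self, update_of_ne hkk, partner_partner]
      have h1 : update (update (update b k c) k' c) k (partner c) =
          update (update b k' c) k (partner c) := by
        rw [update_comm hkk, update_idem]
      have h2 : update (update (update b k (partner c)) k' (partner c)) k c =
          update b k' (partner c) := by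
        rw [update_comm hkk, update_idem, ← hbk]
        funext s
        by_cases hs : s = k
        · subst hs; simp [hkk]
        · simp [hs]
      have h3 : φ (update (update b k' c) k (partner c)) =
          -(q⁻¹ • φ (update b k' (partner c))) := by
        rw [(hφ k k' le_rfl hk).eq_neg_inv hq (by simpa [hkk.symm] using hlt)]
        congr 3
        rw [← update_update_eq_comp_swap hkk]
        funext s
        by_cases hs : s = k'
        · subst hs; simp [hkk.symm]
        · by_cases hs' : s = k
          · subst hs'; simp [hkk, hkk.symm, hbk]
          · simp [hs, hs']
      rw [h1, h2, h3]
      simp only [rtCoeff, gEntry, hc, hpc, if_true, if_false, partner_ne, hlt.not_gt, sympRow,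
        smul_eq_algebraMap_smul (Z := Z), map_neg, map_one, map_inv₀]
      match_scalars
      field_simp
      ring
    · rintro d ⟨hd1, hd2⟩
      obtain ⟨j, hj, hbj⟩ := hd d hd1 hd2
      have hjk : j ≠ k := (hkk'.trans hj).ne'
      simp only [vecMul_Gop_symp, update_self, update_of_ne hkk]
      have : φ (update (update (update b k d) k' d) k (partner d)) = 0 := by
        rcases hbj with hbj | hbj
        · exact alt_eq_zero_of_eq_of_ne hq hφ hkk'.le (hkk'.trans hj).le hj.ne
            (by simp [hkk.symm, hjk, hj.ne', hbj])
        · exact alt_eq_zero_of_eq_of_ne hq hφ le_rfl (hkk'.trans hj).le hjk.symm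
            (by simp [hjk, hj.ne', hbj])
      rw [this, smul_zero, smul_zero]
  · intro j hj
    rw [mem_drop_finRange] at hj
    have : k' < j := by rw [Fin.lt_def]; omega
    exact ⟨(hkk'.trans this).ne, by rw [hbk]; exact (hb j this).symm⟩

/-- The second entry c is carried back to the factor `k'` by adjacent swaps. Both sides are
alternating under each swap, and the entry passed is neither c nor its partner, so it compares in
the same way with these two consecutive values and both sides acquire the same factor. -/
theorem vecMul_row_symp (hq : q ≠ 0) {x : Fin r → Z}
    (hx : ∀ m m' : Fin r, m'.val = m.val + 1 → x m = Q ^ 2 * x m') {k k' : Fin r}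
    (hk : k'.val = k.val + 1) {φ : (Fin r → Fin (2 * n)) → B}
    (hφ : ∀ m m' : Fin r, k ≤ m → m'.val = m.val + 1 → IsAlt q m m' φ) {c : Fin (2 * n)}
    (hc : Even c.val) (t : ℕ) : ∀ (p : Fin r), p.val = k'.val + t →
    ∀ (b : Fin r → Fin (2 * n)), b k = c → b p = c →
    (∀ j, k < j → j ≠ p → b j ≠ c ∧ b j ≠ partner c) →
    (∀ d, d ≠ c → d ≠ partner c → ∃ j, k < j ∧ j ≠ p ∧ (b j = d ∨ b j = partner d)) →
    (φ ᵥ* (Gop B q (.symp n) k *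
      (((List.finRange r).drop (k.val + 1)).map (Rop B q (2 * n) x k)).prod)) b =
      sympRow q x k k' • φ (update b p (partner c)) := by
  induction t with
  | zero =>
    intro p hp b hbk hbp hb hd
    obtain rfl : p = k' := Fin.ext hp
    refine vecMul_row_symp_adjacent hq x hk hφ hc hbk hbp (fun j hj => ?_) fun d h1 h2 => ?_
    · exact (hb j (by rw [Fin.lt_def] at hj ⊢; omega) hj.ne').1
    · obtain ⟨j, h3, h4, h5⟩ := hd d h1 h2
      refine ⟨j, ?_, h5⟩
      have := Fin.val_ne_of_ne h4
      rw [Fin.lt_def] at h3 ⊢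
      omega
  | succ t ih =>
    intro p hp b hbk hbp hb hd
    have hp'r : p.val - 1 < r := by omega
    set p' : Fin r := ⟨p.val - 1, hp'r⟩ with hp'def
    have hpp : p.val = p'.val + 1 := by simp [hp'def]; omega
    have hpv : p'.val = k'.val + t := by omega
    clear_value p'
    have hkp' : k < p' := by rw [Fin.lt_def]; omega
    have hkp : k < p := by rw [Fin.lt_def]; omega
    have hne : p' ≠ p := fun e => by rw [e] at hpp; omega
    set Φ := φ ᵥ* (Gop B q (.symp n) k *
      (((List.finRange r).drop (k.val + 1)).map (Rop B q (2 * n) x k)).prod) with hΦ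
    have halt : IsAlt q p' p Φ := by
      refine (mul_mem (onOne_mem_altPres q hkp'.ne hkp.ne _)
        (prod_Rop_mem_altPres hq hx hpp k (k.val + 1) ?_ (by omega))) φ (hφ p' p hkp'.le hpp)
      rw [Fin.lt_def] at hkp'
      omega
    have hφp := hφ p' p hkp'.le hpp
    have key : Φ (b ∘ Equiv.swap p' p) = sympRow q x k k' •
        φ (update (b ∘ Equiv.swap p' p) p' (partner c)) := by
      refine ih p' hpv _ ?_ ?_ ?_ ?_
      · simp [Equiv.swap_apply_of_ne_of_ne hkp'.ne hkp.ne, hbk]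
      · simp [hbp]
      · intro j hkj hjp'
        rw [Function.comp_apply]
        refine hb _ ?_ ?_
        · rw [Equiv.swap_apply_def]
          split_ifs <;> assumption
        · intro e
          exact hjp' ((Equiv.swap p' p).injective (e.trans (Equiv.swap_apply_left p' p).symm))
      · intro d h1 h2
        obtain ⟨j, h3, h4, h5⟩ := hd d h1 h2
        refine ⟨Equiv.swap p' p j, ?_, ?_, ?_⟩
        · rw [Equiv.swap_apply_def]
          split_ifs <;> assumption
        · intro e
          exact h4 ((Equiv.swap p' p).injective (e.trans (Equiv.swap_apply_right p' p).symm))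
        · simpa using h5
    have hsw : update b p (partner c) ∘ Equiv.swap p' p =
        update (b ∘ Equiv.swap p' p) p' (partner c) := by
      funext s
      by_cases h1 : s = p'
      · subst h1; simp
      · by_cases h2 : s = p
        · subst h2; simp [h1, hne]
        · simp [h1, h2, Equiv.swap_apply_of_ne_of_ne]
    obtain ⟨hb1, hb2⟩ := hb p' hkp' hne
    have hb1' := Fin.val_ne_of_ne hb1
    have hb2' := Fin.val_ne_of_ne hb2
    have hpc := partner_val_of_even hc
    rcases lt_or_gt_of_ne hb1 with hlt | hgt
    · rw [(halt b).2 (by rw [hbp]; exact hlt), key, (hφp (update b p (partner c))).2, hsw]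
      · rw [smul_neg, smul_comm]
      · rw [update_self, update_of_ne hne]
        rw [Fin.lt_def] at hlt ⊢
        omega
    · rw [halt.eq_neg_inv hq (by rw [hbp]; exact hgt), key,
        hφp.eq_neg_inv hq (a := update b p (partner c)), hsw]
      · rw [smul_neg, smul_comm]
      · rw [update_self, update_of_ne hne]
        rw [Fin.lt_def] at hgt
        rw [Fin.lt_def]
        omega

/-- The multi-index `(1, 3, …, 2n-1, 2, 4, …, 2n)` with some of the entries in the second half
lowered by `1`: those in the factors `≥ k` for `k ≥ n`, and the first `k` ones for `k ≤ n`. -/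
def sympState (n k : ℕ) (i : Fin (2 * n)) : Fin (2 * n) :=
  if h : i.val < n then ⟨2 * i.val, by omega⟩
  else if (n ≤ k ∧ k ≤ i.val) ∨ (k < n ∧ i.val - n < k) then ⟨2 * (i.val - n), by omega⟩
  else ⟨2 * (i.val - n) + 1, by omega⟩

/-- The value of the row `i` of the product in the symplectic case, for `i ≤ n`. -/
def sympFirst (q : ℂ) (x : Fin r → Z) (i : Fin r) : List (Fin r) → Z
  | [] => 1
  | j :: l => ((algebraMap ℂ Z q)⁻¹ ^ 2 * (x i)⁻¹ - algebraMap ℂ Z q ^ 2 * x j) *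
      (l.map fun j => (x i)⁻¹ - x j).prod

/-- The value of the product of all `G_i` and `R_ij^t` with `i`, `j` in a list in the symplectic
case. -/
def sympProd (q : ℂ) (n : ℕ) (x : Fin (2 * n) → Z) : List (Fin (2 * n)) → Z
  | [] => 1
  | i :: l => (if i.val < n then sympFirst q x i l
      else algebraMap ℂ Z q * (l.map fun j => (x i)⁻¹ - x j).prod) * sympProd q n x l

/-- `sympState n k` is the multi-index at which the functional must be evaluated once the rows from
`k` on have been stripped off. Going down through the second half, each row meets distinct entries
and G lowers an even value of {1, …, 2n} to its odd partner, with the factor q. Going down through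
the first half, each row meets a doubled value, and `vecMul_row_symp` restores the even partner. At
k = 0 the initial multi-index returns, so an eigenvalue is obtained. -/
theorem vecMul_Kop_symp (hq : q ≠ 0) {x : Fin (2 * n) → Z}
    (hx : ∀ m m' : Fin (2 * n), m'.val = m.val + 1 → x m = Q ^ 2 * x m') :
    ∀ k ≤ 2 * n, ∀ φ : (Fin (2 * n) → Fin (2 * n)) → B,
    (∀ m m' : Fin (2 * n), k ≤ m.val → m'.val = m.val + 1 → IsAlt q m m' φ) →
    (φ ᵥ* Kop B q (.symp n) x ((List.finRange (2 * n)).drop k)) (sympState n (2 * n)) =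
      sympProd q n x ((List.finRange (2 * n)).drop k) • φ (sympState n k) := by
  intro k hk
  induction hk using Nat.decreasingInduction with
  | self =>
    intro φ _
    rw [List.drop_eq_nil_of_le (by simp)]
    simp [Kop, sympProd]
  | of_succ k hk ih =>
    intro φ hφ
    set κ : Fin (2 * n) := ⟨k, hk⟩ with hκ
    rw [drop_finRange_eq_cons hk, Kop, ← vecMul_vecMul, ih, sympProd, mul_smul, smul_comm _ (sympProd q n x _)]
    · congr 1
      by_cases hkn : k < n
      · rw [if_pos hkn]
        have hk1 : k + 1 < 2 * n := by omega
        -- The value in the factor k occurs a second time in the factor n + k, at distance n - 1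
        -- from the factor k + 1.
        have hrow := vecMul_row_symp (n := n) hq hx (k := κ) (k' := ⟨k + 1, hk1⟩) rfl (φ := φ)
          (fun m m' hm hm' => hφ m m' (by rwa [Fin.le_def] at hm) hm') (c := ⟨2 * k, by omega⟩)
          (by simp) (n - 1) ⟨n + k, by omega⟩ (by simp; omega) (sympState n (k + 1)) ?_ ?_ ?_ ?_
        · rw [hrow]
          have : update (sympState n (k + 1)) ⟨n + k, by omega⟩ (partner ⟨2 * k, by omega⟩) =
              sympState n k := by
            funext i
            by_cases hi : i = ⟨n + k, by omega⟩
            · subst hi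
              apply Fin.ext
              rw [update_self, partner_val_of_even (by simp)]
              simp only [sympState]
              split_ifs <;> simp <;> omega
            · rw [update_of_ne hi]
              have hi' : i.val ≠ n + k := fun e => hi (Fin.ext e)
              simp only [sympState]
              split_ifs <;> first | rfl | (exfalso; omega)
          rw [this, drop_finRange_eq_cons hk1]
          rfl
        · apply Fin.ext
          simp [sympState, hκ, hkn]
        · apply Fin.ext
          simp only [sympState]
          split_ifs <;> simp <;> omega
        · intro j hj hjp
          have hj' : j.val ≠ n + k := fun e => hjp (Fin.ext e)
          rw [Fin.lt_def] at hj
          simp only [hκ] at hj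
          have hpv : (partner (⟨2 * k, by omega⟩ : Fin (2 * n))).val = 2 * k + 1 :=
            partner_val_of_even (by simp)
          simp only [ne_eq, Fin.ext_iff, hpv]
          simp only [sympState]
          split_ifs <;> simp <;> omega
        · intro d hd1 hd2
          have hpv : (partner (⟨2 * k, by omega⟩ : Fin (2 * n))).val = 2 * k + 1 :=
            partner_val_of_even (by simp)
          rw [ne_eq, Fin.ext_iff] at hd1 hd2
          rw [hpv] at hd2
          simp only at hd1
          have hdn := d.isLt
          by_cases hlt : d.val / 2 < k
          · refine ⟨⟨n + d.val / 2, by omega⟩, ?_, ?_, ?_⟩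
            · rw [Fin.lt_def]; simp [hκ]; omega
            · simp only [ne_eq, Fin.ext_iff]; omega
            · have hs : (sympState n (k + 1) ⟨n + d.val / 2, by omega⟩).val = 2 * (d.val / 2) := by
                simp only [sympState]
                split_ifs <;> simp <;> omega
              by_cases he : Even d.val
              · left
                apply Fin.ext
                rw [hs]
                rw [Nat.even_iff] at he
                omega
              · right
                apply Fin.ext
                rw [hs, (partner_val_of_not_even he).1]
                rw [Nat.even_iff] at he
                omega
          · refine ⟨⟨d.val / 2, by omega⟩, ?_, ?_, ?_⟩
            · rw [Fin.lt_def]; simp [hκ]; omega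
            · simp only [ne_eq, Fin.ext_iff]; omega
            · have hs : (sympState n (k + 1) ⟨d.val / 2, by omega⟩).val = 2 * (d.val / 2) := by
                simp only [sympState]
                split_ifs <;> simp <;> omega
              by_cases he : Even d.val
              · left
                apply Fin.ext
                rw [hs]
                rw [Nat.even_iff] at he
                omega
              · right
                apply Fin.ext
                rw [hs, (partner_val_of_not_even he).1]
                rw [Nat.even_iff] at he
                omega
      -- In the second half the entry in the factor k differs from all later ones, so the R^t are
      -- scalars and only G moves the multi-index.
      · rw [if_neg hkn, ← vecMul_vecMul, vecMul_prod_Rop_of_ne, vecMul_Gop_symp]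
        · have hv : (sympState n (k + 1) κ).val = 2 * (k - n) + 1 := by
            simp only [sympState, hκ]
            split_ifs <;> simp <;> omega
          have hev : ¬ Even (sympState n (k + 1) κ).val := by
            rw [hv]; simp
          have : update (sympState n (k + 1)) κ (partner (sympState n (k + 1) κ)) =
              sympState n k := by
            funext i
            by_cases hi : i = κ
            · subst hi
              apply Fin.ext
              rw [update_self, (partner_val_of_not_even hev).1, hv]
              simp only [sympState, hκ]
              split_ifs <;> simp <;> omega
            · rw [update_of_ne hi]
              have hi' : i.val ≠ k := fun e => hi (Fin.ext e)
              simp only [sympState]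
              split_ifs <;> first | rfl | (exfalso; omega)
          rw [this, gEntry, if_neg hev, smul_eq_algebraMap_smul (Z := Z), smul_smul, mul_comm]
        · intro j hj
          rw [mem_drop_finRange] at hj
          refine ⟨fun e => by rw [← e] at hj; simp [hκ] at hj, fun e => ?_⟩
          have := congrArg Fin.val e
          simp only [sympState, hκ] at this
          split_ifs at this <;> simp at this <;> omega
    · intro m m' hm hm'
      refine mul_mem (onOne_mem_altPres q ?_ ?_ _)
        (prod_Rop_mem_altPres hq hx hm' _ (k + 1) hm (by simp [hκ])) φ (hφ m m' (by omega) hm')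
      · intro e
        rw [← e] at hm
        simp [hκ] at hm
      · intro e
        rw [← e] at hm'
        simp [hκ] at hm'
        omega

theorem sympState_injective (n : ℕ) : Injective (sympState n (2 * n)) := by
  intro i j h
  have := congrArg Fin.val h
  apply Fin.ext
  simp only [sympState] at this
  split_ifs at this <;> simp at this <;> omega

theorem sympState_zero (n : ℕ) : sympState n 0 = sympState n (2 * n) := by
  funext i
  simp only [sympState]
  split_ifs <;> first | rfl | (exfalso; omega)

end Symp

end TwistedQYangian

end

noncomputable section

namespace TwistedQYangian

open Matrix Function

/-! ## Families of matrices satisfying the `RTT` relations -/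

section Families

variable {Z : Type*} [Field Z] [Algebra ℂ Z] {B : Type*} [Ring B] [Algebra ℂ B] [Algebra Z B]
  [IsScalarTower ℂ Z B] {r N : ℕ} {q : ℂ}

/-- The scalar `q` as an element of the field `Z`. -/
local notation "Q" => algebraMap ℂ Z q

/-- The row `(1, …, N)` of the antisymmetrizer, over an algebra. -/
def eta (B : Type*) [Ring B] [Algebra ℂ B] (q : ℂ) (N : ℕ) (c : Fin N → Fin N) : B :=
  algebraMap ℂ B (etaC q N c)

theorem eta_id (q : ℂ) (N : ℕ) : eta B q N id = 1 := by rw [eta, etaC_id, map_one]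

theorem isAlt_eta (hq : q ≠ 0) (i j : Fin N) (h : j.val = i.val + 1) :
    IsAlt q i j (eta B q N) := by
  intro a
  refine ⟨fun ha => ?_, fun ha => ?_⟩
  · rw [eta, (isAlt_etaC hq N i j h a).1 ha, map_zero]
  · rw [eta, (isAlt_etaC hq N i j h a).2 ha, map_neg, eta, smul_eq_mul, map_mul, Algebra.smul_def]

theorem alt_eq_smul_eta (hq : q ≠ 0) {φ : (Fin N → Fin N) → B}
    (h : ∀ m m' : Fin N, m'.val = m.val + 1 → IsAlt q m m' φ) : φ = φ id • eta B q N := by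
  funext a
  rw [alt_eq_smul_etaC hq h a, Pi.smul_apply, smul_eq_mul, eta, Algebra.smul_def, Algebra.commutes]

theorem eta_vecMul_of_mem (hq : q ≠ 0) {X : Matrix (Fin N → Fin N) (Fin N → Fin N) B}
    (h : ∀ m m' : Fin N, m'.val = m.val + 1 → X ∈ altPres B N q m m') :
    eta B q N ᵥ* X = (eta B q N ᵥ* X) id • eta B q N :=
  alt_eq_smul_eta hq fun m m' hm => h m m' hm _ (isAlt_eta hq m m' hm)

/-- The relation `R(x, y) X₁ Y₂ = Y₂ X₁ R(x, y)`. -/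
def RTT (q : ℂ) (x y : Z) (X Y : Matrix (Fin N) (Fin N) B) : Prop :=
  (Rmat q N x y).map (algebraMap Z B) * (X ⊗ₖ (1 : Matrix (Fin N) (Fin N) B)) *
      ((1 : Matrix (Fin N) (Fin N) B) ⊗ₖ Y) =
    ((1 : Matrix (Fin N) (Fin N) B) ⊗ₖ Y) * (X ⊗ₖ (1 : Matrix (Fin N) (Fin N) B)) *
      (Rmat q N x y).map (algebraMap Z B)

theorem kronecker_one_mul_one_kronecker (X Y : Matrix (Fin N) (Fin N) B) (a b : Fin N × Fin N) :
    ((X ⊗ₖ (1 : Matrix (Fin N) (Fin N) B)) * ((1 : Matrix (Fin N) (Fin N) B) ⊗ₖ Y)) a b =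
      X a.1 b.1 * Y a.2 b.2 := by
  rw [Matrix.mul_apply, Fintype.sum_eq_single (b.1, a.2)]
  · simp
  · rintro ⟨c, d⟩ h
    simp only [kroneckerMap_apply, Matrix.one_apply]
    by_cases h1 : a.2 = d
    · by_cases h2 : c = b.1
      · exact absurd (by rw [h1, h2]) h
      · simp [h2]
    · simp [h1]

theorem one_kronecker_mul_kronecker_one (X Y : Matrix (Fin N) (Fin N) B) (a b : Fin N × Fin N) :
    (((1 : Matrix (Fin N) (Fin N) B) ⊗ₖ Y) * (X ⊗ₖ (1 : Matrix (Fin N) (Fin N) B))) a b =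
      Y a.2 b.2 * X a.1 b.1 := by
  rw [Matrix.mul_apply, Fintype.sum_eq_single (a.1, b.2)]
  · simp
  · rintro ⟨c, d⟩ h
    simp only [kroneckerMap_apply, Matrix.one_apply]
    by_cases h1 : a.1 = c
    · by_cases h2 : d = b.2
      · exact absurd (by rw [h1, h2]) h
      · simp [h2]
    · simp [h1]

theorem rtt_iff {x y : Z} {X Y : Matrix (Fin N) (Fin N) B} : RTT q x y X Y ↔
    ∀ a b : Fin N × Fin N, ∑ c : Fin N × Fin N, Rmat q N x y a c • (X c.1 b.1 * Y c.2 b.2) =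
      ∑ c : Fin N × Fin N, Rmat q N x y c b • (Y a.2 c.2 * X a.1 c.1) := by
  rw [RTT, Matrix.mul_assoc, ← Matrix.ext_iff]
  refine forall_congr' fun a => forall_congr' fun b => ?_
  rw [Matrix.mul_apply, Matrix.mul_apply]
  simp only [kronecker_one_mul_one_kronecker, one_kronecker_mul_kronecker_one, Matrix.map_apply,
    mul_algebraMap_eq_smul, Algebra.smul_def]

theorem RTT.rch {x y : Z} {X Y : Matrix (Fin N) (Fin N) B} (h : RTT q x y X Y) :
    (Rch q N x y).map (algebraMap Z B) * ((X ⊗ₖ (1 : Matrix (Fin N) (Fin N) B)) *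
      ((1 : Matrix (Fin N) (Fin N) B) ⊗ₖ Y)) =
    ((Y ⊗ₖ (1 : Matrix (Fin N) (Fin N) B)) * ((1 : Matrix (Fin N) (Fin N) B) ⊗ₖ X)) *
      (Rch q N x y).map (algebraMap Z B) := by
  ext a b
  have := rtt_iff.1 h a.swap b
  rw [Matrix.mul_apply, Matrix.mul_apply]
  simp only [kronecker_one_mul_one_kronecker, Matrix.map_apply, mul_algebraMap_eq_smul, Rch,
    ← Algebra.smul_def]
  rw [this, ← (Equiv.prodComm (Fin N) (Fin N)).sum_comp]
  simp

theorem RTT.rch_sites {x y : Z} {X Y : Matrix (Fin N) (Fin N) B} (h : RTT q x y X Y) {s s' : Fin r}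
    (hs : s ≠ s') :
    onTwo s s' ((Rch q N x y).map (algebraMap Z B)) * (onOne s X * onOne s' Y) =
      onOne s Y * onOne s' X * onTwo s s' ((Rch q N x y).map (algebraMap Z B)) := by
  rw [onOne_eq_onTwo_left hs, onOne_eq_onTwo_right hs, onOne_eq_onTwo_left hs,
    onOne_eq_onTwo_right hs]
  simp only [← onTwo_mul hs]
  rw [h.rch]

theorem RTT.sites {x y : Z} {X Y : Matrix (Fin N) (Fin N) B} (h : RTT q x y X Y) {s s' : Fin r}
    (hs : s ≠ s') :
    onTwo s s' ((Rmat q N x y).map (algebraMap Z B)) * (onOne s X * onOne s' Y) =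
      onOne s' Y * onOne s X * onTwo s s' ((Rmat q N x y).map (algebraMap Z B)) := by
  rw [onOne_eq_onTwo_left hs, onOne_eq_onTwo_right hs]
  simp only [← onTwo_mul hs]
  rw [← h, Matrix.mul_assoc]

/-- `X₁ X₂ ⋯ X_r`, where `X_i` is in the `i`-th factor. -/
def Xprod (X : Fin r → Matrix (Fin N) (Fin N) B) : Matrix (Fin r → Fin N) (Fin r → Fin N) B :=
  ((List.finRange r).map fun i => onOne i (X i)).prod

theorem finRange_eq_append {m m' : Fin r} (hm : m'.val = m.val + 1) :
    List.finRange r = (List.finRange r).take m.val ++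
      m :: m' :: (List.finRange r).drop (m'.val + 1) := by
  have e1 := drop_finRange_eq_cons m.isLt
  have e2 := drop_finRange_eq_cons m'.isLt
  rw [← hm] at e1
  conv_lhs => rw [← List.take_append_drop m.val (List.finRange r), e1, e2]

theorem mem_take_finRange {k : ℕ} {i : Fin r} (h : i ∈ (List.finRange r).take k) : i.val < k := by
  rw [List.mem_take_iff_getElem] at h
  obtain ⟨n, hn, rfl⟩ := h
  simp at hn ⊢
  omega

theorem rch_mul_Xprod {x y : Z} (X : Fin r → Matrix (Fin N) (Fin N) B) {m m' : Fin r}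
    (hm : m'.val = m.val + 1) (h : RTT q x y (X m) (X m')) :
    onTwo m m' ((Rch q N x y).map (algebraMap Z B)) * Xprod X =
      Xprod (X ∘ Equiv.swap m m') * onTwo m m' ((Rch q N x y).map (algebraMap Z B)) := by
  have hmm' : m ≠ m' := fun e => by rw [e] at hm; omega
  have hc : ∀ l : List (Fin r), (∀ i ∈ l, i ≠ m ∧ i ≠ m') →
      Commute (l.map fun i => onOne i (X i)).prod
        (onTwo m m' ((Rch q N x y).map (algebraMap Z B))) := by
    intro l hl
    refine Commute.list_prod_left _ _ fun Y hY => ?_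
    obtain ⟨j, hj, rfl⟩ := List.mem_map.1 hY
    exact commute_onOne_onTwo hmm' (hl j hj).1 (hl j hj).2
      fun a b c d => (commute_scalar _ _ _ _).symm
  have hsw : ∀ l : List (Fin r), (∀ i ∈ l, i ≠ m ∧ i ≠ m') →
      (l.map fun i => onOne i (X (Equiv.swap m m' i))) = l.map fun i => onOne i (X i) := by
    intro l hl
    refine List.map_congr_left fun i hi => ?_
    rw [Equiv.swap_apply_of_ne_of_ne (hl i hi).1 (hl i hi).2]
  have h1 : ∀ i ∈ (List.finRange r).take m.val, i ≠ m ∧ i ≠ m' := by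
    intro i hi
    have := mem_take_finRange hi
    constructor <;>
    · rintro rfl; omega
  have h2 : ∀ i ∈ (List.finRange r).drop (m'.val + 1), i ≠ m ∧ i ≠ m' := by
    intro i hi
    rw [mem_drop_finRange] at hi
    constructor <;>
    · rintro rfl; omega
  rw [Xprod, Xprod, finRange_eq_append hm]
  simp only [List.map_append, List.prod_append, List.map_cons, List.prod_cons, hsw _ h1, hsw _ h2,
    Function.comp_apply, Equiv.swap_apply_left, Equiv.swap_apply_right]
  rw [← mul_assoc, ← (hc _ h1).eq, mul_assoc, mul_assoc]
  congr 1
  rw [← mul_assoc (onOne m (X m)), ← mul_assoc, h.rch_sites hmm', mul_assoc, ← (hc _ h2).eq]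
  simp only [mul_assoc]

/-- An alternating φ is an eigenvector of Ř(x, q⁻²x) with eigenvalue q⁻¹y(1 - q⁴) for y = q⁻²x,
which is nonzero. So Ř can be inserted in front of the product and moved through it to the right,
and its image there is alternating. -/
theorem Xprod_mem_altPres (hq : q ≠ 0) (hq4 : q ^ 4 ≠ 1) {x y : Z} (hy : y ≠ 0)
    (hxy : x = Q ^ 2 * y) (X : Fin r → Matrix (Fin N) (Fin N) B) {m m' : Fin r}
    (hm : m'.val = m.val + 1) (h : RTT q x y (X m) (X m')) :
    Xprod X ∈ altPres B N q m m' := by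
  have hQ : Q ≠ 0 := algebraMap_ne_zero_of_ne_zero hq
  have hmm' : m ≠ m' := fun e => by rw [e] at hm; omega
  intro φ hφ
  have hlam : (Q)⁻¹ * y - Q * x ≠ 0 := by
    rw [hxy]
    intro e
    apply hq4
    have h1 : Q ^ 4 = 1 := by
      have h2 : y * (1 - Q ^ 4) = 0 := by
        field_simp at e
        linear_combination e
      linear_combination -(mul_eq_zero.1 h2).resolve_left hy
    rw [← map_pow, ← map_one (algebraMap ℂ Z)] at h1
    exact (algebraMap ℂ Z).injective h1
  have key : φ ᵥ* Xprod X = ((Q)⁻¹ * y - Q * x)⁻¹ • ((φ ᵥ* Xprod (X ∘ Equiv.swap m m')) ᵥ*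
      onTwo m m' ((Rch q N x y).map (algebraMap Z B))) := by
    rw [vecMul_vecMul, ← rch_mul_Xprod X hm h, ← vecMul_vecMul, hφ.vecMul_Rch hq hmm',
      smul_vecMul, smul_smul, inv_mul_cancel₀ hlam, one_smul]
  rw [key, ← vecMul_smul]
  have := smul_mem_altPres (Z := Z) (B := B) (N := N) (q := q) ((Q)⁻¹ * y - Q * x)⁻¹
    (one_mem (altPres B N q m m'))
  have h2 := isAlt_vecMul_Rch (B := B) hq hmm' (φ ᵥ* Xprod (X ∘ Equiv.swap m m')) hxy
  have h3 := this _ h2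
  rwa [vecMul_smul, vecMul_one, ← vecMul_smul] at h3

theorem Xprod_apply (X : Fin r → Matrix (Fin N) (Fin N) B) (a b : Fin r → Fin N) :
    Xprod X a b = ((List.finRange r).map fun i => X i (a i) (b i)).prod := by
  rw [Xprod, prod_onOne_apply X _ (List.nodup_finRange r), if_pos]
  intro k hk
  exact absurd (List.mem_finRange k) hk

/-! ### Independence of the order of the factors -/

theorem Rch_symm (q : ℂ) (N : ℕ) (x y : Z) : (Rch q N x y)ᵀ = Rch q N x y := by
  ext ⟨a1, a2⟩ ⟨b1, b2⟩
  simp only [Matrix.transpose_apply, Rch, Rmat, Prod.swap_prod_mk, Prod.mk.injEq]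
  by_cases h : b2 = a1 ∧ b1 = a2
  · obtain ⟨rfl, rfl⟩ := h
    simp [eq_comm]
  · have e1 : ¬ (a2 = b1 ∧ a1 = b2) := fun e => h ⟨e.2.symm, e.1.symm⟩
    simp only [if_neg h, if_neg e1]
    by_cases h' : b2 = a2 ∧ b1 = a1
    · obtain ⟨rfl, rfl⟩ := h'
      simp
    · have e2 : ¬ (a2 = b2 ∧ a1 = b1) := fun e => h' ⟨e.1.symm, e.2.symm⟩
      simp only [if_neg h', if_neg e2]

/-- Ř is a symmetric matrix, so its row eigenvector η is also a column eigenvector with the same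
eigenvalue. -/
theorem Rch_mulVec_eta (hq : q ≠ 0) {m m' : Fin N} (hm : m'.val = m.val + 1) (x y : Z) :
    onTwo m m' ((Rch q N x y).map (algebraMap Z B)) *ᵥ eta B q N =
      ((Q)⁻¹ * y - Q * x) • eta B q N := by
  have hmm' : m ≠ m' := fun e => by rw [e] at hm; omega
  rw [← (isAlt_eta hq m m' hm).vecMul_Rch hq hmm' x y]
  funext a
  rw [mulVec, vecMul, dotProduct, dotProduct]
  refine Finset.sum_congr rfl fun c _ => ?_
  have : onTwo m m' ((Rch q N x y).map (algebraMap Z B)) a c =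
      onTwo m m' ((Rch q N x y).map (algebraMap Z B)) c a := by
    simp only [onTwo, Matrix.map_apply]
    have h1 := congrFun (congrFun (Rch_symm q N x y) (c m, c m')) (a m, a m')
    rw [Matrix.transpose_apply] at h1
    rw [h1]
    congr 1
    exact propext ⟨fun h k h1 h2 => (h k h1 h2).symm, fun h k h1 h2 => (h k h1 h2).symm⟩
  rw [this]
  exact (Algebra.commutes (etaC q N c) _).symm

/-- The matrix element of `X₁ ⋯ X_N` between two copies of the alternating vector. -/
def sandwich (q : ℂ) (X : Fin N → Matrix (Fin N) (Fin N) B) : B :=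
  (eta B q N ᵥ* Xprod X) ⬝ᵥ eta B q N

/-- Ř acts on both copies of η by the same scalar. Moving it from the left end to the right end
exchanges two neighbouring matrices, and the nonzero scalar cancels. -/
theorem sandwich_comp_swap (hq : q ≠ 0) {x y : Z} (X : Fin N → Matrix (Fin N) (Fin N) B)
    {m m' : Fin N} (hm : m'.val = m.val + 1) (h : RTT q x y (X m) (X m'))
    (hlam : (Q)⁻¹ * y - Q * x ≠ 0) :
    sandwich q (X ∘ Equiv.swap m m') = sandwich q X := by
  have hmm' : m ≠ m' := fun e => by rw [e] at hm; omega
  have h1 : ((Q)⁻¹ * y - Q * x) • sandwich q X =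
      ((Q)⁻¹ * y - Q * x) • sandwich q (X ∘ Equiv.swap m m') := by
    rw [sandwich, ← smul_dotProduct, ← smul_vecMul,
      ← (isAlt_eta hq m m' hm).vecMul_Rch hq hmm' x y, vecMul_vecMul, rch_mul_Xprod X hm h,
      ← vecMul_vecMul, ← dotProduct_mulVec, Rch_mulVec_eta hq hm, dotProduct_smul, sandwich]
  exact (smul_right_injective B hlam h1).symm

theorem eq_rev_of_no_ascent (w : Equiv.Perm (Fin N))
    (h : ∀ m m' : Fin N, m'.val = m.val + 1 → ¬ w m < w m') : (w : Fin N → Fin N) = Fin.rev := by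
  have hanti : ∀ (d : ℕ) (i j : Fin N), j.val = i.val + 1 + d → w j < w i := by
    intro d
    induction d with
    | zero =>
      intro i j hij
      refine lt_of_le_of_ne (not_lt.1 (h i j (by omega))) fun e => ?_
      have := w.injective e
      rw [this] at hij
      omega
    | succ d ih =>
      intro i j hij
      have hj := j.isLt
      refine (ih ⟨i.val + 1, by omega⟩ j (by simp; omega)).trans (lt_of_le_of_ne
        (not_lt.1 (h i ⟨i.val + 1, by omega⟩ rfl)) fun e => ?_)
      have := congrArg Fin.val (w.injective e)
      simp at this
  have hmono : StrictMono (fun i => w (Fin.rev i)) := by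
    intro i j hij
    rw [Fin.lt_def] at hij
    refine hanti (j.val - i.val - 1) j.rev i.rev ?_
    simp only [Fin.val_rev]
    omega
  have hid : (fun i => w (Fin.rev i)) = id := by
    have h2 : Set.range (fun i => w (Fin.rev i)) = Set.range (id : Fin N → Fin N) := by
      rw [Set.range_id, Set.range_eq_univ]
      exact w.surjective.comp Fin.rev_surjective
    exact (StrictMono.range_inj hmono strictMono_id).1 h2
  funext i
  have := congrFun hid i.rev
  simpa using this

/-- The reversal is reached from the identity by swapping adjacent ascents, so only the relations
with i < j are used. Each swap raises the number of inversions, which is bounded by N², and a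
permutation without ascents is the reversal. -/
theorem sandwich_rev (hq : q ≠ 0) {x : Fin N → Z} (X : Fin N → Matrix (Fin N) (Fin N) B)
    (h : ∀ i j, i < j → RTT q (x i) (x j) (X i) (X j))
    (hlam : ∀ i j, i < j → (Q)⁻¹ * x j - Q * x i ≠ 0) :
    sandwich q (X ∘ Fin.rev) = sandwich q X := by
  have key : ∀ (d : ℕ) (w : Equiv.Perm (Fin N)), inv (w : Fin N → Fin N) + d = N * N →
      sandwich q (X ∘ w) = sandwich q (X ∘ Fin.rev) := by
    intro d
    induction d using Nat.strong_induction_on with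
    | _ d ih =>
      intro w hw
      by_cases hasc : ∀ m m' : Fin N, m'.val = m.val + 1 → ¬ w m < w m'
      · rw [eq_rev_of_no_ascent w hasc]
      · push Not at hasc
        obtain ⟨m, m', hm, hlt⟩ := hasc
        have hi := inv_comp_swap w m m' hm
        rw [if_pos hlt, if_neg hlt.not_gt] at hi
        have hb : inv ((w * Equiv.swap m m' : Equiv.Perm (Fin N)) : Fin N → Fin N) ≤ N * N := by
          refine (Finset.card_filter_le _ _).trans ?_
          simp
        rw [Equiv.Perm.coe_mul] at hb
        rw [← sandwich_comp_swap hq (X ∘ w) hm (h _ _ hlt) (hlam _ _ hlt)]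
        refine ih (d - 1) ?_ (w * Equiv.swap m m') ?_
        · omega
        · rw [Equiv.Perm.coe_mul]
          omega
  have hb : inv ((1 : Equiv.Perm (Fin N)) : Fin N → Fin N) ≤ N * N := by
    rw [Equiv.Perm.coe_one, inv_id]
    exact Nat.zero_le _
  rw [← key (N * N - inv ((1 : Equiv.Perm (Fin N)) : Fin N → Fin N)) 1 (by omega)]
  rfl

end Families

end TwistedQYangian

end

noncomputable section

namespace TwistedQYangian

open Matrix Function

/-! ## Ordered products of Sklyanin type -/

section OrdProd

variable {M ι : Type*} [Monoid M]

/-- `S₁ R₁₂ ⋯ R₁ₙ S₂ R₂₃ ⋯ R₂ₙ ⋯ Sₙ`. -/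
def ordProd (S : ι → M) (R : ι → ι → M) : List ι → M
  | [] => 1
  | i :: l => S i * (l.map (R i)).prod * ordProd S R l

theorem commute_ordProd {S : ι → M} {R : ι → ι → M} {l : List ι} {Y : M}
    (hl : l.Nodup) (hS : ∀ i ∈ l, Commute (S i) Y)
    (hR : ∀ i ∈ l, ∀ j ∈ l, i ≠ j → Commute (R i j) Y) : Commute (ordProd S R l) Y := by
  induction l with
  | nil => exact Commute.one_left _
  | cons i l ih =>
    obtain ⟨hi, hl⟩ := List.nodup_cons.1 hl
    refine Commute.mul_left (Commute.mul_left (hS i (by simp)) ?_)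
      (ih hl (fun j hj => hS j (by simp [hj]))
        fun j hj k hk => hR j (by simp [hj]) k (by simp [hk]))
    refine Commute.list_prod_left _ _ fun x hx => ?_
    obtain ⟨j, hj, rfl⟩ := List.mem_map.1 hx
    exact hR i (by simp) j (by simp [hj]) fun e : i = j => hi (e ▸ hj)

/-- Within the row `i`, the relation `hex` carries T'_i to the right through R_ij and T_j for all
later j, after which it commutes with the rest of the product of the G's and R's. -/
theorem ordProd_factor {T G T' : ι → M} {R : ι → ι → M}
    (hex : ∀ i j, i ≠ j → T' i * R i j * T j = T j * R i j * T' i)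
    (hRT : ∀ i j k, i ≠ j → k ≠ i → k ≠ j → Commute (R i j) (T k))
    (hRT' : ∀ i j k, i ≠ j → k ≠ i → k ≠ j → Commute (R i j) (T' k))
    (hGT : ∀ i j, i ≠ j → Commute (G i) (T j)) (hGT' : ∀ i j, i ≠ j → Commute (G i) (T' j))
    {l : List ι} (hl : l.Nodup) :
    ordProd (fun i => T i * G i * T' i) R l = (l.map T).prod * ordProd G R l * (l.map T').prod := by
  induction l with
  | nil => simp [ordProd]
  | cons i l ih =>
    obtain ⟨hi, hl'⟩ := List.nodup_cons.1 hl
    have hne : ∀ j ∈ l, i ≠ j := fun j hj (e : i = j) => hi (e ▸ hj)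
    -- Interleaving the two products into factors R_ij T_j lets the exchange relation be applied to
    -- one j at a time.
    have h1 : T' i * ((l.map (R i)).prod * (l.map T).prod) =
        (l.map T).prod * (l.map (R i)).prod * T' i := by
      rw [List.prod_map_mul_of_commute _ _ l hl' fun j hj k hk hjk =>
          hRT i j k (hne j hj) (hne k hk).symm hjk.symm,
        List.prod_map_mul_of_commute _ _ l hl' fun j hj k hk hjk =>
          (hRT i k j (hne k hk) (hne j hj).symm hjk).symm]
      clear ih hi hl hl'
      induction l with
      | nil => simp
      | cons j l ih =>
        rw [List.map_cons, List.prod_cons, List.map_cons, List.prod_cons, ← mul_assoc, ← mul_assoc,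
          hex i j (hne j (by simp)), mul_assoc, ih fun k hk => hne k (by simp [hk])]
        simp only [mul_assoc]
    have h2 : Commute (G i) (l.map T).prod := by
      refine Commute.list_prod_right _ _ fun x hx => ?_
      obtain ⟨j, hj, rfl⟩ := List.mem_map.1 hx
      exact hGT i j (hne j hj)
    have h3 : Commute (ordProd G R l) (T' i) :=
      commute_ordProd hl' (fun j hj => hGT' j i (hne j hj).symm)
        fun j hj k hk hjk => hRT' j k i hjk (hne j hj) (hne k hk)
    rw [ordProd, ih hl', ordProd, List.map_cons, List.prod_cons, List.map_cons, List.prod_cons]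
    calc T i * G i * T' i * (l.map (R i)).prod *
          ((l.map T).prod * ordProd G R l * (l.map T').prod)
        = T i * (G i * (T' i * ((l.map (R i)).prod * (l.map T).prod))) *
            ordProd G R l * (l.map T').prod := by simp only [mul_assoc]
      _ = T i * (G i * (l.map T).prod * (l.map (R i)).prod * (T' i *
            ordProd G R l)) * (l.map T').prod := by rw [h1]; simp only [mul_assoc]
      _ = _ := by rw [h2.eq, ← h3.eq]; simp only [mul_assoc]

end OrdProd

/-! ### The action of the ordered product on η. -/

section Left

variable {Z : Type*} [Field Z] [Algebra ℂ Z] {B : Type*} [Ring B] [Algebra ℂ B] [Algebra Z B]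
  [IsScalarTower ℂ Z B] {r N : ℕ} {q : ℂ}

/-- The scalar `q` as an element of the field `Z`. -/
local notation "Q" => algebraMap ℂ Z q

theorem Kop_eq_ordProd (κ : TwistType N) (x : Fin r → Z) (l : List (Fin r)) :
    Kop B q κ x l = ordProd (Gop B q κ) (Rop B q N x) l := by
  induction l with
  | nil => rfl
  | cons i l ih => rw [Kop, ordProd, ih]

/-- The scalar by which `G₁ R₁₂ ⋯ R₁ₙ G₂ ⋯ Gₙ` acts on the alternating row vector. -/
def kScalar (q : ℂ) : {N : ℕ} → TwistType N → (Fin N → Z) → Z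
  | N, .orth _, x => pairProd x (List.finRange N)
  | _, .symp n, x => sympProd q n x (List.finRange (2 * n))

/-- K maps η to a multiple of itself, and the multiple may be computed at any multi-index where η
does not vanish: `id` in the orthogonal case, `sympState` in the symplectic one. -/
theorem eta_vecMul_Kop (hq : q ≠ 0) (κ : TwistType N) {x : Fin N → Z} (hx0 : ∀ i, x i ≠ 0)
    (hx : ∀ m m' : Fin N, m'.val = m.val + 1 → x m = Q ^ 2 * x m') :
    eta B q N ᵥ* Kop B q κ x (List.finRange N) = kScalar q κ x • eta B q N := by
  have h := eta_vecMul_of_mem (B := B) hq (X := Kop B q κ x (List.finRange N)) fun m m' hm =>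
    Kop_mem_altPres hq κ hx0 hx hm 0 (Nat.zero_le _)
  rw [h]
  cases κ with
  | orth =>
    rw [vecMul_Kop_orth _ _ (List.nodup_finRange N) _ injective_id, eta_id, smul_assoc, one_smul]
    rfl
  | symp n =>
    have h1 := vecMul_Kop_symp (Z := Z) (B := B) (n := n) hq hx 0 (Nat.zero_le _) (eta B q (2 * n))
      (fun m m' _ hm => isAlt_eta hq m m' hm)
    have h2 := congrFun h (sympState n (2 * n))
    rw [List.drop_zero] at h1
    rw [h1, sympState_zero] at h2
    have h3 : etaC q (2 * n) (sympState n (2 * n)) ≠ 0 :=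
      etaC_ne_zero_of_injective hq (sympState_injective n)
    have h4 : (eta B q (2 * n) ᵥ* Kop B q (.symp n) x (List.finRange (2 * n))) id =
        algebraMap Z B (sympProd q n x (List.finRange (2 * n))) := by
      -- The value of η at this multi-index is a nonzero complex number and can be cancelled.
      have h5 := congrArg (fun b => b * algebraMap ℂ B (etaC q (2 * n) (sympState n (2 * n)))⁻¹) h2
      simp only [Pi.smul_apply, smul_eq_mul, eta, Algebra.smul_def, mul_assoc] at h5
      rw [← map_mul, mul_inv_cancel₀ h3, map_one, mul_one, mul_one] at h5
      exact h5.symm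
    rw [h4, algebraMap_smul]
    rfl

/-- The determinant of a family of matrices, expanded along rows. -/
def rowDet (q : ℂ) (X : Fin N → Matrix (Fin N) (Fin N) B) : B := (eta B q N ᵥ* Xprod X) id

theorem rowDet_apply (X : Fin N → Matrix (Fin N) (Fin N) B) :
    rowDet q X = ∑ b, eta B q N b * ((List.finRange N).map fun i => X i (b i) i).prod := by
  rw [rowDet, vecMul, dotProduct]
  simp only [Xprod_apply, id]

theorem eta_vecMul_Xprod (hq : q ≠ 0) (hq4 : q ^ 4 ≠ 1) {x : Fin N → Z} (hx0 : ∀ i, x i ≠ 0)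
    (hx : ∀ m m' : Fin N, m'.val = m.val + 1 → x m = Q ^ 2 * x m')
    {X : Fin N → Matrix (Fin N) (Fin N) B}
    (h : ∀ i j, i < j → RTT q (x i) (x j) (X i) (X j)) :
    eta B q N ᵥ* Xprod X = rowDet q X • eta B q N :=
  eta_vecMul_of_mem hq fun m m' hm => Xprod_mem_altPres hq hq4 (hx0 m') (hx m m' hm) X hm
    (h m m' (by rw [Fin.lt_def]; omega))

/-- The relation `X₁ R^t(x, y) Y₂ = Y₂ R^t(x, y) X₁`. -/
def Exch (q : ℂ) (x y : Z) (X Y : Matrix (Fin N) (Fin N) B) : Prop :=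
  (X ⊗ₖ (1 : Matrix (Fin N) (Fin N) B)) * (Rt q N x y).map (algebraMap Z B) *
      ((1 : Matrix (Fin N) (Fin N) B) ⊗ₖ Y) =
    ((1 : Matrix (Fin N) (Fin N) B) ⊗ₖ Y) * (Rt q N x y).map (algebraMap Z B) *
      (X ⊗ₖ (1 : Matrix (Fin N) (Fin N) B))

theorem Exch.sites {x y : Z} {X Y : Matrix (Fin N) (Fin N) B} (h : Exch q x y X Y) {s s' : Fin r}
    (hs : s ≠ s') :
    onOne s X * onTwo s s' ((Rt q N x y).map (algebraMap Z B)) * onOne s' Y =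
      onOne s' Y * onTwo s s' ((Rt q N x y).map (algebraMap Z B)) * onOne s X := by
  rw [onOne_eq_onTwo_left hs, onOne_eq_onTwo_right hs]
  simp only [← onTwo_mul hs]
  rw [h]

theorem kronecker_one_mul (X : Matrix (Fin N) (Fin N) B)
    (M : Matrix (Fin N × Fin N) (Fin N × Fin N) B) (a b : Fin N × Fin N) :
    ((X ⊗ₖ (1 : Matrix (Fin N) (Fin N) B)) * M) a b = ∑ c, X a.1 c * M (c, a.2) b := by
  rw [Matrix.mul_apply, Fintype.sum_prod_type]
  refine Finset.sum_congr rfl fun c _ => ?_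
  rw [Fintype.sum_eq_single a.2]
  · simp
  · intro d hd
    simp [Matrix.one_apply_ne' hd]

theorem one_kronecker_mul (Y : Matrix (Fin N) (Fin N) B)
    (M : Matrix (Fin N × Fin N) (Fin N × Fin N) B) (a b : Fin N × Fin N) :
    (((1 : Matrix (Fin N) (Fin N) B) ⊗ₖ Y) * M) a b = ∑ c, Y a.2 c * M (a.1, c) b := by
  rw [Matrix.mul_apply, Fintype.sum_prod_type, Fintype.sum_eq_single a.1]
  · simp
  · intro d hd
    simp [Matrix.one_apply_ne' hd]

theorem mul_kronecker_one (X : Matrix (Fin N) (Fin N) B)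
    (M : Matrix (Fin N × Fin N) (Fin N × Fin N) B) (a b : Fin N × Fin N) :
    (M * (X ⊗ₖ (1 : Matrix (Fin N) (Fin N) B))) a b = ∑ c, M a (c, b.2) * X c b.1 := by
  rw [Matrix.mul_apply, Fintype.sum_prod_type]
  refine Finset.sum_congr rfl fun c _ => ?_
  rw [Fintype.sum_eq_single b.2]
  · simp
  · intro d hd
    simp [Matrix.one_apply_ne hd]

theorem mul_one_kronecker (Y : Matrix (Fin N) (Fin N) B)
    (M : Matrix (Fin N × Fin N) (Fin N × Fin N) B) (a b : Fin N × Fin N) :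
    (M * ((1 : Matrix (Fin N) (Fin N) B) ⊗ₖ Y)) a b = ∑ c, M a (b.1, c) * Y c b.2 := by
  rw [Matrix.mul_apply, Fintype.sum_prod_type, Fintype.sum_eq_single b.1]
  · simp
  · intro d hd
    simp [Matrix.one_apply_ne hd]

theorem exch_iff {x y : Z} {X Y : Matrix (Fin N) (Fin N) B} : Exch q x y X Y ↔
    ∀ a b : Fin N × Fin N,
      ∑ c : Fin N × Fin N, Rt q N x y (c.1, a.2) (b.1, c.2) • (X a.1 c.1 * Y c.2 b.2) =
      ∑ c : Fin N × Fin N, Rt q N x y (a.1, c.2) (c.1, b.2) • (Y a.2 c.2 * X c.1 b.1) := by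
  rw [Exch, ← Matrix.ext_iff]
  refine forall_congr' fun a => forall_congr' fun b => ?_
  rw [mul_one_kronecker, mul_kronecker_one]
  simp only [kronecker_one_mul, one_kronecker_mul, Finset.sum_mul, Matrix.map_apply]
  rw [Finset.sum_comm, ← Fintype.sum_prod_type', ← Fintype.sum_prod_type']
  simp only [mul_algebraMap_eq_smul, smul_mul_assoc]

/-- Transposing `X` turns the `RTT` relation into the exchange relation with `R^t`. -/
theorem RTT.exch {x y : Z} {X Y : Matrix (Fin N) (Fin N) B} (h : RTT q x y X Y) :
    Exch q x y Xᵀ Y := by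
  rw [exch_iff]
  intro a b
  exact rtt_iff.1 h (b.1, a.2) (a.1, b.2)

/-- Matrices `T_i`, `T'_i` subject to the relations that govern the ordered products of the
matrices `T_i G T'_i`. -/
structure SklyaninData (q : ℂ) (x : Fin N → Z) (T T' : Fin N → Matrix (Fin N) (Fin N) B) :
    Prop where
  ne_zero : ∀ i, x i ≠ 0
  step : ∀ m m' : Fin N, m'.val = m.val + 1 → x m = algebraMap ℂ Z q ^ 2 * x m'
  rtt : ∀ i j, i < j → RTT q (x i) (x j) (T i) (T j)
  rtt' : ∀ i j, i < j → RTT q (x i) (x j) (T' i) (T' j)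
  exch : ∀ i j, i ≠ j → Exch q (x i)⁻¹ (x j) (T' i) (T j)

/-- `S_i = T_i G T'_i` in the `i`-th factor. -/
def Sop (q : ℂ) (κ : TwistType N) (T T' : Fin N → Matrix (Fin N) (Fin N) B) (i : Fin N) :
    Matrix (Fin N → Fin N) (Fin N → Fin N) B :=
  onOne i (T i * (Gmat q κ).map (algebraMap ℂ B) * T' i)

/-- The three factors given by `ordProd_factor` act on η one after another, each by its own
eigenvalue. -/
theorem SklyaninData.eta_vecMul {x : Fin N → Z} {T T' : Fin N → Matrix (Fin N) (Fin N) B}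
    (D : SklyaninData q x T T') (hq : q ≠ 0) (hq4 : q ^ 4 ≠ 1) (κ : TwistType N) :
    eta B q N ᵥ* ordProd (Sop q κ T T') (Rop B q N x) (List.finRange N) =
      (rowDet q T * algebraMap Z B (kScalar q κ x) * rowDet q T') • eta B q N := by
  have h1 : Sop q κ T T' = fun i => onOne i (T i) * Gop B q κ i * onOne i (T' i) := by
    funext i
    rw [Sop, onOne_mul, onOne_mul, Gop]
  rw [h1, ordProd_factor (T := fun i => onOne i (T i)) (G := Gop B q κ)
    (T' := fun i => onOne i (T' i)) (R := Rop B q N x)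
    (fun i j hij => (D.exch i j hij).sites hij) _ _ _ _ (List.nodup_finRange N), ← Kop_eq_ordProd, ← vecMul_vecMul, ← vecMul_vecMul]
  · change ((eta B q N ᵥ* Xprod T) ᵥ* _) ᵥ* Xprod T' = _
    rw [eta_vecMul_Xprod hq hq4 D.ne_zero D.step D.rtt, smul_vecMul,
      eta_vecMul_Kop hq κ D.ne_zero D.step, smul_vecMul, smul_vecMul,
      eta_vecMul_Xprod hq hq4 D.ne_zero D.step D.rtt', ← algebraMap_smul B (kScalar q κ x),
      smul_smul, smul_smul, mul_assoc]
  · exact fun i j k hij hki hkj =>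
      (commute_onOne_onTwo hij hki hkj fun a b c d => (commute_scalar _ _ _ _).symm).symm
  · exact fun i j k hij hki hkj =>
      (commute_onOne_onTwo hij hki hkj fun a b c d => (commute_scalar _ _ _ _).symm).symm
  · exact fun i j hij => commute_onOne_onOne hij fun a b c d => Algebra.commutes _ _
  · exact fun i j hij => commute_onOne_onOne hij fun a b c d => Algebra.commutes _ _

end Left

end TwistedQYangian

end

noncomputable section

namespace TwistedQYangian

open Matrix Function MulOpposite

/-! ## Passing to the opposite algebra -/

section Opposite

variable {Z : Type*} [Field Z] [Algebra ℂ Z] {B : Type*} [Ring B] [Algebra ℂ B] [Algebra Z B]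
  [IsScalarTower ℂ Z B] {r N : ℕ} {q : ℂ}

/-- The scalar `q` as an element of the field `Z`. -/
local notation "Q" => algebraMap ℂ Z q

/-- The transposed matrix over the opposite algebra, with the indices renamed by `ρ`. -/
def opT {s : Type*} (ρ : s → s) (M : Matrix s s B) : Matrix s s Bᵐᵒᵖ :=
  fun a b => op (M (ρ b) (ρ a))

theorem opT_mul {s : Type*} [Fintype s] {ρ : s → s} (hρ : Involutive ρ) (M M' : Matrix s s B) :
    opT ρ (M * M') = opT ρ M' * opT ρ M := by
  ext a b
  rw [opT, Matrix.mul_apply, Matrix.mul_apply, Finset.op_sum, ← hρ.bijective.sum_comp]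
  rfl

theorem opT_one {s : Type*} [Fintype s] [DecidableEq s] {ρ : s → s} (hρ : Involutive ρ) :
    opT ρ (1 : Matrix s s B) = 1 := by
  ext a b
  simp only [opT, Matrix.one_apply, hρ.injective.eq_iff, eq_comm (a := b)]
  split_ifs <;> simp

theorem involutive_rev_comp : Involutive fun a : Fin r → Fin N => Fin.rev ∘ a := fun a => by
  funext i; simp

theorem involutive_prod_rev :
    Involutive (Prod.map Fin.rev Fin.rev : Fin N × Fin N → Fin N × Fin N) :=
  Fin.rev_involutive.prodMap Fin.rev_involutive

theorem opT_onOne (i : Fin r) (M : Matrix (Fin N) (Fin N) B) :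
    opT (fun a => Fin.rev ∘ a) (onOne i M) = onOne i (opT Fin.rev M) := by
  ext a b
  simp only [opT, onOne, Function.comp_apply, Fin.rev_inj, eq_comm (a := b _)]
  split_ifs <;> simp

theorem opT_onTwo (i j : Fin r) (M : Matrix (Fin N × Fin N) (Fin N × Fin N) B) :
    opT (fun a => Fin.rev ∘ a) (onTwo i j M) = onTwo i j (opT (Prod.map Fin.rev Fin.rev) M) := by
  ext a b
  simp only [opT, onTwo, Function.comp_apply, Fin.rev_inj, eq_comm (a := b _), Prod.map_apply]
  split_ifs <;> simp

/-- Transposition interchanges the terms with i > j and i < j, and the reversal of the indices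
interchanges them back. The same combination fixes G, which makes it possible to pass to the
opposite algebra. -/
theorem Rmat_rev (x y : Z) (a b : Fin N × Fin N) :
    Rmat q N x y (Prod.map Fin.rev Fin.rev b) (Prod.map Fin.rev Fin.rev a) = Rmat q N x y a b := by
  obtain ⟨a1, a2⟩ := a
  obtain ⟨b1, b2⟩ := b
  simp only [Rmat, Prod.map_apply, Prod.mk.injEq, Fin.rev_inj, Fin.rev_lt_rev]
  by_cases h : a1 = b1 ∧ a2 = b2
  · obtain ⟨rfl, rfl⟩ := h
    simp
  · have h' : ¬ (b1 = a1 ∧ b2 = a2) := fun e => h ⟨e.1.symm, e.2.symm⟩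
    rw [if_neg h, if_neg h']
    by_cases h2 : a1 = b2 ∧ a2 = b1
    · obtain ⟨rfl, rfl⟩ := h2
      simp
    · have h2' : ¬ (b1 = a2 ∧ b2 = a1) := fun e => h2 ⟨e.2.symm, e.1.symm⟩
      rw [if_neg h2, if_neg h2']

theorem opT_Rmat (x y : Z) : opT (Prod.map Fin.rev Fin.rev) ((Rmat q N x y).map (algebraMap Z B)) =
    (Rmat q N x y).map (algebraMap Z Bᵐᵒᵖ) := by
  ext a b
  rw [opT, Matrix.map_apply, Rmat_rev, Matrix.map_apply]
  rfl

theorem opT_Rt (x y : Z) : opT (Prod.map Fin.rev Fin.rev) ((Rt q N x y).map (algebraMap Z B)) =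
    (Rt q N x y).map (algebraMap Z Bᵐᵒᵖ) := by
  ext a b
  rw [opT, Matrix.map_apply, Matrix.map_apply, Rt, Rt, ← Rmat_rev]
  simp only [Prod.map_apply, Prod.map_fst, Prod.map_snd, Fin.rev_rev]
  rfl

theorem Gmat_rev (κ : TwistType N) (i j : Fin N) :
    Gmat q κ (Fin.rev j) (Fin.rev i) = Gmat q κ i j := by
  cases κ with
  | orth => simp only [Gmat, Matrix.one_apply, Fin.rev_inj, eq_comm]
  | symp n =>
    have h1 : (Even j.rev.val ∧ i.rev.val = j.rev.val + 1) ↔ (Even i.val ∧ j.val = i.val + 1) := by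
      simp only [Fin.val_rev, Nat.even_iff]
      omega
    have h2 : (Even i.rev.val ∧ j.rev.val = i.rev.val + 1) ↔ (Even j.val ∧ i.val = j.val + 1) := by
      simp only [Fin.val_rev, Nat.even_iff]
      omega
    simp only [Gmat, h1, h2]

theorem opT_Gmat (κ : TwistType N) : opT Fin.rev ((Gmat q κ).map (algebraMap ℂ B)) =
    (Gmat q κ).map (algebraMap ℂ Bᵐᵒᵖ) := by
  ext a b
  rw [opT, Matrix.map_apply, Gmat_rev, Matrix.map_apply]
  rfl

theorem opT_kronecker_one (X : Matrix (Fin N) (Fin N) B) :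
    opT (Prod.map Fin.rev Fin.rev) (X ⊗ₖ (1 : Matrix (Fin N) (Fin N) B)) =
      opT Fin.rev X ⊗ₖ (1 : Matrix (Fin N) (Fin N) Bᵐᵒᵖ) := by
  ext a b
  simp only [opT, kroneckerMap_apply, Matrix.one_apply, Prod.map_fst, Prod.map_snd, Fin.rev_inj,
    eq_comm (a := b.2)]
  split_ifs <;> simp

theorem opT_one_kronecker (X : Matrix (Fin N) (Fin N) B) :
    opT (Prod.map Fin.rev Fin.rev) ((1 : Matrix (Fin N) (Fin N) B) ⊗ₖ X) =
      (1 : Matrix (Fin N) (Fin N) Bᵐᵒᵖ) ⊗ₖ opT Fin.rev X := by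
  ext a b
  simp only [opT, kroneckerMap_apply, Matrix.one_apply, Prod.map_fst, Prod.map_snd, Fin.rev_inj,
    eq_comm (a := b.1)]
  split_ifs <;> simp

theorem RTT.opT {x y : Z} {X Y : Matrix (Fin N) (Fin N) B} (h : RTT q x y X Y) :
    RTT q x y (opT Fin.rev X) (opT Fin.rev Y) := by
  have := congrArg (TwistedQYangian.opT (Prod.map Fin.rev Fin.rev)) h
  simp only [opT_mul involutive_prod_rev, opT_kronecker_one, opT_one_kronecker, opT_Rmat] at this
  rw [RTT, Matrix.mul_assoc, ← this, Matrix.mul_assoc]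

/-- Exchanging the two tensor factors. -/
theorem Exch.swap {x y : Z} {X Y : Matrix (Fin N) (Fin N) B} (h : Exch q x y X Y) :
    ((1 : Matrix (Fin N) (Fin N) B) ⊗ₖ X) * (Rt q N x y).map (algebraMap Z B) *
      (Y ⊗ₖ (1 : Matrix (Fin N) (Fin N) B)) =
    (Y ⊗ₖ (1 : Matrix (Fin N) (Fin N) B)) * (Rt q N x y).map (algebraMap Z B) *
      ((1 : Matrix (Fin N) (Fin N) B) ⊗ₖ X) := by
  ext a b
  have := exch_iff.1 h a.swap b.swap
  rw [mul_one_kronecker, mul_kronecker_one]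
  simp only [kronecker_one_mul, one_kronecker_mul, Finset.sum_mul, Matrix.map_apply]
  rw [Finset.sum_comm, ← Fintype.sum_prod_type', ← Fintype.sum_prod_type']
  simp only [mul_algebraMap_eq_smul, smul_mul_assoc]
  refine Eq.trans ?_ (this.trans ?_)
  · refine Finset.sum_congr rfl fun c _ => ?_
    rw [← Rt_swap]
    rfl
  · refine Finset.sum_congr rfl fun c _ => ?_
    rw [← Rt_swap]
    rfl

/-- Transposition reverses the product T G T', so T and T' exchange their roles over the opposite
algebra. -/
theorem SklyaninData.opT {x : Fin N → Z} {T T' : Fin N → Matrix (Fin N) (Fin N) B}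
    (D : SklyaninData q x T T') :
    SklyaninData q x (fun i => opT Fin.rev (T' i)) (fun i => opT Fin.rev (T i)) where
  ne_zero := D.ne_zero
  step := D.step
  rtt i j h := (D.rtt' i j h).opT
  rtt' i j h := (D.rtt i j h).opT
  exch i j h := by
    have h1 := (D.exch j i h.symm).swap
    have h2 := congrArg (TwistedQYangian.opT (Prod.map Fin.rev Fin.rev)) h1
    simp only [opT_mul involutive_prod_rev, opT_kronecker_one, opT_one_kronecker, opT_Rt] at h2
    -- The relation available here involves R^t(x_j⁻¹, x_i), which is proportional to R^t(x_i⁻¹,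
    -- x_j).
    rw [Exch, Rt_eq_smul q N (inv_ne_zero (D.ne_zero i)) (D.ne_zero j), _root_.inv_inv]
    simp only [Matrix.mul_smul, Matrix.smul_mul]
    rw [← Matrix.mul_assoc, ← Matrix.mul_assoc] at h2
    rw [h2]

/-- `Sₙ ⋯ R₂ₙ ⋯ R₂₃ S₂ R₁ₙ ⋯ R₁₂ S₁`. -/
def revProd {M ι : Type*} [Monoid M] (S : ι → M) (R : ι → ι → M) : List ι → M
  | [] => 1
  | i :: l => revProd S R l * ((l.reverse.map (R i)).prod * S i)

theorem opT_list_prod {s : Type*} [Fintype s] [DecidableEq s] {ρ : s → s} (hρ : Involutive ρ)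
    (l : List (Matrix s s B)) : opT ρ l.prod = (l.reverse.map (opT ρ)).prod := by
  induction l with
  | nil => simp [opT_one hρ]
  | cons M l ih => simp [opT_mul hρ, ih]

/-- The product in reverse order is turned into an ordered product of the first kind, so that
`SklyaninData.eta_vecMul` applies to it. -/
theorem opT_revProd (κ : TwistType N) (T T' : Fin N → Matrix (Fin N) (Fin N) B) (x : Fin N → Z)
    (l : List (Fin N)) :
    opT (fun a => Fin.rev ∘ a) (revProd (Sop q κ T T') (Rop B q N x) l) =
      ordProd (Sop q κ (fun i => opT Fin.rev (T' i)) (fun i => opT Fin.rev (T i)))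
        (Rop Bᵐᵒᵖ q N x) l := by
  induction l with
  | nil => exact opT_one involutive_rev_comp
  | cons i l ih =>
    rw [revProd, ordProd, opT_mul involutive_rev_comp, opT_mul involutive_rev_comp, ih,
      opT_list_prod involutive_rev_comp]
    congr 2
    · rw [Sop, opT_onOne, opT_mul Fin.rev_involutive, opT_mul Fin.rev_involutive, opT_Gmat, Sop,
        Matrix.mul_assoc]
    · simp only [List.map_reverse, List.reverse_reverse, List.map_map]
      refine congrArg List.prod (List.map_congr_left fun j _ => ?_)
      rw [Function.comp_apply, Rop, opT_onTwo, opT_Rt, Rop]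

/-- The determinant of a family of matrices, expanded along columns. -/
def colDet (q : ℂ) (X : Fin N → Matrix (Fin N) (Fin N) B) : B :=
  unop (rowDet q fun i => opT Fin.rev (X i))

theorem eta_op (c : Fin N → Fin N) : eta Bᵐᵒᵖ q N c = op (eta B q N c) := rfl

theorem SklyaninData.mulVec_eta {x : Fin N → Z} {T T' : Fin N → Matrix (Fin N) (Fin N) B}
    (D : SklyaninData q x T T') (hq : q ≠ 0) (hq4 : q ^ 4 ≠ 1) (κ : TwistType N)
    (a : Fin N → Fin N) :
    (revProd (Sop q κ T T') (Rop B q N x) (List.finRange N) *ᵥ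
      fun c => eta B q N (Fin.rev ∘ c)) a =
      (colDet q T * algebraMap Z B (kScalar q κ x) * colDet q T') * eta B q N (Fin.rev ∘ a) := by
  have h := congrFun (D.opT.eta_vecMul hq hq4 κ) (Fin.rev ∘ a)
  rw [← opT_revProd] at h
  have h2 := congrArg unop h
  rw [vecMul, dotProduct, Finset.unop_sum] at h2
  rw [mulVec, dotProduct, ← involutive_rev_comp.bijective.sum_comp]
  refine Eq.trans ?_ (h2.trans ?_)
  · refine Finset.sum_congr rfl fun c _ => ?_
    simp only [involutive_rev_comp c, involutive_rev_comp a, eta_op, TwistedQYangian.opT]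
    rfl
  · simp only [Pi.smul_apply, smul_eq_mul, eta_op, unop_mul, unop_op, colDet]
    rw [eta, Algebra.commutes, ← mul_assoc]
    rfl

/-- Reversing both the positions and the values preserves adjacency and the sense of each
comparison, so the left side is again alternating with value 1 at `id`. -/
theorem etaC_rev (hq : q ≠ 0) (a : Fin N → Fin N) :
    etaC q N (Fin.rev ∘ a ∘ Fin.rev) = etaC q N a := by
  have h : ∀ m m' : Fin N, m'.val = m.val + 1 →
      IsAlt q m m' fun a => etaC q N (Fin.rev ∘ a ∘ Fin.rev) := by
    intro m m' hm a
    have h1 := isAlt_etaC hq N m'.rev m.rev (by simp only [Fin.val_rev]; omega)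
      (Fin.rev ∘ a ∘ Fin.rev)
    refine ⟨fun e => h1.1 (by simp [e]), fun e => ?_⟩
    have h2 := h1.2 (by simpa using e)
    refine h2.trans (congrArg (fun c => -(q • etaC q N c)) ?_)
    funext i
    have hne : m' ≠ m := fun e => by rw [e] at hm; omega
    simp only [Function.comp_apply, Equiv.swap_apply_def]
    by_cases h3 : i = m'.rev
    · simp [h3, hne]
    · by_cases h4 : i = m.rev
      · simp [h4, hne.symm]
      · have h5 : i.rev ≠ m' := fun e => h3 (by rw [← e, Fin.rev_rev])
        have h6 : i.rev ≠ m := fun e => h4 (by rw [← e, Fin.rev_rev])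
        simp [h3, h4, h5, h6]
  have := alt_eq_smul_etaC hq h a
  rw [this]
  have h2 : (Fin.rev ∘ id ∘ Fin.rev : Fin N → Fin N) = id := by funext i; simp
  rw [h2, etaC_id, smul_eq_mul, mul_one]

theorem eta_rev (hq : q ≠ 0) (a : Fin N → Fin N) :
    eta B q N (Fin.rev ∘ a ∘ Fin.rev) = eta B q N a := by rw [eta, etaC_rev hq, eta]

theorem sandwich_eq (X : Fin N → Matrix (Fin N) (Fin N) B)
    (h : eta B q N ᵥ* Xprod X = rowDet q X • eta B q N) :
    sandwich q X = algebraMap ℂ B (∑ b, etaC q N b * etaC q N b) * rowDet q X := by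
  rw [sandwich, h, smul_dotProduct, dotProduct, smul_eq_mul, Algebra.commutes, map_sum]
  simp only [map_mul, eta]

theorem sandwich_opT (hq : q ≠ 0) (X : Fin N → Matrix (Fin N) (Fin N) B) :
    sandwich q (fun i => opT Fin.rev (X i)) = op (sandwich q (X ∘ Fin.rev)) := by
  have hinv : Involutive fun a : Fin N → Fin N => Fin.rev ∘ a ∘ Fin.rev := fun a => by
    funext i; simp
  have hX : ∀ a b : Fin N → Fin N, Xprod (fun i => opT Fin.rev (X i)) a b =
      op (Xprod (X ∘ Fin.rev) (Fin.rev ∘ b ∘ Fin.rev) (Fin.rev ∘ a ∘ Fin.rev)) := by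
    intro a b
    rw [Xprod_apply, Xprod_apply, op_list_prod, List.map_map, ← List.map_reverse,
      List.finRange_reverse, List.map_map]
    refine congrArg List.prod (List.map_congr_left fun i _ => ?_)
    simp [opT]
  rw [sandwich, sandwich, dotProduct, dotProduct, Finset.op_sum]
  simp only [vecMul, dotProduct, Finset.sum_mul, Finset.op_sum]
  rw [Finset.sum_comm]
  rw [← hinv.bijective.sum_comp (fun b => ∑ a, _)]
  refine Finset.sum_congr rfl fun a _ => ?_
  rw [← hinv.bijective.sum_comp (fun b => op _)]
  refine Finset.sum_congr rfl fun b _ => ?_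
  rw [hX, eta_rev hq, eta_rev hq, eta_op, eta_op, op_mul, op_mul, mul_assoc]
  have ha : Fin.rev ∘ (Fin.rev ∘ a ∘ Fin.rev) ∘ Fin.rev = a := hinv a
  rw [ha]

theorem apply_eq_pow_mul {x : Fin N → Z}
    (hx : ∀ m m' : Fin N, m'.val = m.val + 1 → x m = Q ^ 2 * x m') :
    ∀ (d : ℕ) (i j : Fin N), j.val = i.val + d → x i = Q ^ (2 * d) * x j := by
  intro d
  induction d with
  | zero => intro i j h; rw [Fin.ext (a := i) (b := j) (by omega)]; simp
  | succ d ih =>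
    intro i j h
    have hj := j.isLt
    rw [ih i ⟨i.val + d, by omega⟩ rfl, hx ⟨i.val + d, by omega⟩ j (by simp; omega)]
    ring

/-- As x_i = q^{2(j-i)} x_j, the difference is q⁻¹ x_j (1 - q^{2(j-i)+2}). -/
theorem lam_ne_zero (hq0 : q ≠ 0) (hq : ∀ m : ℕ, 0 < m → q ^ m ≠ 1) {x : Fin N → Z}
    (hx0 : ∀ i, x i ≠ 0) (hx : ∀ m m' : Fin N, m'.val = m.val + 1 → x m = Q ^ 2 * x m')
    (i j : Fin N) (hij : i < j) : (Q)⁻¹ * x j - Q * x i ≠ 0 := by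
  have hQ : Q ≠ 0 := algebraMap_ne_zero_of_ne_zero hq0
  rw [Fin.lt_def] at hij
  rw [apply_eq_pow_mul hx (j.val - i.val) i j (by omega)]
  intro e
  have h1 : x j * (1 - Q ^ (2 * (j.val - i.val) + 2)) = 0 := by
    have h2 : Q * ((Q)⁻¹ * x j - Q * (Q ^ (2 * (j.val - i.val)) * x j)) = 0 := by rw [e, mul_zero]
    rw [mul_sub, mul_inv_cancel_left₀ hQ] at h2
    rw [← h2]
    ring
  have h3 := (mul_eq_zero.1 h1).resolve_left (hx0 j)
  refine hq (2 * (j.val - i.val) + 2) (by omega) ((algebraMap ℂ Z).injective ?_)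
  rw [map_pow, map_one]
  exact (sub_eq_zero.1 h3).symm

/-- Each determinant is obtained from a sandwich between two copies of η by the same nonzero
constant ∑ η_b². The sandwich over the opposite algebra is the original one with the factors in
reverse order, so `sandwich_rev` identifies them. -/
theorem colDet_eq_rowDet (hq0 : q ≠ 0) (hq : ∀ m : ℕ, 0 < m → q ^ m ≠ 1) {x : Fin N → Z}
    (hx0 : ∀ i, x i ≠ 0) (hx : ∀ m m' : Fin N, m'.val = m.val + 1 → x m = Q ^ 2 * x m')
    {X : Fin N → Matrix (Fin N) (Fin N) B}
    (h : ∀ i j, i < j → RTT q (x i) (x j) (X i) (X j)) :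
    colDet q X = rowDet q X := by
  have hq4 := hq 4 (by omega)
  have h1 := sandwich_eq X (eta_vecMul_Xprod hq0 hq4 hx0 hx h)
  have h2 := sandwich_eq (fun i => opT Fin.rev (X i))
    (eta_vecMul_Xprod hq0 hq4 hx0 hx fun i j hij => (h i j hij).opT)
  rw [sandwich_opT hq0, sandwich_rev hq0 X h (lam_ne_zero hq0 hq hx0 hx), h1] at h2
  have h3 := congrArg unop h2
  rw [unop_op, unop_mul] at h3
  have h4 : algebraMap ℂ B (∑ b, etaC q N b * etaC q N b) * rowDet q X =
      algebraMap ℂ B (∑ b, etaC q N b * etaC q N b) * colDet q X := by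
    rw [h3, Algebra.commutes]
    rfl
  have h5 := congrArg (fun b => algebraMap ℂ B (∑ b, etaC q N b * etaC q N b)⁻¹ * b) h4
  simp only [← mul_assoc, ← map_mul] at h5
  rw [inv_mul_cancel₀ (sum_etaC_sq_ne_zero hq0 hq N), map_one, one_mul, one_mul] at h5
  exact h5.symm

end Opposite

end TwistedQYangian

end

noncomputable section

namespace TwistedQYangian

open Matrix Function

/-! ## Entries that commute with the determinants -/

section Central

theorem rev_prod_mul_mul_prod {M ι : Type*} [Monoid M] {R X : ι → M} {Y : M}
    (h : ∀ i, R i * (Y * X i) = X i * Y * R i) (hc : ∀ i j, i ≠ j → Commute (R i) (X j))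
    {l : List ι} (hl : l.Nodup) :
    (l.reverse.map R).prod * (Y * (l.map X).prod) =
      (l.map X).prod * Y * (l.reverse.map R).prod := by
  induction l with
  | nil => simp
  | cons i l ih =>
    obtain ⟨hi, hl⟩ := List.nodup_cons.1 hl
    have h1 : Commute (R i) (l.map X).prod := by
      refine Commute.list_prod_right _ _ fun x hx => ?_
      obtain ⟨j, hj, rfl⟩ := List.mem_map.1 hx
      exact hc i j fun e : i = j => hi (e ▸ hj)
    have h2 : Commute (l.reverse.map R).prod (X i) := by
      refine Commute.list_prod_left _ _ fun x hx => ?_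
      obtain ⟨j, hj, rfl⟩ := List.mem_map.1 hx
      exact hc j i fun e : j = i => hi (e ▸ List.mem_reverse.1 hj)
    simp only [List.reverse_cons, List.map_append, List.prod_append, List.map_cons, List.prod_cons,
      List.map_nil, List.prod_nil, mul_one]
    calc (l.reverse.map R).prod * R i * (Y * (X i * (l.map X).prod))
        = (l.reverse.map R).prod * (R i * (Y * X i)) * (l.map X).prod := by simp only [mul_assoc]
      _ = (l.reverse.map R).prod * X i * Y * (R i * (l.map X).prod) := by
          rw [h]; simp only [mul_assoc]
      _ = X i * ((l.reverse.map R).prod * (Y * (l.map X).prod)) * R i := by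
          rw [h1.eq, h2.eq]; simp only [mul_assoc]
      _ = _ := by rw [ih hl]; simp only [mul_assoc]

variable {Z : Type*} [Field Z] [Algebra ℂ Z] {B : Type*} [Ring B] [Algebra ℂ B] [Algebra Z B]
  [IsScalarTower ℂ Z B] {r N : ℕ} {q : ℂ}

/-- The scalar `q` as an element of the field `Z`. -/
local notation "Q" => algebraMap ℂ Z q

theorem cons_comp_swap (f : Fin N) (τ : Fin r → Fin N) (m m' : Fin r) :
    (Fin.cons f (τ ∘ Equiv.swap m m') : Fin (r + 1) → Fin N) =
      (Fin.cons f τ : Fin (r + 1) → Fin N) ∘ Equiv.swap m.succ m'.succ := by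
  funext i
  refine Fin.cases ?_ (fun i => ?_) i
  · rw [Function.comp_apply, Equiv.swap_apply_of_ne_of_ne (Fin.succ_ne_zero m).symm
      (Fin.succ_ne_zero m').symm, Fin.cons_zero, Fin.cons_zero]
  · rw [Function.comp_apply, (Fin.succ_injective r).swap_apply, Fin.cons_succ, Fin.cons_succ,
      Function.comp_apply]

theorem IsAlt.cons {V : Type*} [AddCommGroup V] [Module ℂ V] {φ : (Fin (r + 1) → Fin N) → V}
    {m m' : Fin r} (h : IsAlt q m.succ m'.succ φ) (f : Fin N) :
    IsAlt q m m' fun τ : Fin r → Fin N => φ (Fin.cons f τ) := by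
  intro τ
  have := h (Fin.cons f τ)
  rw [Fin.cons_succ, Fin.cons_succ, ← cons_comp_swap] at this
  exact this

theorem eq_of_alt_of_apply_eq {V : Type*} [AddCommGroup V] [Module ℂ V] (hq : q ≠ 0)
    {φ ψ : (Fin N → Fin N) → V}
    (h : ∀ m m' : Fin N, m'.val = m.val + 1 → IsAlt q m m' φ)
    (h' : ∀ m m' : Fin N, m'.val = m.val + 1 → IsAlt q m m' ψ) (σ : Equiv.Perm (Fin N))
    (e : φ σ = ψ σ) : φ = ψ := by
  have hs : ∀ m m' : Fin N, m'.val = m.val + 1 → IsAlt q m m' (φ - ψ) :=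
    fun m m' hm => (h m m' hm).sub (h' m m' hm)
  have h1 := alt_comp_perm_eq_zero hq hs σ⁻¹ σ (by rw [Pi.sub_apply, e, sub_self])
  have h2 : (σ : Fin N → Fin N) ∘ (σ⁻¹ : Equiv.Perm (Fin N)) = id := by
    funext i; simp
  rw [h2] at h1
  exact sub_eq_zero.1 (alt_eq_zero hq hs h1)

/-- The functional `e* ⊗ η` on `ℂ^N ⊗ (ℂ^N)^{⊗ N}`. -/
def etaCons (B : Type*) [Ring B] [Algebra ℂ B] (q : ℂ) (N : ℕ) (e : Fin N)
    (a : Fin (N + 1) → Fin N) : B :=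
  if a 0 = e then eta B q N (Fin.tail a) else 0

theorem isAlt_etaCons (hq : q ≠ 0) (e : Fin N) (m m' : Fin N) (hm : m'.val = m.val + 1) :
    IsAlt q m.succ m'.succ (etaCons B q N e) := by
  intro a
  have h := isAlt_eta (B := B) hq m m' hm (Fin.tail a)
  have h0 : (a ∘ Equiv.swap m.succ m'.succ) 0 = a 0 := by
    rw [Function.comp_apply, Equiv.swap_apply_of_ne_of_ne (Fin.succ_ne_zero m).symm
      (Fin.succ_ne_zero m').symm]
  have h1 : Fin.tail (a ∘ Equiv.swap m.succ m'.succ) = Fin.tail a ∘ Equiv.swap m m' := by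
    funext i
    simp only [Fin.tail, Function.comp_apply, (Fin.succ_injective N).swap_apply]
  simp only [etaCons, h0, h1]
  by_cases h2 : a 0 = e
  · simp only [if_pos h2]
    exact h
  · simp [if_neg h2]

/-- `R_0N(y, x_N) ⋯ R_0k(y, x_k)` for a list of indices `k`. -/
def auxProd (B : Type*) [Ring B] [Algebra Z B] (q : ℂ) (N : ℕ) (y : Z) (x : Fin r → Z)
    (l : List (Fin r)) : Matrix (Fin (r + 1) → Fin N) (Fin (r + 1) → Fin N) B :=
  (l.reverse.map fun i => onTwo 0 i.succ ((Rmat q N y (x i)).map (algebraMap Z B))).prod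

theorem auxProd_cons (y : Z) (x : Fin r → Z) (i : Fin r) (l : List (Fin r)) :
    auxProd B q N y x (i :: l) = auxProd B q N y x l *
      onTwo 0 i.succ ((Rmat q N y (x i)).map (algebraMap Z B)) := by
  simp [auxProd]

theorem auxProd_append (y : Z) (x : Fin r → Z) (l l' : List (Fin r)) :
    auxProd B q N y x (l ++ l') = auxProd B q N y x l' * auxProd B q N y x l := by
  simp [auxProd]

theorem auxProd_mem_altPres_of_not_mem (y : Z) (x : Fin r → Z) {l : List (Fin r)} {m m' : Fin r}
    (hm : m ∉ l) (hm' : m' ∉ l) : auxProd B q N y x l ∈ altPres B N q m.succ m'.succ := by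
  refine list_prod_mem fun X hX => ?_
  obtain ⟨i, hi, rfl⟩ := List.mem_map.1 hX
  rw [List.mem_reverse] at hi
  exact onTwo_mem_altPres q (Fin.succ_ne_zero i).symm (Fin.succ_ne_zero m).symm
    (Fin.succ_ne_zero m').symm (fun e => hm (Fin.succ_injective _ e ▸ hi))
    (fun e => hm' (Fin.succ_injective _ e ▸ hi)) _

theorem auxProd_mem_altPres (hq : q ≠ 0) (y : Z) {x : Fin r → Z}
    (hx : ∀ m m' : Fin r, m'.val = m.val + 1 → x m = Q ^ 2 * x m') {m m' : Fin r}
    (hm : m'.val = m.val + 1) :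
    auxProd B q N y x (List.finRange r) ∈ altPres B N q m.succ m'.succ := by
  have hmm' : m ≠ m' := fun e => by rw [e] at hm; omega
  rw [finRange_eq_append hm, auxProd_append, auxProd_cons, auxProd_cons, mul_assoc, mul_assoc]
  refine mul_mem (auxProd_mem_altPres_of_not_mem y x ?_ ?_) ?_
  · rw [mem_drop_finRange]; omega
  · rw [mem_drop_finRange]; omega
  · rw [← mul_assoc]
    refine mul_mem (Rmat_mul_Rmat_mem_altPres hq (Fin.succ_ne_zero m).symm
      (Fin.succ_ne_zero m').symm (fun e => hmm' (Fin.succ_injective _ e)) (hx m m' hm))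
      (auxProd_mem_altPres_of_not_mem y x ?_ ?_)
    · intro h
      have := mem_take_finRange h
      omega
    · intro h
      have := mem_take_finRange h
      omega

/-- The off-diagonal part of R_0k would move the entry of the factor 0 into the factor `k`, where it
repeats the entry of the first factor; alternation kills this term and leaves the diagonal scalar y
- x_k. -/
theorem vecMul_auxProd_apply (hq : q ≠ 0) (y : Z) (x : Fin r → Z)
    {φ : (Fin (r + 1) → Fin N) → B}
    (hφ : ∀ m m' : Fin r, m'.val = m.val + 1 → IsAlt q m.succ m'.succ φ) {i₀ : Fin r}
    (hi₀ : i₀.val = 0) {a : Fin (r + 1) → Fin N} (ha : a 0 = a i₀.succ)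
    (hinj : Injective (Fin.tail a)) :
    ∀ k ≤ r, 1 ≤ k → (φ ᵥ* auxProd B q N y x ((List.finRange r).drop k)) a =
      (((List.finRange r).drop k).map fun j => y - x j).prod • φ a := by
  intro k hk
  induction hk using Nat.decreasingInduction with
  | self =>
    intro _
    rw [List.drop_eq_nil_of_le (by simp)]
    simp [auxProd]
  | of_succ k hk ih =>
    intro hk1
    have hne : a 0 ≠ a (Fin.succ ⟨k, hk⟩) := by
      rw [ha]
      intro e
      have := congrArg Fin.val (hinj (a₁ := i₀) (a₂ := ⟨k, hk⟩) e)
      simp [hi₀] at this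
      omega
    rw [drop_finRange_eq_cons hk, auxProd_cons, ← vecMul_vecMul,
      vecMul_Rmat _ (Fin.succ_ne_zero _).symm, if_neg hne, ih (by omega), List.map_cons,
      List.prod_cons, smul_smul]
    have h0 : (φ ᵥ* auxProd B q N y x ((List.finRange r).drop (k + 1)))
        (a ∘ Equiv.swap 0 (Fin.succ ⟨k, hk⟩)) = 0 := by
      refine alt_eq_zero_of_eq hq (j := i₀.succ) (k - 1) (Fin.succ ⟨k, hk⟩) (by simp; omega) ?_ _ ?_
      · intro m m' hm hm' hmm'
        rw [Fin.le_def] at hm hm'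
        simp only [Fin.val_succ] at hm hm'
        obtain ⟨n, rfl⟩ := Fin.exists_succ_eq.2 (show m ≠ 0 from fun e => by simp [e] at hm)
        obtain ⟨n', rfl⟩ := Fin.exists_succ_eq.2 (show m' ≠ 0 from fun e => by simp [e] at hmm')
        simp only [Fin.val_succ] at hm hm' hmm'
        refine auxProd_mem_altPres_of_not_mem y x ?_ ?_ _ (hφ _ _ (by omega))
        · rw [mem_drop_finRange]; omega
        · rw [mem_drop_finRange]; omega
      · have h2 : i₀.succ ≠ Fin.succ ⟨k, hk⟩ := fun e => by
          have := congrArg Fin.val e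
          simp [hi₀] at this
          omega
        rw [Function.comp_apply, Function.comp_apply, Equiv.swap_apply_right,
          Equiv.swap_apply_of_ne_of_ne (Fin.succ_ne_zero i₀) h2, ha]
    rw [h0, smul_zero, add_zero]

/-- For each value f of the factor 0, both sides are alternating in the other factors, so one
permutation suffices for the comparison. Taking one whose first entry is f makes R_01 act on equal
entries by a scalar and puts the remaining factors in the situation of `vecMul_auxProd_apply`. -/
theorem etaCons_vecMul_auxProd (hq : q ≠ 0) (y : Z) {x : Fin N → Z}
    (hx : ∀ m m' : Fin N, m'.val = m.val + 1 → x m = Q ^ 2 * x m') (hN : 0 < N) (e : Fin N) :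
    etaCons B q N e ᵥ* auxProd B q N y x (List.finRange N) =
      (((Q)⁻¹ * y - Q * x ⟨0, hN⟩) * (((List.finRange N).drop 1).map fun j => y - x j).prod) •
        etaCons B q N e := by
  have halt := fun m m' hm => isAlt_etaCons (B := B) hq e m m' hm
  have key : ∀ f : Fin N, (fun τ : Fin N → Fin N =>
      (etaCons B q N e ᵥ* auxProd B q N y x (List.finRange N)) (Fin.cons f τ)) =
      fun τ : Fin N → Fin N =>
        ((((Q)⁻¹ * y - Q * x ⟨0, hN⟩) * (((List.finRange N).drop 1).map fun j => y - x j).prod) •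
        etaCons B q N e) (Fin.cons f τ) := by
    intro f
    refine eq_of_alt_of_apply_eq hq
      (fun m m' hm => (auxProd_mem_altPres hq y hx hm _ (halt m m' hm)).cons f)
      (fun m m' hm => ?_) (Equiv.swap ⟨0, hN⟩ f) ?_
    · refine IsAlt.cons ?_ f
      have h1 := smul_mem_altPres (Z := Z) (B := B) (N := N) (q := q)
        (((Q)⁻¹ * y - Q * x ⟨0, hN⟩) * (((List.finRange N).drop 1).map fun j => y - x j).prod)
        (one_mem (altPres B N q m.succ m'.succ)) _ (halt m m' hm)
      rwa [vecMul_smul, vecMul_one] at h1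
    · have h0 : (Fin.cons f (Equiv.swap ⟨0, hN⟩ f : Fin N → Fin N) : Fin (N + 1) → Fin N) 0 =
          (Fin.cons f (Equiv.swap ⟨0, hN⟩ f : Fin N → Fin N) : Fin (N + 1) → Fin N)
            (Fin.succ ⟨0, hN⟩) := by
        rw [Fin.cons_zero, Fin.cons_succ, Equiv.swap_apply_left]
      have hd := drop_finRange_eq_cons (r := N) hN
      rw [List.drop_zero] at hd
      conv_lhs => rw [hd]
      rw [auxProd_cons, ← vecMul_vecMul, vecMul_Rmat _ (Fin.succ_ne_zero _).symm, if_pos h0,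
        vecMul_auxProd_apply hq y x halt (i₀ := ⟨0, hN⟩) rfl h0 _ 1 hN le_rfl, smul_smul,
        Pi.smul_apply]
      rw [Fin.tail_cons]
      exact Equiv.injective _
  funext a
  have := congrFun (key (a 0)) (Fin.tail a)
  rwa [Fin.cons_self_tail] at this

theorem vecMul_prod_onOne_succ (X : Fin r → Matrix (Fin N) (Fin N) B) (l : List (Fin r))
    (φ : (Fin (r + 1) → Fin N) → B) (f : Fin N) (τ : Fin r → Fin N) :
    (φ ᵥ* (l.map fun i => onOne i.succ (X i)).prod) (Fin.cons f τ) =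
      ((fun σ : Fin r → Fin N => φ (Fin.cons f σ)) ᵥ* (l.map fun i => onOne i (X i)).prod) τ := by
  induction l generalizing φ with
  | nil => simp
  | cons i l ih =>
    rw [List.map_cons, List.prod_cons, ← vecMul_vecMul, ih, List.map_cons, List.prod_cons,
      ← vecMul_vecMul]
    congr 2
    funext σ
    rw [vecMul_onOne, vecMul_onOne]
    simp only [Fin.cons_succ, Fin.cons_update]

/-- The determinant of a family commutes with every matrix that satisfies the `RTT` relations with
all members of the family. -/
theorem commute_rowDet (hq : q ≠ 0) (hq4 : q ^ 4 ≠ 1) {x : Fin N → Z} (hx0 : ∀ i, x i ≠ 0)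
    (hx : ∀ m m' : Fin N, m'.val = m.val + 1 → x m = Q ^ 2 * x m')
    {X : Fin N → Matrix (Fin N) (Fin N) B}
    (h : ∀ i j, i < j → RTT q (x i) (x j) (X i) (X j)) {y : Z} {Y : Matrix (Fin N) (Fin N) B}
    (hY : ∀ i, RTT q y (x i) Y (X i)) (hy : ∀ i, (Q)⁻¹ * y - Q * x i ≠ 0)
    (hy' : ∀ i, y - x i ≠ 0) (e f : Fin N) : Commute (Y e f) (rowDet q X) := by
  have hN : 0 < N := e.pos
  have hcomm : auxProd B q N y x (List.finRange N) *
      (onOne 0 Y * ((List.finRange N).map fun i => onOne i.succ (X i)).prod) =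
      ((List.finRange N).map fun i => onOne i.succ (X i)).prod * onOne 0 Y *
        auxProd B q N y x (List.finRange N) :=
    rev_prod_mul_mul_prod (X := fun i : Fin N => onOne i.succ (X i))
      (R := fun i : Fin N => onTwo 0 i.succ ((Rmat q N y (x i)).map (algebraMap Z B)))
      (fun i => (hY i).sites (Fin.succ_ne_zero i).symm)
      (fun i j hij => (commute_onOne_onTwo (Fin.succ_ne_zero i).symm (Fin.succ_ne_zero j)
        (fun e => hij (Fin.succ_injective _ e).symm)
        fun a b c d => (commute_scalar _ _ _ _).symm).symm) (List.nodup_finRange N)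
  set ρ := (((Q)⁻¹ * y - Q * x ⟨0, hN⟩) *
    (((List.finRange N).drop 1).map fun j => y - x j).prod) with hρdef
  have hρ : ρ ≠ 0 := by
    refine mul_ne_zero (hy _) (List.prod_ne_zero fun h0 => ?_)
    obtain ⟨j, _, hj⟩ := List.mem_map.1 h0
    exact hy' j hj
  have hM : ∀ e, etaCons B q N e ᵥ* auxProd B q N y x (List.finRange N) =
      ρ • etaCons B q N e := etaCons_vecMul_auxProd hq y hx hN
  have hYe : etaCons B q N e ᵥ* onOne 0 Y = ∑ g, Y e g • etaCons B q N g := by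
    funext a
    rw [vecMul_onOne, Finset.sum_apply, Fintype.sum_eq_single e, Fintype.sum_eq_single (a 0)]
    · have : Fin.tail (update a 0 e) = Fin.tail a := by
        funext i; simp [Fin.tail]
      simp only [etaCons, update_self, if_true, this, Pi.smul_apply, smul_eq_mul]
      exact Algebra.commutes _ _
    · intro g hg
      simp [etaCons, hg.symm]
    · intro g hg
      simp [etaCons, hg]
  have hXe : etaCons B q N e ᵥ* ((List.finRange N).map fun i => onOne i.succ (X i)).prod =
      rowDet q X • etaCons B q N e := by
    funext a
    rw [← Fin.cons_self_tail a, vecMul_prod_onOne_succ]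
    have hx' := congrFun (eta_vecMul_Xprod hq hq4 hx0 hx h) (Fin.tail a)
    by_cases ha : a 0 = e
    · have : (fun σ : Fin N → Fin N => etaCons B q N e (Fin.cons (a 0) σ)) = eta B q N := by
        funext σ; simp [etaCons, ha]
      rw [this]
      refine hx'.trans ?_
      simp [etaCons, ha]
    · have : (fun σ : Fin N → Fin N => etaCons B q N e (Fin.cons (a 0) σ)) = 0 := by
        funext σ; simp [etaCons, ha]
      rw [this]
      simp [etaCons, ha]
  -- Both sides of R_0N ⋯ R_01 Y_0 X_1 ⋯ X_N = X_1 ⋯ X_N Y_0 R_0N ⋯ R_01 are applied to e* ⊗ η and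
  -- evaluated at (f, 1, …, N). They give ρ Y_ef det X and det X ρ Y_ef.
  have h1 := congrArg (fun M => (etaCons B q N e ᵥ* M) (Fin.cons f id)) hcomm
  simp only [← vecMul_vecMul] at h1
  rw [hM, hXe, smul_vecMul, smul_vecMul, smul_vecMul, hYe, smul_vecMul] at h1
  have hL : ((∑ g, Y e g • etaCons B q N g) ᵥ* ((List.finRange N).map fun i =>
      onOne i.succ (X i)).prod) (Fin.cons f id) = Y e f * rowDet q X := by
    rw [vecMul_prod_onOne_succ, rowDet, Xprod]
    have : (fun σ : Fin N → Fin N => (∑ g, Y e g • etaCons B q N g) (Fin.cons f σ)) =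
        Y e f • eta B q N := by
      funext σ
      rw [Finset.sum_apply, Fintype.sum_eq_single f]
      · simp [etaCons]
      · intro g hg
        simp [etaCons, hg.symm]
    rw [this, smul_vecMul, Pi.smul_apply, smul_eq_mul]
  have hR : ((∑ g, Y e g • etaCons B q N g) ᵥ* auxProd B q N y x (List.finRange N))
      (Fin.cons f id) = ρ • Y e f := by
    rw [sum_vecMul]
    simp only [smul_vecMul, hM]
    rw [Finset.sum_apply, Fintype.sum_eq_single f]
    · simp [etaCons, eta_id]
    · intro g hg
      simp [etaCons, hg.symm]
  rw [Pi.smul_apply, Pi.smul_apply, hL, hR, smul_eq_mul, mul_smul_comm] at h1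
  exact smul_right_injective B hρ h1

end Central

end TwistedQYangian

end

noncomputable section

namespace TwistedQYangian

open Matrix Function

/-! ## Laurent series over the quantum affine algebra -/

section Series

variable {A : Type*} [Ring A]

/-- Any finite window containing [0, k] may be used, so that coefficients of neighbouring degrees
can be written as sums over a common index set. -/
theorem coeff_mul_eq_sum_of_nonneg {P P' : LaurentSeries A} (h : ∀ k < 0, P.coeff k = 0)
    (h' : ∀ k < 0, P'.coeff k = 0) (k : ℤ) {S : Finset ℤ} (hS : Finset.Icc 0 k ⊆ S) :
    (P * P').coeff k = ∑ i ∈ S, P.coeff i * P'.coeff (k - i) := by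
  rw [HahnSeries.coeff_mul]
  refine Finset.sum_of_injOn Prod.fst ?_ ?_ ?_ ?_
  · rintro ⟨a, b⟩ hab ⟨c, d⟩ hcd e
    simp only [Finset.mem_coe, Finset.mem_addAntidiagonal] at hab hcd e
    ext <;> simp <;> omega
  · rintro ⟨a, b⟩ hab
    simp only [Finset.mem_coe, Finset.mem_addAntidiagonal, HahnSeries.mem_support] at hab
    apply hS
    rw [Finset.mem_Icc]
    refine ⟨not_lt.1 fun h0 => hab.1 (h a h0), ?_⟩
    have : 0 ≤ b := not_lt.1 fun h0 => hab.2.1 (h' b h0)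
    simp
    omega
  · intro i _ hi
    by_contra hne
    apply hi
    refine ⟨(i, k - i), ?_, rfl⟩
    simp only [Finset.mem_coe, Finset.mem_addAntidiagonal, HahnSeries.mem_support]
    exact ⟨left_ne_zero_of_mul hne, right_ne_zero_of_mul hne, by omega⟩
  · rintro ⟨a, b⟩ hab
    simp only [Finset.mem_addAntidiagonal] at hab
    rw [← hab.2.2]
    simp

theorem coeff_mul_eq_sum_of_nonneg' {P P' : LaurentSeries A} (h : ∀ k < 0, P.coeff k = 0)
    (h' : ∀ k < 0, P'.coeff k = 0) (k : ℤ) {S : Finset ℤ} (hS : Finset.Icc 0 k ⊆ S) :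
    (P' * P).coeff k = ∑ i ∈ S, P'.coeff (k - i) * P.coeff i := by
  rw [coeff_mul_eq_sum_of_nonneg h' h k (S := S.image fun i => k - i)]
  · rw [Finset.sum_image fun i _ j _ e => by simpa using e]
    simp
  · intro i hi
    rw [Finset.mem_image]
    refine ⟨k - i, hS ?_, by omega⟩
    rw [Finset.mem_Icc] at hi ⊢
    omega

variable [Algebra ℂ A]

/-- Laurent series with complex coefficients inside Laurent series over a `ℂ`-algebra. -/
def seriesMap (A : Type*) [Ring A] [Algebra ℂ A] : LaurentSeries ℂ →+* LaurentSeries A where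
  toFun z := z.map (algebraMap ℂ A)
  map_zero' := by ext; simp
  map_one' := HahnSeries.map_one (algebraMap ℂ A).toMonoidWithZeroHom
  map_add' z w := by ext; simp
  map_mul' z w := HahnSeries.map_mul (algebraMap ℂ A).toNonUnitalRingHom

theorem seriesMap_single (k : ℤ) (c : ℂ) :
    seriesMap A (HahnSeries.single k c) = HahnSeries.single k (algebraMap ℂ A c) :=
  HahnSeries.map_single (algebraMap ℂ A : ZeroHom ℂ A)

theorem seriesMap_commutes (z : LaurentSeries ℂ) (b : LaurentSeries A) :
    seriesMap A z * b = b * seriesMap A z := by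
  ext k
  rw [HahnSeries.coeff_mul, HahnSeries.coeff_mul]
  refine Finset.sum_equiv (Equiv.prodComm _ _) ?_ ?_
  · rintro ⟨i, j⟩
    simp only [Finset.mem_addAntidiagonal, Equiv.prodComm_apply, Prod.swap_prod_mk, add_comm]
    tauto
  · rintro ⟨i, j⟩ _
    exact Algebra.commutes _ _

end Series

/-- The field of Laurent series in `z = u⁻¹` with complex coefficients. -/
def ZSer : Type := LaurentSeries ℂ

instance instFieldZSer : Field ZSer := inferInstanceAs (Field (LaurentSeries ℂ))

instance instAlgebraZSer : Algebra ℂ ZSer :=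
  (HahnSeries.instAlgebra : Algebra ℂ (HahnSeries ℤ ℂ))

/-- The series `c z^k`. -/
def zMon (k : ℤ) (c : ℂ) : ZSer := (HahnSeries.single k c : LaurentSeries ℂ)

/-- A complex Laurent series as a series over the quantum affine algebra. -/
def zSerMap (q : ℂ) (N : ℕ) : ZSer →+* LaurentSeries (QAffine q N) := seriesMap (QAffine q N)

instance instAlgebraSeries (q : ℂ) (N : ℕ) : Algebra ZSer (LaurentSeries (QAffine q N)) :=
  RingHom.toAlgebra' (zSerMap q N) fun z b => seriesMap_commutes (A := QAffine q N) z b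

theorem algebraMap_zMon (q : ℂ) (N : ℕ) (k : ℤ) (c : ℂ) :
    algebraMap ZSer (LaurentSeries (QAffine q N)) (zMon k c) =
      HahnSeries.single k (algebraMap ℂ (QAffine q N) c) :=
  seriesMap_single (A := QAffine q N) k c

theorem algebraMap_ZSer (c : ℂ) : algebraMap ℂ ZSer c = zMon 0 c := rfl

instance instIsScalarTowerSeries (q : ℂ) (N : ℕ) :
    IsScalarTower ℂ ZSer (LaurentSeries (QAffine q N)) :=
  IsScalarTower.of_algebraMap_eq fun c => (seriesMap_single (A := QAffine q N) 0 c).symm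

section Specialization

variable {A : Type*} [Ring A] [Algebra ℂ A] {ε δ : ℤ} {α β : ℂ}

/-- Comparison of the coefficients of `u F(u) G(v)` at `u = α z^ε`, `v = β z^δ`, where `F` and `G`
are power series in `z`. -/
theorem smul_coeff_sub_left (hε : ε = 1 ∨ ε = -1) (hα : α ≠ 0) (μ : A →ₗ[ℂ] A →ₗ[ℂ] A)
    {f g : ℤ → A} {F G H : LaurentSeries A} (hF : ∀ k, F.coeff k = α ^ (ε * k) • f (ε * k))
    (hG : ∀ k, G.coeff k = β ^ (δ * k) • g (δ * k))
    (hH : ∀ (k : ℤ) (S : Finset ℤ), Finset.Icc 0 k ⊆ S →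
      H.coeff k = ∑ i ∈ S, μ (F.coeff i) (G.coeff (k - i)))
    (k : ℤ) :
    α • H.coeff (k - ε) = ∑ i ∈ Finset.Icc (-(|k| + 2)) (|k| + 2),
      (α ^ (ε * i) * β ^ (δ * (k - i))) • μ (f (ε * i - 1)) (g (δ * (k - i))) := by
  have hε2 : ε * ε = 1 := by rcases hε with rfl | rfl <;> rfl
  rw [hH (k - ε) ((Finset.Icc (-(|k| + 2)) (|k| + 2)).image fun i => i - ε)]
  · rw [Finset.sum_image fun i _ j _ e => by simpa using e, Finset.smul_sum]
    refine Finset.sum_congr rfl fun i _ => ?_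
    have e1 : k - ε - (i - ε) = k - i := by ring
    have e2 : ε * (i - ε) = ε * i - 1 := by rw [mul_sub, hε2]
    rw [hF, hG, e1, e2, map_smul, map_smul, LinearMap.smul_apply, smul_smul, smul_smul,
      zpow_sub_one₀ hα]
    congr 1
    field_simp
  · intro i hi
    rw [Finset.mem_Icc] at hi
    rw [Finset.mem_image]
    refine ⟨i + ε, ?_, by ring⟩
    rw [Finset.mem_Icc]
    have := le_abs_self k
    have := abs_nonneg k
    rcases hε with rfl | rfl <;> omega

/-- Comparison of the coefficients of `v F(u) G(v)` at `u = α z^ε`, `v = β z^δ`, where `F` and `G`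
are power series in `z`. -/
theorem smul_coeff_sub_right (hδ : δ = 1 ∨ δ = -1) (hβ : β ≠ 0) (μ : A →ₗ[ℂ] A →ₗ[ℂ] A)
    {f g : ℤ → A} {F G H : LaurentSeries A} (hF : ∀ k, F.coeff k = α ^ (ε * k) • f (ε * k))
    (hG : ∀ k, G.coeff k = β ^ (δ * k) • g (δ * k))
    (hH : ∀ (k : ℤ) (S : Finset ℤ), Finset.Icc 0 k ⊆ S →
      H.coeff k = ∑ i ∈ S, μ (F.coeff i) (G.coeff (k - i)))
    (k : ℤ) :
    β • H.coeff (k - δ) = ∑ i ∈ Finset.Icc (-(|k| + 2)) (|k| + 2),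
      (α ^ (ε * i) * β ^ (δ * (k - i))) • μ (f (ε * i)) (g (δ * (k - i) - 1)) := by
  have hδ2 : δ * δ = 1 := by rcases hδ with rfl | rfl <;> rfl
  rw [hH (k - δ) (Finset.Icc (-(|k| + 2)) (|k| + 2))]
  · rw [Finset.smul_sum]
    refine Finset.sum_congr rfl fun i _ => ?_
    have e2 : δ * (k - δ - i) = δ * (k - i) - 1 := by linear_combination -hδ2
    rw [hF, hG, e2, map_smul, map_smul, LinearMap.smul_apply, smul_smul, smul_smul,
      zpow_sub_one₀ hβ]
    congr 1
    field_simp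
  · intro i hi
    rw [Finset.mem_Icc] at hi ⊢
    have := le_abs_self k
    have := abs_nonneg k
    rcases hδ with rfl | rfl <;> omega

theorem Rmat_eq_smul_add_smul {Z : Type*} [Ring Z] [Algebra ℂ Z] (q : ℂ) (N : ℕ) (x y : Z)
    (a b : Fin N × Fin N) :
    Rmat q N x y a b = Rmat q N (1 : ℂ) 0 a b • x + Rmat q N (0 : ℂ) 1 a b • y := by
  simp only [Rmat]
  split_ifs <;> simp [sub_eq_add_neg]

theorem rttLeft_apply (q : ℂ) {N : ℕ} (X Y : ℤ → Matrix (Fin N) (Fin N) A) (m n : ℤ)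
    (a b : Fin N × Fin N) : rttLeft q X Y m n a b =
      ∑ c : Fin N × Fin N, (Rmat q N (1 : ℂ) 0 a c • (X (m - 1) c.1 b.1 * Y n c.2 b.2) +
        Rmat q N (0 : ℂ) 1 a c • (X m c.1 b.1 * Y (n - 1) c.2 b.2)) := by
  rw [rttLeft, Matrix.add_apply, Matrix.mul_assoc, Matrix.mul_assoc, Matrix.mul_apply,
    Matrix.mul_apply, ← Finset.sum_add_distrib]
  refine Finset.sum_congr rfl fun c _ => ?_
  rw [kronecker_one_mul_one_kronecker, kronecker_one_mul_one_kronecker,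
    Rmat_eq_smul_add_smul q N (1 : A) 0, Rmat_eq_smul_add_smul q N (0 : A) 1]
  simp

theorem rttRight_apply (q : ℂ) {N : ℕ} (X Y : ℤ → Matrix (Fin N) (Fin N) A) (m n : ℤ)
    (a b : Fin N × Fin N) : rttRight q X Y m n a b =
      ∑ c : Fin N × Fin N, (Rmat q N (1 : ℂ) 0 c b • (Y n a.2 c.2 * X (m - 1) a.1 c.1) +
        Rmat q N (0 : ℂ) 1 c b • (Y (n - 1) a.2 c.2 * X m a.1 c.1)) := by
  rw [rttRight, Matrix.add_apply, Matrix.mul_apply, Matrix.mul_apply, ← Finset.sum_add_distrib]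
  refine Finset.sum_congr rfl fun c _ => ?_
  rw [one_kronecker_mul_kronecker_one, one_kronecker_mul_kronecker_one,
    Rmat_eq_smul_add_smul q N (1 : A) 0, Rmat_eq_smul_add_smul q N (0 : A) 1]
  simp

theorem coeff_smul_series {q : ℂ} {N : ℕ} (c c' : ℂ) (ε δ : ℤ) (b : LaurentSeries (QAffine q N))
    (α β : ℂ) (k : ℤ) :
    ((c • zMon ε α + c' • zMon δ β) • b).coeff k =
        c • α • b.coeff (k - ε) + c' • β • b.coeff (k - δ) := by
  have h : ∀ (c α : ℂ) (ε : ℤ), ((c • zMon ε α) • b).coeff k =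
      c • α • b.coeff (k - ε) := by
    intro c α ε
    rw [smul_assoc, HahnSeries.coeff_smul, Algebra.smul_def (zMon ε α), algebraMap_zMon]
    have := HahnSeries.coeff_single_mul_add (r := algebraMap ℂ (QAffine q N) α) (x := b)
      (a := k - ε) (b := ε)
    rw [sub_add_cancel] at this
    rw [this, Algebra.smul_def α]
  rw [add_smul, HahnSeries.coeff_add, h, h]

/-- The defining relations of `U_q(ĝl_N)`, specialized at `u = α z^ε`, `v = β z^δ`. -/
theorem RTT_of_forall_coeff {q : ℂ} {N : ℕ} (hε : ε = 1 ∨ ε = -1) (hδ : δ = 1 ∨ δ = -1)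
    (hα : α ≠ 0) (hβ : β ≠ 0) {X Y : ℤ → Matrix (Fin N) (Fin N) (QAffine q N)}
    {X' Y' : Matrix (Fin N) (Fin N) (LaurentSeries (QAffine q N))}
    (hX : ∀ i j k, (X' i j).coeff k = α ^ (ε * k) • X (ε * k) i j)
    (hY : ∀ i j k, (Y' i j).coeff k = β ^ (δ * k) • Y (δ * k) i j)
    (hX0 : ∀ i j, ∀ k < 0, (X' i j).coeff k = 0) (hY0 : ∀ i j, ∀ k < 0, (Y' i j).coeff k = 0)
    (h : ∀ m n a b, rttLeft q X Y m n a b = rttRight q X Y m n a b) :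
    RTT q (zMon ε α) (zMon δ β) X' Y' := by
  rw [rtt_iff]
  intro a b
  ext k
  have hc : ∀ {ι : Type} (s : Finset ι) (φ : ι → LaurentSeries (QAffine q N)),
      (∑ i ∈ s, φ i).coeff k = ∑ i ∈ s, (φ i).coeff k := fun s φ =>
    map_sum (HahnSeries.coeff.addMonoidHom k : LaurentSeries (QAffine q N) →+ QAffine q N) φ s
  -- The coefficient of z^k in the specialized relation is the sum of the relations for u^{εi}
  -- v^{δ(k-i)} with weights α^{εi} β^{δ(k-i)}. The window |k| + 2 leaves room for the shifts by one
  -- caused by the factors u and v of R.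
  have h1 := Finset.sum_congr rfl fun i (_ : i ∈ Finset.Icc (-(|k| + 2)) (|k| + 2)) =>
    congrArg (fun t => (α ^ (ε * i) * β ^ (δ * (k - i))) • t) (h (ε * i) (δ * (k - i)) a b)
  simp only [rttLeft_apply, rttRight_apply, Finset.smul_sum] at h1
  rw [Finset.sum_comm, Finset.sum_comm (s := Finset.Icc _ _)] at h1
  rw [hc, hc]
  refine Eq.trans ?_ (h1.trans ?_)
  · refine Finset.sum_congr rfl fun c _ => ?_
    have hH := fun k S hS => coeff_mul_eq_sum_of_nonneg (hX0 c.1 b.1) (hY0 c.2 b.2) k (S := S) hS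
    rw [Rmat_eq_smul_add_smul q N (zMon ε α), coeff_smul_series,
      smul_coeff_sub_left hε hα (LinearMap.mul ℂ (QAffine q N)) (f := fun m => X m c.1 b.1)
        (g := fun m => Y m c.2 b.2) (hX c.1 b.1) (hY c.2 b.2) hH,
      smul_coeff_sub_right hδ hβ (LinearMap.mul ℂ (QAffine q N)) (f := fun m => X m c.1 b.1)
        (g := fun m => Y m c.2 b.2) (hX c.1 b.1) (hY c.2 b.2) hH,
      Finset.smul_sum, Finset.smul_sum, ← Finset.sum_add_distrib]
    refine Finset.sum_congr rfl fun i _ => ?_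
    rw [smul_add, smul_comm, smul_comm (Rmat q N (0 : ℂ) 1 a c)]
    rfl
  · refine Finset.sum_congr rfl fun c _ => ?_
    have hH := fun k S hS => coeff_mul_eq_sum_of_nonneg' (hX0 a.1 c.1) (hY0 a.2 c.2) k (S := S) hS
    rw [Rmat_eq_smul_add_smul q N (zMon ε α), coeff_smul_series,
      smul_coeff_sub_left hε hα (LinearMap.mul ℂ (QAffine q N)).flip (f := fun m => X m a.1 c.1)
        (g := fun m => Y m a.2 c.2) (hX a.1 c.1) (hY a.2 c.2) hH,
      smul_coeff_sub_right hδ hβ (LinearMap.mul ℂ (QAffine q N)).flip (f := fun m => X m a.1 c.1)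
        (g := fun m => Y m a.2 c.2) (hX a.1 c.1) (hY a.2 c.2) hH,
      Finset.smul_sum, Finset.smul_sum, ← Finset.sum_add_distrib]
    refine Finset.sum_congr rfl fun i _ => ?_
    rw [smul_add, smul_comm, smul_comm (Rmat q N (0 : ℂ) 1 c b)]
    rfl

end Specialization

end TwistedQYangian

end

noncomputable section

namespace TwistedQYangian

open Matrix Function

/-! ## The generating matrices of the quantum affine algebra -/

section Scale

variable {A : Type*} [Ring A] [Algebra ℂ A]

/-- The substitution `z ↦ c⁻¹ z`, from power series to Laurent series in `z`. -/
def scaleHom (A : Type*) [Ring A] [Algebra ℂ A] (c : ℂ) : PowerSeries A →+* LaurentSeries A where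
  toFun p := HahnSeries.ofPowerSeries ℤ A (PowerSeries.mk fun r => c⁻¹ ^ r • PowerSeries.coeff r p)
  map_zero' := by
    rw [← map_zero (HahnSeries.ofPowerSeries ℤ A)]
    congr 1
    ext r
    simp
  map_one' := by
    rw [← map_one (HahnSeries.ofPowerSeries ℤ A)]
    congr 1
    ext r
    rw [PowerSeries.coeff_mk, PowerSeries.coeff_one]
    split_ifs with h
    · simp [h]
    · simp
  map_add' p p' := by
    rw [← map_add (HahnSeries.ofPowerSeries ℤ A)]
    congr 1
    ext r
    simp
  map_mul' p p' := by
    rw [← map_mul (HahnSeries.ofPowerSeries ℤ A)]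
    congr 1
    ext r
    rw [PowerSeries.coeff_mk, PowerSeries.coeff_mul, PowerSeries.coeff_mul, Finset.smul_sum]
    refine Finset.sum_congr rfl fun ij hij => ?_
    rw [PowerSeries.coeff_mk, PowerSeries.coeff_mk, smul_mul_smul_comm, ← pow_add,
      Finset.HasAntidiagonal.mem_antidiagonal.1 hij]

theorem coeff_scaleHom (c : ℂ) (p : PowerSeries A) (k : ℤ) :
    (scaleHom A c p).coeff k =
      if 0 ≤ k then c⁻¹ ^ k.toNat • PowerSeries.coeff k.toNat p else 0 := by
  split_ifs with h
  · obtain ⟨n, rfl⟩ := Int.eq_ofNat_of_zero_le h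
    rw [Int.toNat_natCast]
    exact (HahnSeries.ofPowerSeries_apply_coeff _ n).trans (PowerSeries.coeff_mk _ _)
  · exact (PowerSeries.coeff_coe _ _).trans (if_pos (not_le.1 h))

theorem scaleHom_algebraMap (c g : ℂ) :
    scaleHom A c (algebraMap ℂ (PowerSeries A) g) = algebraMap ℂ (LaurentSeries A) g := by
  ext k
  rw [coeff_scaleHom, HahnSeries.algebraMap_apply, HahnSeries.C_apply, HahnSeries.coeff_single,
    PowerSeries.algebraMap_apply, PowerSeries.coeff_C]
  by_cases hk : k = 0
  · simp [hk]
  · rw [if_neg hk]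
    split_ifs with h1 h2
    · exact absurd (by omega) hk
    · simp
    · rfl

end Scale

section Concrete

variable (q : ℂ) {N : ℕ}

/-- The matrix `T(cu)`. -/
def tMat (c : ℂ) : Matrix (Fin N) (Fin N) (LaurentSeries (QAffine q N)) :=
  fun i j => scaleHom (QAffine q N) c (Tser q N i j)

/-- The matrix `T̄(c⁻¹u⁻¹)`. -/
def tbarMat (c : ℂ) : Matrix (Fin N) (Fin N) (LaurentSeries (QAffine q N)) :=
  fun i j => scaleHom (QAffine q N) c (TbarInvSer q N i j)

theorem Sat_eq (κ : TwistType N) (c : ℂ) :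
    Sat q κ c = tMat q c * (Gmat q κ).map (algebraMap ℂ (LaurentSeries (QAffine q N))) *
      (tbarMat q c)ᵀ := by
  ext1 i j
  change scaleHom (QAffine q N) c (Sser q κ i j) = _
  simp only [Sser, Matrix.mul_apply, map_sum, map_mul, Matrix.map_apply, scaleHom_algebraMap,
    Matrix.transpose_apply]
  rfl

theorem map_rttLeft {A A' : Type*} [Ring A] [Algebra ℂ A] [Ring A'] [Algebra ℂ A'] (f : A →ₐ[ℂ] A')
    (X Y : ℤ → Matrix (Fin N) (Fin N) A) (m n : ℤ) (a b : Fin N × Fin N) :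
    f (rttLeft q X Y m n a b) =
      rttLeft q (fun m => (X m).map f) (fun m => (Y m).map f) m n a b := by
  rw [rttLeft_apply, rttLeft_apply]
  simp

theorem map_rttRight {A A' : Type*} [Ring A] [Algebra ℂ A] [Ring A'] [Algebra ℂ A']
    (f : A →ₐ[ℂ] A') (X Y : ℤ → Matrix (Fin N) (Fin N) A) (m n : ℤ) (a b : Fin N × Fin N) :
    f (rttRight q X Y m n a b) =
      rttRight q (fun m => (X m).map f) (fun m => (Y m).map f) m n a b := by
  rw [rttRight_apply, rttRight_apply]
  simp

theorem toQAffine_eq {x y : FreeAlgebra ℂ (Gen N)} (h : Rel q N x y) :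
    toQAffine q N x = toQAffine q N y := RingQuot.mkAlgHom_rel ℂ h

theorem coeff_tMat (c : ℂ) (i j : Fin N) (k : ℤ) : (tMat q c i j).coeff k =
    c ^ (-1 * k) • ((freeT N (-1 * k)).map (toQAffine q N)) i j := by
  rw [tMat, coeff_scaleHom, Matrix.map_apply, freeT]
  by_cases h : 0 ≤ k
  · obtain ⟨n, rfl⟩ := Int.eq_ofNat_of_zero_le h
    rw [if_pos h, if_pos (by omega)]
    simp [Tser, tGen, _root_.zpow_neg]
  · rw [if_neg h, if_neg (by omega), map_zero, smul_zero]

theorem coeff_tbarMat (c : ℂ) (i j : Fin N) (k : ℤ) : (tbarMat q c i j).coeff k =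
    c⁻¹ ^ (1 * k) • ((freeTbar N (1 * k)).map (toQAffine q N)) i j := by
  rw [tbarMat, coeff_scaleHom, Matrix.map_apply, freeTbar, one_mul]
  by_cases h : 0 ≤ k
  · obtain ⟨n, rfl⟩ := Int.eq_ofNat_of_zero_le h
    rw [if_pos h, if_pos h]
    simp [TbarInvSer, tbarGen]
  · rw [if_neg h, if_neg h, map_zero, smul_zero]

theorem coeff_tMat_of_neg (c : ℂ) (i j : Fin N) : ∀ k < 0, (tMat q c i j).coeff k = 0 :=
  fun k hk => by rw [tMat, coeff_scaleHom, if_neg (not_le.2 hk)]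

theorem coeff_tbarMat_of_neg (c : ℂ) (i j : Fin N) : ∀ k < 0, (tbarMat q c i j).coeff k = 0 :=
  fun k hk => by rw [tbarMat, coeff_scaleHom, if_neg (not_le.2 hk)]

variable {q} {c d : ℂ}

theorem rtt_t_t (hc : c ≠ 0) (hd : d ≠ 0) :
    RTT q (zMon (-1) c) (zMon (-1) d) (tMat (N := N) q c) (tMat q d) :=
  RTT_of_forall_coeff (Or.inr rfl) (Or.inr rfl) hc hd (coeff_tMat q c) (coeff_tMat q d)
    (coeff_tMat_of_neg q c) (coeff_tMat_of_neg q d) fun m n a b => by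
      rw [← map_rttLeft, ← map_rttRight]
      exact toQAffine_eq q (Rel.rtt m n a b)

theorem rtt_tbar_tbar (hc : c ≠ 0) (hd : d ≠ 0) :
    RTT q (zMon 1 c⁻¹) (zMon 1 d⁻¹) (tbarMat (N := N) q c) (tbarMat q d) :=
  RTT_of_forall_coeff (Or.inl rfl) (Or.inl rfl) (inv_ne_zero hc) (inv_ne_zero hd)
    (coeff_tbarMat q c) (coeff_tbarMat q d)
    (coeff_tbarMat_of_neg q c) (coeff_tbarMat_of_neg q d) fun m n a b => by
      rw [← map_rttLeft, ← map_rttRight]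
      exact toQAffine_eq q (Rel.rtbtb m n a b)

theorem rtt_tbar_t (hc : c ≠ 0) (hd : d ≠ 0) :
    RTT q (zMon 1 c⁻¹) (zMon (-1) d) (tbarMat (N := N) q c) (tMat q d) :=
  RTT_of_forall_coeff (Or.inl rfl) (Or.inr rfl) (inv_ne_zero hc) hd
    (coeff_tbarMat q c) (coeff_tMat q d)
    (coeff_tbarMat_of_neg q c) (coeff_tMat_of_neg q d) fun m n a b => by
      rw [← map_rttLeft, ← map_rttRight]
      exact toQAffine_eq q (Rel.rtbt m n a b)

theorem zMon_mul_zMon (k l : ℤ) (c d : ℂ) : zMon k c * zMon l d = zMon (k + l) (c * d) :=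
  HahnSeries.single_mul_single

theorem zMon_zero_one : zMon 0 1 = 1 := rfl

theorem zMon_ne_zero (k : ℤ) (hc : c ≠ 0) : zMon k c ≠ 0 := HahnSeries.single_ne_zero hc

theorem inv_zMon (k : ℤ) (hc : c ≠ 0) : (zMon k c)⁻¹ = zMon (-k) c⁻¹ := by
  refine inv_eq_of_mul_eq_one_right ?_
  rw [zMon_mul_zMon, add_neg_cancel, mul_inv_cancel₀ hc, zMon_zero_one]

end Concrete

/-! ### Symmetries of the RTT relation, needed for the transposed matrices. -/

section Transpose

variable {Z : Type*} [Field Z] [Algebra ℂ Z] {B : Type*} [Ring B] [Algebra ℂ B] [Algebra Z B]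
  [IsScalarTower ℂ Z B] {N : ℕ} {q : ℂ}

theorem Rmat_transpose_swap (x y : Z) (a b : Fin N × Fin N) :
    Rmat q N x y b.swap a.swap = Rmat q N x y a b := by
  obtain ⟨a1, a2⟩ := a
  obtain ⟨b1, b2⟩ := b
  simp only [Rmat, Prod.swap_prod_mk, Prod.mk.injEq]
  by_cases h : a1 = b1 ∧ a2 = b2
  · obtain ⟨rfl, rfl⟩ := h
    simp [eq_comm]
  · have h' : ¬ (b2 = a2 ∧ b1 = a1) := fun e => h ⟨e.2.symm, e.1.symm⟩
    rw [if_neg h, if_neg h']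
    by_cases h2 : a1 = b2 ∧ a2 = b1
    · obtain ⟨rfl, rfl⟩ := h2
      simp
    · have h2' : ¬ (b2 = a1 ∧ b1 = a2) := fun e => h2 ⟨e.1.symm, e.2.symm⟩
      rw [if_neg h2, if_neg h2']

/-- Transposition in both tensor factors combined with their exchange fixes R, so transposing the
matrices interchanges them. -/
theorem RTT.transpose {x y : Z} {X Y : Matrix (Fin N) (Fin N) B} (h : RTT q x y X Y) :
    RTT q x y Yᵀ Xᵀ := by
  rw [rtt_iff] at h ⊢
  intro a b
  have := h b.swap a.swap
  rw [← (Equiv.prodComm (Fin N) (Fin N)).sum_comp,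
    ← (Equiv.prodComm (Fin N) (Fin N)).sum_comp (fun c => Rmat q N x y c a.swap • _)] at this
  simp only [Equiv.prodComm_apply, Rmat_transpose_swap] at this
  exact this.symm

theorem RTT.inv {x y : Z} (hx : x ≠ 0) (hy : y ≠ 0) {X Y : Matrix (Fin N) (Fin N) B}
    (h : RTT q y⁻¹ x⁻¹ X Y) : RTT q x y X Y := by
  have hR : ∀ a b, Rmat q N x y a b = (x * y) * Rmat q N y⁻¹ x⁻¹ a b := by
    intro a b
    simp only [Rmat]
    split_ifs <;> (try simp only [Algebra.smul_def]) <;> (try rw [mul_zero]) <;> (try field_simp)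
  rw [rtt_iff] at h ⊢
  intro a b
  simp only [hR, mul_smul (x * y), ← Finset.smul_sum, h a b]

end Transpose

section Data

variable {q : ℂ} {N : ℕ} {c d : ℂ}

/-- Transposition exchanges the two matrices and inversion exchanges the two parameters, so
T̄(u⁻¹)^t satisfies the same relation in u as T(u). -/
theorem rtt_tbarT_tbarT (hc : c ≠ 0) (hd : d ≠ 0) :
    RTT q (zMon (-1) c) (zMon (-1) d) (tbarMat (N := N) q c)ᵀ (tbarMat q d)ᵀ := by
  refine RTT.inv (zMon_ne_zero _ hc) (zMon_ne_zero _ hd) ?_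
  rw [inv_zMon _ hc, inv_zMon _ hd]
  exact (rtt_tbar_tbar hd hc).transpose

theorem rtt_tT_tbarT (hc : c ≠ 0) (hd : d ≠ 0) :
    RTT q (zMon 1 c⁻¹) (zMon (-1) d) (tMat (N := N) q c)ᵀ (tbarMat q d)ᵀ := by
  refine RTT.inv (zMon_ne_zero _ (inv_ne_zero hc)) (zMon_ne_zero _ hd) ?_
  rw [inv_zMon _ (inv_ne_zero hc), inv_zMon _ hd, _root_.inv_inv]
  exact (rtt_tbar_t hd hc).transpose

theorem shift_ne_zero (hq : q ≠ 0) (i : Fin N) : shift q i ≠ 0 := zpow_ne_zero _ hq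

theorem zMon_shift_step (hq : q ≠ 0) (m m' : Fin N) (hm : m'.val = m.val + 1) :
    zMon (-1) (shift q m) = algebraMap ℂ ZSer q ^ 2 * zMon (-1) (shift q m') := by
  rw [← map_pow, algebraMap_ZSer, zMon_mul_zMon, zero_add, shift, shift, hm, ← zpow_natCast,
    ← zpow_add₀ hq]
  congr 2
  push_cast
  ring

theorem sklyaninData (hq : q ≠ 0) : SklyaninData q (fun i : Fin N => zMon (-1) (shift q i))
    (fun i => tMat q (shift q i)) (fun i => (tbarMat q (shift q i))ᵀ) where
  ne_zero i := zMon_ne_zero _ (shift_ne_zero hq i)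
  step := zMon_shift_step hq
  rtt i j _ := rtt_t_t (shift_ne_zero hq i) (shift_ne_zero hq j)
  rtt' i j _ := rtt_tbarT_tbarT (shift_ne_zero hq i) (shift_ne_zero hq j)
  exch i j _ := by
    rw [inv_zMon _ (shift_ne_zero hq i)]
    exact (rtt_tbar_t (shift_ne_zero hq i) (shift_ne_zero hq j)).exch

end Data

end TwistedQYangian

end

noncomputable section

namespace TwistedQYangian

open Matrix Function

/-! ## Existence of the Sklyanin determinant -/

section Exists

variable {q : ℂ} {N : ℕ}

theorem algebraMap_Aq (hq : q ≠ 0) (a c : Fin N → Fin N) :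
    AqSer q N a c = algebraMap ℂ (LaurentSeries (QAffine q N)) (Aq q N N a id) *
      eta (LaurentSeries (QAffine q N)) q N c := by
  rw [AqSer, Matrix.map_apply, Aq_apply hq, map_mul, eta]

theorem Aq_apply_id (hq : q ≠ 0) (a : Fin N → Fin N) :
    Aq q N N a id = etaC q N (Fin.rev ∘ a) * Aq q N N Fin.rev id := by
  have h1 := Aq_rev_apply hq N (a ∘ Fin.rev)
  have h2 : (a ∘ Fin.rev) ∘ Fin.rev = a := by funext i; simp
  rw [h2] at h1
  rw [h1, ← etaC_rev hq (a ∘ Fin.rev), Function.comp_assoc, Fin.rev_involutive.comp_self,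
    Function.comp_id]

theorem RtFac_eq (hq : q ≠ 0) : RtFac q (N := N) =
    Rop (LaurentSeries (QAffine q N)) q N fun i : Fin N => zMon (-1) (shift q i) := by
  funext i j
  rw [RtFac, Rop, inv_zMon _ (shift_ne_zero hq i)]
  have h : - -1 = (1 : ℤ) := rfl
  rw [h]
  have := Rt_map (IsScalarTower.toAlgHom ℂ ZSer (LaurentSeries (QAffine q N))) q N
    (zMon 1 (shift q i)⁻¹) (zMon (-1) (shift q j))
  rw [IsScalarTower.coe_toAlgHom', algebraMap_zMon, algebraMap_zMon] at this
  rw [this]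
  rfl

theorem Sfac_eq (κ : TwistType N) : Sfac q κ =
    Sop q κ (fun i => tMat q (shift q i)) (fun i => (tbarMat q (shift q i))ᵀ) := by
  funext i
  rw [Sfac, Sat_eq, Sop]

theorem prod_map_eq_ordProd {M : Type*} [Monoid M] (S : Fin N → M) (R : Fin N → Fin N → M) :
    ((List.finRange N).map fun i => S i * ((above i).map fun j => R i j).prod).prod =
      ordProd S R (List.finRange N) := by
  have key : ∀ k ≤ N, (((List.finRange N).drop k).map fun i =>
      S i * ((above i).map fun j => R i j).prod).prod =
      ordProd S R ((List.finRange N).drop k) := by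
    intro k hk
    induction hk using Nat.decreasingInduction with
    | self => rw [List.drop_eq_nil_of_le (by simp)]; rfl
    | of_succ k hk ih =>
      rw [drop_finRange_eq_cons hk, List.map_cons, List.prod_cons, ih, above_eq_drop, ordProd]
  exact key 0 (Nat.zero_le _)

theorem prod_map_eq_revProd {M : Type*} [Monoid M] (S : Fin N → M) (R : Fin N → Fin N → M) :
    ((List.finRange N).reverse.map fun i => ((above i).reverse.map fun j => R i j).prod * S i).prod =
      revProd S R (List.finRange N) := by
  have key : ∀ k ≤ N, (((List.finRange N).drop k).reverse.map fun i =>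
      ((above i).reverse.map fun j => R i j).prod * S i).prod =
      revProd S R ((List.finRange N).drop k) := by
    intro k hk
    induction hk using Nat.decreasingInduction with
    | self => rw [List.drop_eq_nil_of_le (by simp)]; rfl
    | of_succ k hk ih =>
      rw [drop_finRange_eq_cons hk, List.reverse_cons, List.map_append, List.prod_append, ih,
        List.map_cons, List.map_nil, List.prod_singleton, above_eq_drop, revProd]
  exact key 0 (Nat.zero_le _)

/-- The quantum determinant of `T(u)`. -/
def detT (q : ℂ) (N : ℕ) : LaurentSeries (QAffine q N) :=
  rowDet q fun i : Fin N => tMat q (shift q i)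

/-- The quantum determinant of the transpose of `T̄(u⁻¹)`. -/
def detTbar (q : ℂ) (N : ℕ) : LaurentSeries (QAffine q N) :=
  rowDet q fun i : Fin N => (tbarMat q (shift q i))ᵀ

/-- The scalar factor of the Sklyanin determinant. -/
def sdetScalar (q : ℂ) (κ : TwistType N) : ZSer := kScalar q κ fun i => zMon (-1) (shift q i)

/-- A^q_N is a column times η, and also a multiple of η with reversed values times a row. Thus the
two products reduce to the action on η from the right and on the reversed η from the left, and
`colDet_eq_rowDet` makes the two resulting series equal. -/
theorem isSklyaninDet (hq0 : q ≠ 0) (hq : ∀ m : ℕ, 0 < m → q ^ m ≠ 1) (κ : TwistType N) :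
    IsSklyaninDet q κ (algebraMap ZSer _ (sdetScalar q κ) * (detT q N * detTbar q N)) := by
  have hq4 := hq 4 (by omega)
  have D := sklyaninData (N := N) hq0
  have e1 := colDet_eq_rowDet hq0 hq D.ne_zero D.step D.rtt
  have e2 := colDet_eq_rowDet hq0 hq D.ne_zero D.step D.rtt'
  have ed : detT q N * algebraMap ZSer _ (sdetScalar q κ) * detTbar q N =
      algebraMap ZSer _ (sdetScalar q κ) * (detT q N * detTbar q N) := by
    rw [← Algebra.commutes, mul_assoc]
  have hL : ∀ c, (eta _ q N ᵥ* ordProd (Sop q κ (fun i => tMat q (shift q i))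
      (fun i => (tbarMat q (shift q i))ᵀ)) (Rop (LaurentSeries (QAffine q N)) q N
        fun i : Fin N => zMon (-1) (shift q i)) (List.finRange N)) c =
      algebraMap ZSer _ (sdetScalar q κ) * (detT q N * detTbar q N) * eta _ q N c := fun c => by
    rw [← ed]
    exact congrFun (D.eta_vecMul hq0 hq4 κ) c
  have hR : ∀ a, (revProd (Sop q κ (fun i => tMat q (shift q i))
      (fun i => (tbarMat q (shift q i))ᵀ)) (Rop (LaurentSeries (QAffine q N)) q N
        fun i : Fin N => zMon (-1) (shift q i)) (List.finRange N) *ᵥ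
          fun c => eta _ q N (Fin.rev ∘ c)) a =
      algebraMap ZSer _ (sdetScalar q κ) * (detT q N * detTbar q N) * eta _ q N (Fin.rev ∘ a) :=
    fun a => by
      have h := D.mulVec_eta hq0 hq4 κ a
      rw [e1, e2] at h
      rw [← ed]
      exact h
  generalize algebraMap ZSer _ (sdetScalar q κ) * (detT q N * detTbar q N) = d at hL hR ⊢
  constructor
  · ext1 a c
    rw [sdetLeft, prod_map_eq_ordProd, RtFac_eq hq0, Sfac_eq, Matrix.mul_apply]
    have h := hL c
    rw [vecMul, dotProduct] at h
    simp only [algebraMap_Aq hq0, mul_assoc]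
    rw [← Finset.mul_sum, h, Matrix.map_apply, algebraMap_Aq hq0, mul_assoc, eta,
      Algebra.commutes (etaC q N c) d]
  · ext1 a c
    rw [sdetRight, prod_map_eq_revProd, RtFac_eq hq0, Sfac_eq, Matrix.mul_apply]
    have h := hR a
    rw [mulVec, dotProduct] at h
    have hA : ∀ b c, AqSer q N b c = eta (LaurentSeries (QAffine q N)) q N (Fin.rev ∘ b) *
        algebraMap ℂ _ (Aq q N N Fin.rev id * etaC q N c) := by
      intro b c
      rw [AqSer, Matrix.map_apply, Aq_apply hq0, Aq_apply_id hq0, mul_assoc, map_mul, eta]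
    simp only [hA, ← mul_assoc]
    rw [← Finset.sum_mul, h, Matrix.map_apply, hA, eta, mul_assoc, ← map_mul, Algebra.commutes]

theorem Aq_id_id (hq : q ≠ 0) : AqSer q N id id = 1 := by
  rw [algebraMap_Aq hq, eta_id, mul_one, ← etaC, etaC_id, map_one]

theorem IsSklyaninDet.unique (hq : q ≠ 0) {κ : TwistType N} {d d' : LaurentSeries (QAffine q N)}
    (h : IsSklyaninDet q κ d) (h' : IsSklyaninDet q κ d') : d = d' := by
  have := congrFun (congrFun (h.1.symm.trans h'.1) id) id
  rwa [Matrix.map_apply, Matrix.map_apply, Aq_id_id hq, one_mul, one_mul] at this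

/-- The entry of A^q_N at (`id`, `id`) is 1, so sdet S is itself an entry of the first product; its
coefficients are therefore polynomials in the s_ij^(r). -/
theorem IsSklyaninDet.eq_sdetLeft (hq : q ≠ 0) {κ : TwistType N}
    {d : LaurentSeries (QAffine q N)} (h : IsSklyaninDet q κ d) : d = sdetLeft q κ id id := by
  rw [h.1, Matrix.map_apply, Aq_id_id hq, one_mul]

end Exists

end TwistedQYangian

end

noncomputable section

namespace TwistedQYangian

open Matrix Function

/-! ## The scalar factor -/

section Gamma

variable {q : ℂ} {N : ℕ}

theorem pairProd_eq_prod {Z : Type*} [Field Z] (x : Fin N → Z) :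
    pairProd x (List.finRange N) =
      ∏ p : Fin N × Fin N with p.1 < p.2, ((x p.1)⁻¹ - x p.2) := by
  have key : ∀ k ≤ N, pairProd x ((List.finRange N).drop k) =
      (((List.finRange N).drop k).map fun i => ((above i).map fun j => (x i)⁻¹ - x j).prod).prod := by
    intro k hk
    induction hk using Nat.decreasingInduction with
    | self => rw [List.drop_eq_nil_of_le (by simp)]; rfl
    | of_succ k hk ih =>
      rw [drop_finRange_eq_cons hk, List.map_cons, List.prod_cons, pairProd, ih, above_eq_drop]
  have h0 := key 0 (Nat.zero_le _)
  rw [List.drop_zero] at h0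
  rw [h0, ← Fin.prod_univ_def, Finset.prod_filter, Fintype.prod_prod_type]
  refine Finset.prod_congr rfl fun i _ => ?_
  rw [← Finset.prod_filter, above,
    ← List.prod_toFinset _ (List.Nodup.filter _ (List.nodup_finRange N))]
  refine Finset.prod_congr ?_ fun _ _ => rfl
  ext j
  simp

theorem inv_zMon_shift (hq : q ≠ 0) (i : Fin N) :
    (zMon (-1) (shift q i))⁻¹ = zMon 1 (q ^ (2 * (i.val : ℤ))) := by
  rw [inv_zMon _ (shift_ne_zero hq i), shift, ← _root_.zpow_neg]
  congr 2
  ring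

/-- The factors `q^{2k-2} u⁻¹ - q^{-2k} u`. -/
def stepFactor (q : ℂ) (k : ℕ) : ZSer :=
  zMon 1 (q ^ (2 * (k : ℤ) - 2)) - zMon (-1) (q ^ (-2 * (k : ℤ)))

theorem stepFactor_ne_zero (hq : q ≠ 0) (k : ℕ) : stepFactor q k ≠ 0 := by
  intro h
  have h1 := congrArg (fun z : LaurentSeries ℂ => z.coeff 1) h
  have h2 : (HahnSeries.single 1 (q ^ (2 * (k : ℤ) - 2)) -
      HahnSeries.single (-1) (q ^ (-2 * (k : ℤ))) : LaurentSeries ℂ).coeff 1 = 0 := h1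
  rw [HahnSeries.coeff_sub, HahnSeries.coeff_single_same,
    HahnSeries.coeff_single_of_ne (by norm_num), sub_zero] at h2
  exact zpow_ne_zero _ hq h2

/-- With k counted from 0, a row k < n differs from the orthogonal one only in that x_k⁻¹ - x_{k+1},
which is `stepFactor q (k + 1)`, is replaced by `stepFactor q k`; these quotients telescope. Each
row k ≥ n contributes q. The truncated difference n - (k - n) counts the rows from max(k, n) on. -/
theorem sympProd_mul_stepFactor (hq : q ≠ 0) (n : ℕ) :
    ∀ k ≤ 2 * n, sympProd q n (fun i : Fin (2 * n) => zMon (-1) (shift q i))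
        ((List.finRange (2 * n)).drop k) * stepFactor q n =
      algebraMap ℂ ZSer q ^ (n - (k - n)) * stepFactor q (min k n) *
        pairProd (fun i : Fin (2 * n) => zMon (-1) (shift q i))
          ((List.finRange (2 * n)).drop k) := by
  intro k hk
  induction hk using Nat.decreasingInduction with
  | self =>
    rw [List.drop_eq_nil_of_le (by simp), sympProd, pairProd, min_eq_right (by omega)]
    rw [show n - (2 * n - n) = 0 by omega]
    simp
  | of_succ k hk ih =>
    rw [drop_finRange_eq_cons hk, sympProd, pairProd]
    by_cases hkn : k < n
    · have hk1 : k + 1 < 2 * n := by omega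
      have hfirst : sympFirst q (fun i : Fin (2 * n) => zMon (-1) (shift q i)) ⟨k, hk⟩
          ((List.finRange (2 * n)).drop (k + 1)) = stepFactor q k *
          (((List.finRange (2 * n)).drop (k + 1 + 1)).map fun j : Fin (2 * n) =>
            (zMon (-1) (shift q ⟨k, hk⟩))⁻¹ - zMon (-1) (shift q j)).prod := by
        rw [drop_finRange_eq_cons hk1, sympFirst]
        congr 1
        rw [inv_zMon_shift hq, ← map_inv₀, ← map_pow, ← map_pow, algebraMap_ZSer, algebraMap_ZSer,
          zMon_mul_zMon, zMon_mul_zMon, zero_add, zero_add, stepFactor, shift, ← zpow_natCast,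
          ← zpow_natCast, _root_.inv_zpow', ← zpow_add₀ hq, ← zpow_add₀ hq]
        congr 3 <;> · push_cast; ring
      have hpair : (((List.finRange (2 * n)).drop (k + 1)).map fun j : Fin (2 * n) =>
            (zMon (-1) (shift q ⟨k, hk⟩))⁻¹ - zMon (-1) (shift q j)).prod = stepFactor q (k + 1) *
          (((List.finRange (2 * n)).drop (k + 1 + 1)).map fun j : Fin (2 * n) =>
            (zMon (-1) (shift q ⟨k, hk⟩))⁻¹ - zMon (-1) (shift q j)).prod := by
        rw [drop_finRange_eq_cons hk1, List.map_cons, List.prod_cons]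
        congr 1
        rw [inv_zMon_shift hq, stepFactor, shift]
        congr 3
        push_cast
        ring
      rw [if_pos hkn, hfirst, mul_assoc, ih, hpair, min_eq_left (by omega), min_eq_left (by omega),
        show n - (k + 1 - n) = n - (k - n) by omega]
      ring
    · rw [if_neg hkn, mul_assoc, ih, min_eq_right (by omega), min_eq_right (by omega),
        show n - (k - n) = n - (k + 1 - n) + 1 by omega]
      ring

theorem sdetScalar_eq (hq : q ≠ 0) (κ : TwistType N) : sdetScalar q κ = gammaN q κ := by
  have hpair := pairProd_eq_prod fun i : Fin N => zMon (-1) (shift q i)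
  simp only [inv_zMon_shift hq] at hpair
  cases κ with
  | orth =>
    change pairProd _ _ = ((∏ p : Fin N × Fin N with p.1 < p.2, (zMon 1 (q ^ (2 * (p.1.val : ℤ))) -
      zMon (-1) (q ^ (-2 * (p.2.val : ℤ))))) * 1 : ZSer)
    rw [hpair, mul_one]
    rfl
  | symp n =>
    change sympProd q n _ _ = ((∏ p : Fin (2 * n) × Fin (2 * n) with p.1 < p.2,
      (zMon 1 (q ^ (2 * (p.1.val : ℤ))) - zMon (-1) (q ^ (-2 * (p.2.val : ℤ))))) *
      ((zMon 0 (q ^ ((n : ℤ) - 2)) - zMon (-2) (q ^ (n : ℤ))) /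
        (zMon 0 (q ^ (2 * (n : ℤ) - 2)) - zMon (-2) (q ^ (-2 * (n : ℤ))))) : ZSer)
    have h := sympProd_mul_stepFactor hq n 0 (Nat.zero_le _)
    rw [List.drop_zero, hpair] at h
    -- Extracting u⁻¹ from both ends of the telescoping quotient gives the denominator and, with the
    -- factor q^n, the numerator of ε(u).
    have hn : stepFactor q n =
        zMon 1 1 * (zMon 0 (q ^ (2 * (n : ℤ) - 2)) - zMon (-2) (q ^ (-2 * (n : ℤ)))) := by
      rw [mul_sub, zMon_mul_zMon, zMon_mul_zMon, one_mul, one_mul]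
      rfl
    have h0 : algebraMap ℂ ZSer q ^ n * stepFactor q 0 =
        zMon 1 1 * (zMon 0 (q ^ ((n : ℤ) - 2)) - zMon (-2) (q ^ (n : ℤ))) := by
      rw [mul_sub, zMon_mul_zMon, zMon_mul_zMon, one_mul, one_mul, ← map_pow, algebraMap_ZSer,
        stepFactor, mul_sub, zMon_mul_zMon, zMon_mul_zMon, ← zpow_natCast, ← zpow_add₀ hq,
        ← zpow_add₀ hq, show (n : ℤ) + (2 * ((0 : ℕ) : ℤ) - 2) = n - 2 by push_cast; ring,
        show (n : ℤ) + -2 * ((0 : ℕ) : ℤ) = n by push_cast; ring]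
      rfl
    have hne := stepFactor_ne_zero hq n
    rw [Nat.zero_sub, Nat.sub_zero, Nat.zero_min, h0] at h
    rw [eq_div_of_mul_eq hne h, hn]
    have hne' : zMon 0 (q ^ (2 * (n : ℤ) - 2)) - zMon (-2) (q ^ (-2 * (n : ℤ))) ≠ 0 := by
      intro e
      rw [hn, e, mul_zero] at hne
      exact hne rfl
    have h1 : zMon 1 1 ≠ 0 := zMon_ne_zero _ one_ne_zero
    have hfac : ∀ a b c d : ZSer, a ≠ 0 → d ≠ 0 → a * b * c / (a * d) = c * (b / d) := by
      intro a b c d ha hd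
      field_simp
    exact hfac _ _ _ _ h1 hne'

end Gamma

end TwistedQYangian

end

noncomputable section

namespace TwistedQYangian

open Matrix Function

/-! ## Coefficients of the normalized determinant -/

section Normalized

variable {q : ℂ} {N : ℕ}

theorem single_sub_single_ne_zero {k l : ℤ} (hkl : k ≠ l) {a b : ℂ} (ha : a ≠ 0) :
    (HahnSeries.single k a - HahnSeries.single l b : LaurentSeries ℂ) ≠ 0 := by
  intro h
  have h1 := congrArg (fun z : LaurentSeries ℂ => z.coeff k) h
  rw [HahnSeries.coeff_sub, HahnSeries.coeff_single_same, HahnSeries.coeff_single_of_ne hkl,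
    sub_zero] at h1
  exact ha h1

theorem gammaN_ne_zero (hq : q ≠ 0) (κ : TwistType N) : gammaN q κ ≠ 0 := by
  refine mul_ne_zero (Finset.prod_ne_zero_iff.2 fun p _ => ?_) ?_
  · exact single_sub_single_ne_zero (by norm_num) (zpow_ne_zero _ hq)
  · cases κ with
    | orth => exact one_ne_zero
    | symp n =>
      exact div_ne_zero (single_sub_single_ne_zero (by norm_num) (zpow_ne_zero _ hq))
        (single_sub_single_ne_zero (by norm_num) (zpow_ne_zero _ hq))

theorem normalized_eq (hq0 : q ≠ 0) (hq : ∀ m : ℕ, 0 < m → q ^ m ≠ 1) {κ : TwistType N}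
    {d : LaurentSeries (QAffine q N)} (hd : IsSklyaninDet q κ d) :
    normalized q κ d = detT q N * detTbar q N := by
  rw [hd.unique hq0 (isSklyaninDet hq0 hq κ), sdetScalar_eq hq0]
  change seriesMap (QAffine q N) (gammaN q κ)⁻¹ * (seriesMap (QAffine q N) (gammaN q κ) * _) = _
  rw [← mul_assoc, ← map_mul, inv_mul_cancel₀ (gammaN_ne_zero hq0 κ), map_one, one_mul]

end Normalized

/-! ### Constant terms of triangular determinants. -/

section Nonneg

variable {A : Type*} [Ring A]

/-- The subring of power series in the ring of Laurent series. -/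
def nonnegSubring (A : Type*) [Ring A] : Subring (LaurentSeries A) where
  carrier := {P | ∀ k < 0, P.coeff k = 0}
  zero_mem' k _ := rfl
  one_mem' k hk := by rw [HahnSeries.coeff_one, if_neg hk.ne]
  add_mem' h h' k hk := by rw [HahnSeries.coeff_add, h k hk, h' k hk, add_zero]
  neg_mem' h k hk := by rw [HahnSeries.coeff_neg, h k hk, neg_zero]
  mul_mem' h h' k hk := by
    rw [coeff_mul_eq_sum_of_nonneg h h' k (S := ∅) (by simp [Finset.Icc_eq_empty (not_le.2 hk)]),
      Finset.sum_empty]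

theorem coeff_zero_mul {P P' : LaurentSeries A} (h : P ∈ nonnegSubring A)
    (h' : P' ∈ nonnegSubring A) : (P * P').coeff 0 = P.coeff 0 * P'.coeff 0 := by
  rw [coeff_mul_eq_sum_of_nonneg h h' 0 (S := {0}) (by simp), Finset.sum_singleton, sub_zero]

theorem coeff_zero_list_prod {l : List (LaurentSeries A)} (h : ∀ P ∈ l, P ∈ nonnegSubring A) :
    l.prod.coeff 0 = (l.map fun P => P.coeff 0).prod := by
  induction l with
  | nil => simp
  | cons P l ih =>
    rw [List.prod_cons, List.map_cons, List.prod_cons, coeff_zero_mul (h P (by simp)),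
      ih fun P' hP' => h P' (by simp [hP'])]
    exact list_prod_mem fun P' hP' => h P' (by simp [hP'])

theorem algebraMap_mem_nonneg [Algebra ℂ A] (c : ℂ) :
    algebraMap ℂ (LaurentSeries A) c ∈ nonnegSubring A := by
  intro k hk
  rw [HahnSeries.algebraMap_apply, HahnSeries.C_apply, HahnSeries.coeff_single_of_ne hk.ne]

theorem Xprod_apply_mem {B : Type*} [Ring B] [Algebra ℂ B] {r N : ℕ} (S : Subring B)
    {X : Fin r → Matrix (Fin N) (Fin N) B} (hX : ∀ i a b, X i a b ∈ S) (a b : Fin r → Fin N) :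
    Xprod X a b ∈ S := by
  rw [Xprod_apply]
  refine list_prod_mem fun P hP => ?_
  obtain ⟨i, _, rfl⟩ := List.mem_map.1 hP
  exact hX _ _ _

theorem eta_vecMul_Xprod_mem [Algebra ℂ A] {q : ℂ} {N : ℕ}
    {X : Fin N → Matrix (Fin N) (Fin N) (LaurentSeries A)}
    (hX : ∀ i a b, X i a b ∈ nonnegSubring A) (a : Fin N → Fin N) :
    (eta (LaurentSeries A) q N ᵥ* Xprod X) a ∈ nonnegSubring A := by
  rw [vecMul, dotProduct]
  exact sum_mem fun b _ => mul_mem (algebraMap_mem_nonneg _) (Xprod_apply_mem _ hX _ _)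

theorem coeff_zero_eta_vecMul [Algebra ℂ A] {q : ℂ} {N : ℕ}
    {X : Fin N → Matrix (Fin N) (Fin N) (LaurentSeries A)}
    (hX : ∀ i a b, X i a b ∈ nonnegSubring A) (a : Fin N → Fin N) :
    ((eta (LaurentSeries A) q N ᵥ* Xprod X) a).coeff 0 =
      ∑ b, etaC q N b • ((List.finRange N).map fun i => (X i (b i) (a i)).coeff 0).prod := by
  rw [vecMul, dotProduct]
  refine (map_sum (HahnSeries.coeff.addMonoidHom 0 : LaurentSeries A →+ A) _ _).trans ?_
  refine Finset.sum_congr rfl fun b _ => ?_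
  refine (coeff_zero_mul (algebraMap_mem_nonneg _) (Xprod_apply_mem _ hX _ _)).trans ?_
  rw [HahnSeries.algebraMap_apply, HahnSeries.C_apply, HahnSeries.coeff_single_same, Xprod_apply,
    coeff_zero_list_prod, List.map_map, Algebra.smul_def]
  · rfl
  · intro P hP
    obtain ⟨i, _, rfl⟩ := List.mem_map.1 hP
    exact hX _ _ _

/-- Both families run through all of {1, …, N}, so their values have equal sums and no inequality
can be strict. -/
theorem eq_of_forall_le {N : ℕ} {a b : Fin N → Fin N} (ha : Injective a) (hb : Injective b)
    (h : ∀ i, a i ≤ b i) : b = a := by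
  have hs : ∀ c : Fin N → Fin N, Injective c → ∑ i, (c i).val = ∑ i : Fin N, i.val := fun c hc =>
    (Finite.injective_iff_bijective.1 hc).sum_comp fun i : Fin N => i.val
  have := (Finset.sum_eq_sum_iff_of_le fun i _ => Fin.le_def.1 (h i)).1
    ((hs a ha).trans (hs b hb).symm)
  funext i
  exact Fin.ext (this i (Finset.mem_univ i)).symm

/-- For a triangular family only one term of the expansion survives in the constant term. -/
theorem coeff_zero_eta_vecMul_of_triangular [Algebra ℂ A] {q : ℂ} (hq : q ≠ 0) {N : ℕ}
    {X : Fin N → Matrix (Fin N) (Fin N) (LaurentSeries A)}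
    (hX : ∀ i a b, X i a b ∈ nonnegSubring A)
    (ht : ∀ i a b, a < b → (X i a b).coeff 0 = 0) {a : Fin N → Fin N} (ha : Injective a) :
    ((eta (LaurentSeries A) q N ᵥ* Xprod X) a).coeff 0 =
      etaC q N a • ((List.finRange N).map fun i => (X i (a i) (a i)).coeff 0).prod := by
  rw [coeff_zero_eta_vecMul hX, Fintype.sum_eq_single a]
  intro b hb
  by_cases hinj : Injective b
  · have : ∃ i, b i < a i := by
      by_contra hcon
      push Not at hcon
      exact hb (eq_of_forall_le ha hinj hcon)
    obtain ⟨i, hi⟩ := this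
    rw [List.prod_eq_zero, smul_zero]
    exact List.mem_map.2 ⟨i, List.mem_finRange i, ht i _ _ hi⟩
  · rw [etaC_eq_zero_of_not_injective hq hinj, zero_smul]

end Nonneg

/-! ### The constant term of det T · det T̄. -/

section ConstantTerm

variable {q : ℂ} {N : ℕ}

theorem tMat_mem (c : ℂ) (i j : Fin N) : tMat q c i j ∈ nonnegSubring (QAffine q N) :=
  coeff_tMat_of_neg q c i j

theorem tbarMat_mem (c : ℂ) (i j : Fin N) : tbarMat q c i j ∈ nonnegSubring (QAffine q N) :=
  coeff_tbarMat_of_neg q c i j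

theorem detT_mem : detT q N ∈ nonnegSubring (QAffine q N) :=
  eta_vecMul_Xprod_mem (fun _ _ _ => tMat_mem _ _ _) _

theorem detTbar_mem : detTbar q N ∈ nonnegSubring (QAffine q N) :=
  eta_vecMul_Xprod_mem (fun _ _ _ => tbarMat_mem _ _ _) _

theorem coeff_zero_tMat (c : ℂ) (i j : Fin N) : (tMat q c i j).coeff 0 = tGen q i j 0 := by
  rw [tMat, coeff_scaleHom]
  simp [Tser]

theorem coeff_zero_tbarMat (c : ℂ) (i j : Fin N) :
    (tbarMat q c i j).coeff 0 = tbarGen q i j 0 := by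
  rw [tbarMat, coeff_scaleHom]
  simp [TbarInvSer]

/-- The expansion is taken at the reversed column multi-index instead of `id`. The diagonal product
then appears as t_NN ⋯ t_11, which cancels against t̄_11 ⋯ t̄_NN from the inside without any
commutation relation. -/
theorem coeff_zero_detT (hq0 : q ≠ 0) (hq4 : q ^ 4 ≠ 1) :
    (detT q N).coeff 0 = ((List.finRange N).reverse.map fun i => tGen q i i 0).prod := by
  have D := sklyaninData (N := N) hq0
  have h : (eta _ q N ᵥ* Xprod fun i : Fin N => tMat q (shift q i)) Fin.rev =
      detT q N * algebraMap ℂ _ (etaC q N Fin.rev) :=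
    congrFun (eta_vecMul_Xprod hq0 hq4 D.ne_zero D.step D.rtt) Fin.rev
  have h1 := congrArg (fun P : LaurentSeries (QAffine q N) => P.coeff 0) h
  rw [coeff_zero_eta_vecMul_of_triangular hq0 (fun _ _ _ => tMat_mem _ _ _) ?_
    Fin.rev_injective] at h1
  · rw [coeff_zero_mul detT_mem (algebraMap_mem_nonneg _),
      HahnSeries.algebraMap_apply, HahnSeries.C_apply, HahnSeries.coeff_single_same,
      ← Algebra.commutes, ← Algebra.smul_def] at h1
    have h2 := smul_right_injective _ (etaC_ne_zero_of_injective hq0 Fin.rev_injective) h1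
    refine h2.symm.trans ?_
    rw [List.finRange_reverse, List.map_map]
    refine congrArg List.prod (List.map_congr_left fun i _ => coeff_zero_tMat _ _ _)
  · intro i a b hab
    rw [coeff_zero_tMat]
    exact (toQAffine_eq q (Rel.t_zero a b hab)).trans (map_zero _)

theorem coeff_zero_detTbar (hq0 : q ≠ 0) :
    (detTbar q N).coeff 0 = ((List.finRange N).map fun i => tbarGen q i i 0).prod := by
  refine (coeff_zero_eta_vecMul_of_triangular hq0 (fun _ _ _ => tbarMat_mem _ _ _) ?_
    injective_id).trans ?_
  · intro i a b hab
    refine (coeff_zero_tbarMat _ _ _).trans ?_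
    exact (toQAffine_eq q (Rel.tbar_zero a b hab)).trans (map_zero _)
  · rw [etaC_id, one_smul]
    exact congrArg List.prod (List.map_congr_left fun i _ => coeff_zero_tbarMat _ _ _)

theorem tGen_mul_tbarGen (i : Fin N) : tGen q i i 0 * tbarGen q i i 0 = 1 := by
  rw [tGen, tbarGen, ← map_mul]
  exact (toQAffine_eq q (Rel.t_mul_tbar i)).trans (map_one _)

theorem coeff_zero_detT_mul_detTbar (hq0 : q ≠ 0) (hq4 : q ^ 4 ≠ 1) :
    (detT q N * detTbar q N).coeff 0 = 1 := by
  rw [coeff_zero_mul detT_mem detTbar_mem, coeff_zero_detT hq0 hq4, coeff_zero_detTbar hq0]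
  induction List.finRange N with
  | nil => simp
  | cons i l ih =>
    rw [List.reverse_cons, List.map_append, List.prod_append, List.map_cons, List.map_nil,
      List.prod_singleton, List.map_cons, List.prod_cons, mul_assoc, ← mul_assoc (tGen q i i 0),
      tGen_mul_tbarGen, one_mul, ih]

end ConstantTerm

end TwistedQYangian

end

noncomputable section

namespace TwistedQYangian

open Matrix Function

/-! ## Centrality -/

section Coefficients

variable {A : Type*} [Ring A] [Algebra ℂ A]

/-- A polynomial function with coefficients in a complex vector space and infinitely many zeros is
trivial. -/
theorem eq_zero_of_infinite_zeros {V : Type*} [AddCommGroup V] [Module ℂ V] {S : Set ℂ}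
    (hS : S.Infinite) {n : ℕ} {a : ℕ → V} (h : ∀ y ∈ S, ∑ i ∈ Finset.range n, y ^ i • a i = 0)
    {i : ℕ} (hi : i < n) : a i = 0 := by
  -- Linear functionals separate vectors, which reduces the claim to polynomials with complex
  -- coefficients.
  rw [← Module.forall_dual_apply_eq_zero_iff ℂ]
  intro φ
  have hp : (∑ j ∈ Finset.range n, Polynomial.C (φ (a j)) * Polynomial.X ^ j) = 0 := by
    refine Polynomial.eq_zero_of_infinite_isRoot _ (hS.mono fun y hy => ?_)
    have := congrArg φ (h y hy)
    rw [map_sum, map_zero] at this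
    rw [Set.mem_setOf_eq, Polynomial.IsRoot.def, Polynomial.eval_finset_sum, ← this]
    refine Finset.sum_congr rfl fun j _ => ?_
    rw [Polynomial.eval_mul, Polynomial.eval_C, Polynomial.eval_pow, Polynomial.eval_X, map_smul,
      smul_eq_mul, mul_comm]
  have := congrArg (fun p => Polynomial.coeff p i) hp
  simpa [Polynomial.finset_sum_coeff, Polynomial.coeff_C_mul, Polynomial.coeff_X_pow, hi] using this

/-- The coefficient of z^{r+s} in the commutator of p(c⁻¹z) with D is a polynomial in c⁻¹, and its
coefficient of c^{-r} is the commutator of p_r with D_s. Infinitely many c thus suffice, and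
finitely many degenerate values may be avoided. -/
theorem commute_coeff_of_infinite {S : Set ℂ} (hS : S.Infinite) {p : PowerSeries A}
    {D : LaurentSeries A} (hD : D ∈ nonnegSubring A)
    (h : ∀ c ∈ S, Commute (scaleHom A c p) D) (r : ℕ) (k : ℤ) :
    Commute (PowerSeries.coeff r p) (D.coeff k) := by
  by_cases hk : k < 0
  · rw [hD k hk]
    exact Commute.zero_right _
  obtain ⟨s, rfl⟩ := Int.eq_ofNat_of_zero_le (not_lt.1 hk)
  have hp : ∀ c, scaleHom A c p ∈ nonnegSubring A := fun c k hk => by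
    rw [coeff_scaleHom, if_neg (not_le.2 hk)]
  have hsub : Finset.Icc 0 ((r + s : ℕ) : ℤ) ⊆
      (Finset.range (r + s + 1)).image fun i : ℕ => (i : ℤ) := by
    intro i hi
    rw [Finset.mem_Icc] at hi
    rw [Finset.mem_image]
    exact ⟨i.toNat, by rw [Finset.mem_range]; omega, by omega⟩
  have key := eq_zero_of_infinite_zeros (V := A) (S := (fun c => c⁻¹) '' S)
    (hS.image (inv_injective.injOn)) (n := r + s + 1)
    (a := fun i => PowerSeries.coeff i p * D.coeff ((r + s : ℕ) - i) -
      D.coeff ((r + s : ℕ) - i) * PowerSeries.coeff i p) ?_ (i := r) (by omega)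
  · have e : (((r + s : ℕ) : ℤ) - r) = s := by push_cast; ring
    rw [e] at key
    exact sub_eq_zero.1 key
  · rintro _ ⟨c, hc, rfl⟩
    have h1 := congrArg (fun P : LaurentSeries A => P.coeff ((r + s : ℕ) : ℤ)) (h c hc).eq
    rw [coeff_mul_eq_sum_of_nonneg (hp c) hD _ hsub, coeff_mul_eq_sum_of_nonneg' (hp c) hD _ hsub,
      Finset.sum_image (fun i _ j _ e => by simpa using e),
      Finset.sum_image (fun i _ j _ e => by simpa using e), ← sub_eq_zero,
      ← Finset.sum_sub_distrib] at h1
    rw [← h1]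
    refine Finset.sum_congr rfl fun i _ => ?_
    rw [coeff_scaleHom, if_pos (Int.natCast_nonneg i), Int.toNat_natCast, smul_mul_assoc,
      mul_smul_comm, smul_sub]

end Coefficients

section Central

variable {q : ℂ} {N : ℕ}

/-- The values of `c` at which `T(cu)` can be exchanged with the quantum determinants. -/
def genericSet (q : ℂ) (N : ℕ) : Set ℂ :=
  (insert 0 (Set.range fun i : Fin N => shift q i) ∪
    Set.range fun i : Fin N => q ^ 2 * shift q i)ᶜ

theorem infinite_genericSet : (genericSet q N).Infinite :=
  (((Set.finite_range _).insert 0).union (Set.finite_range _)).infinite_compl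

theorem ne_zero_of_mem_genericSet {c : ℂ} (hc : c ∈ genericSet q N) : c ≠ 0 := fun h =>
  hc (Or.inl (Or.inl h))

theorem zMon_sub_ne_zero {k l : ℤ} {c d : ℂ} (hc : c ≠ 0) (h : k = l → c ≠ d) :
    zMon k c - zMon l d ≠ 0 := by
  intro e
  have h1 := congrArg (fun z : LaurentSeries ℂ => z.coeff k) (sub_eq_zero.1 e)
  simp only [zMon, HahnSeries.coeff_single] at h1
  by_cases hk : k = l
  · rw [if_pos trivial, if_pos hk] at h1
    exact h hk h1
  · rw [if_pos trivial, if_neg hk] at h1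
    exact hc h1

/-- The spectral parameter of P is τ(c) z^ε. For ε = -1 it is cu and has to avoid the values of
`genericSet`; for ε = 1 it is a multiple of u⁻¹ and never meets a multiple of u. -/
theorem commute_rowDet_coeff (hq0 : q ≠ 0) (hq4 : q ^ 4 ≠ 1) {ε : ℤ} {τ : ℂ → ℂ}
    (hτ : ∀ c, c ≠ 0 → τ c ≠ 0) (hτ' : ε = -1 → ∀ c, τ c = c)
    {X : Fin N → Matrix (Fin N) (Fin N) (LaurentSeries (QAffine q N))}
    (hX : ∀ i a b, X i a b ∈ nonnegSubring (QAffine q N))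
    (h : ∀ i j, i < j → RTT q (zMon (-1) (shift q i)) (zMon (-1) (shift q j)) (X i) (X j))
    (P : Matrix (Fin N) (Fin N) (PowerSeries (QAffine q N)))
    (hP : ∀ c, c ≠ 0 → ∀ i, RTT q (zMon ε (τ c)) (zMon (-1) (shift q i))
      (P.map (scaleHom (QAffine q N) c)) (X i))
    (e f : Fin N) (r : ℕ) (k : ℤ) :
    Commute (PowerSeries.coeff r (P e f)) ((rowDet q X).coeff k) := by
  refine commute_coeff_of_infinite (infinite_genericSet (q := q) (N := N))
    (eta_vecMul_Xprod_mem hX _) (fun c hc => ?_) r k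
  have hc0 := ne_zero_of_mem_genericSet hc
  refine commute_rowDet hq0 hq4 (fun i => zMon_ne_zero _ (shift_ne_zero hq0 i))
    (zMon_shift_step hq0) h (hP c hc0) (fun i => ?_) (fun i => ?_) e f
  · rw [← map_inv₀, algebraMap_ZSer, algebraMap_ZSer, zMon_mul_zMon, zMon_mul_zMon, zero_add,
      zero_add]
    refine zMon_sub_ne_zero (mul_ne_zero (inv_ne_zero hq0) (hτ c hc0)) fun hε he => ?_
    rw [hτ' hε, inv_mul_eq_iff_eq_mul₀ hq0] at he
    exact hc (Or.inr ⟨i, by rw [he]; ring⟩)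
  · refine zMon_sub_ne_zero (hτ c hc0) fun hε he => ?_
    rw [hτ' hε] at he
    exact hc (Or.inl (Or.inr ⟨i, he.symm⟩))

theorem commute_tGen_detT (hq0 : q ≠ 0) (hq4 : q ^ 4 ≠ 1) (i j : Fin N) (r : ℕ) (k : ℤ) :
    Commute (tGen q i j r) ((detT q N).coeff k) := by
  have := commute_rowDet_coeff hq0 hq4 (ε := -1) (τ := id) (fun _ h => h) (fun _ _ => rfl)
    (fun _ _ _ => tMat_mem _ _ _) (sklyaninData (N := N) hq0).rtt (Tser q N)
    (fun c hc l => rtt_t_t hc (shift_ne_zero hq0 l)) i j r k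
  rwa [Tser, PowerSeries.coeff_mk] at this

theorem commute_tbarGen_detT (hq0 : q ≠ 0) (hq4 : q ^ 4 ≠ 1) (i j : Fin N) (r : ℕ) (k : ℤ) :
    Commute (tbarGen q i j r) ((detT q N).coeff k) := by
  have := commute_rowDet_coeff hq0 hq4 (ε := 1) (τ := fun c => c⁻¹) (fun _ h => inv_ne_zero h)
    (fun h => absurd h (by norm_num))
    (fun _ _ _ => tMat_mem _ _ _) (sklyaninData (N := N) hq0).rtt (TbarInvSer q N)
    (fun c hc l => rtt_tbar_t hc (shift_ne_zero hq0 l)) i j r k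
  rwa [TbarInvSer, PowerSeries.coeff_mk] at this

theorem commute_tbarGen_detTbar (hq0 : q ≠ 0) (hq4 : q ^ 4 ≠ 1) (i j : Fin N) (r : ℕ) (k : ℤ) :
    Commute (tbarGen q i j r) ((detTbar q N).coeff k) := by
  have := commute_rowDet_coeff hq0 hq4 (ε := -1) (τ := id) (fun _ h => h) (fun _ _ => rfl)
    (fun _ _ _ => tbarMat_mem _ _ _) (sklyaninData (N := N) hq0).rtt' (TbarInvSer q N)ᵀ
    (fun c hc l => rtt_tbarT_tbarT hc (shift_ne_zero hq0 l)) j i r k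
  rwa [Matrix.transpose_apply, TbarInvSer, PowerSeries.coeff_mk] at this

theorem commute_tGen_detTbar (hq0 : q ≠ 0) (hq4 : q ^ 4 ≠ 1) (i j : Fin N) (r : ℕ) (k : ℤ) :
    Commute (tGen q i j r) ((detTbar q N).coeff k) := by
  have := commute_rowDet_coeff hq0 hq4 (ε := 1) (τ := fun c => c⁻¹) (fun _ h => inv_ne_zero h)
    (fun h => absurd h (by norm_num))
    (fun _ _ _ => tbarMat_mem _ _ _) (sklyaninData (N := N) hq0).rtt' (Tser q N)ᵀ
    (fun c hc l => rtt_tT_tbarT hc (shift_ne_zero hq0 l)) j i r k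
  rwa [Matrix.transpose_apply, Tser, PowerSeries.coeff_mk] at this

theorem coeff_mul_mem {A : Type*} [Ring A] (S : Subring A) {P P' : LaurentSeries A}
    (h : ∀ k, P.coeff k ∈ S) (h' : ∀ k, P'.coeff k ∈ S) (k : ℤ) : (P * P').coeff k ∈ S := by
  rw [HahnSeries.coeff_mul]
  exact sum_mem fun ij _ => mul_mem (h _) (h' _)

theorem commute_of_forall_gen {x : QAffine q N} (ht : ∀ i j r, Commute (tGen q i j r) x)
    (htbar : ∀ i j r, Commute (tbarGen q i j r) x) (y : QAffine q N) : Commute y x := by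
  obtain ⟨w, rfl⟩ : ∃ w, toQAffine q N w = y := RingQuot.mkAlgHom_surjective ℂ (Rel q N) y
  induction w using FreeAlgebra.induction with
  | grade0 c =>
    rw [AlgHom.commutes]
    exact Algebra.commutes c x
  | grade1 g =>
    cases g with
    | t i j r => exact ht i j r
    | tbar i j r => exact htbar i j r
  | mul a b ha hb =>
    rw [map_mul]
    exact ha.mul_left hb
  | add a b ha hb =>
    rw [map_add]
    exact ha.add_left hb

theorem commute_coeff_detT_mul_detTbar (hq0 : q ≠ 0) (hq4 : q ^ 4 ≠ 1) (k : ℤ)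
    (y : QAffine q N) : Commute y ((detT q N * detTbar q N).coeff k) := by
  have h1 : ∀ k y, Commute y ((detT q N).coeff k) := fun k => commute_of_forall_gen
    (fun i j r => commute_tGen_detT hq0 hq4 i j r k)
    (fun i j r => commute_tbarGen_detT hq0 hq4 i j r k)
  have h2 : ∀ k y, Commute y ((detTbar q N).coeff k) := fun k => commute_of_forall_gen
    (fun i j r => commute_tGen_detTbar hq0 hq4 i j r k)
    (fun i j r => commute_tbarGen_detTbar hq0 hq4 i j r k)
  exact Subring.mem_center_iff.1 (coeff_mul_mem (Subring.center (QAffine q N))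
    (fun k => Subring.mem_center_iff.2 fun y => h1 k y)
    (fun k => Subring.mem_center_iff.2 fun y => h2 k y) k) y

end Central

/-! ## The coefficients belong to the twisted `q`-Yangian -/

section Membership

/-- The Laurent series with coefficients in a subring. -/
def coeffSubring {A : Type*} [Ring A] (S : Subring A) : Subring (LaurentSeries A) where
  carrier := {P | ∀ k, P.coeff k ∈ S}
  zero_mem' _ := zero_mem S
  one_mem' k := by
    rw [HahnSeries.coeff_one]
    split_ifs
    exacts [one_mem S, zero_mem S]
  add_mem' h h' k := add_mem (h k) (h' k)
  neg_mem' h k := neg_mem (h k)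
  mul_mem' h h' k := coeff_mul_mem S h h' k

theorem single_mem_coeffSubring {A : Type*} [Ring A] {S : Subring A} (k : ℤ) {a : A} (ha : a ∈ S) :
    (HahnSeries.single k a : LaurentSeries A) ∈ coeffSubring S := by
  intro l
  rw [HahnSeries.coeff_single]
  split_ifs
  exacts [ha, zero_mem S]

variable {q : ℂ} {N : ℕ}

theorem sCoeff_mem (κ : TwistType N) (i j : Fin N) (r : ℕ) : sCoeff q κ i j r ∈ Ytw q κ := by
  refine Algebra.subset_adjoin ?_
  cases κ with
  | orth => exact ⟨i, j, r, rfl⟩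
  | symp => exact Or.inl ⟨i, j, r, rfl⟩

theorem onOne_mem {B : Type*} [Ring B] (S : Subring B) {r : ℕ} (i : Fin r)
    {M : Matrix (Fin N) (Fin N) B} (hM : ∀ a b, M a b ∈ S) : onOne i M ∈ S.matrix := by
  intro a b
  rw [onOne]
  split_ifs
  exacts [hM _ _, zero_mem S]

theorem onTwo_mem {B : Type*} [Ring B] (S : Subring B) {r : ℕ} (i j : Fin r)
    {M : Matrix (Fin N × Fin N) (Fin N × Fin N) B} (hM : ∀ a b, M a b ∈ S) :
    onTwo i j M ∈ S.matrix := by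
  intro a b
  rw [onTwo]
  split_ifs
  exacts [hM _ _, zero_mem S]

theorem Rmat_mem {B : Type*} [Ring B] [Algebra ℂ B] (S : Subring B)
    (hS : ∀ c : ℂ, algebraMap ℂ B c ∈ S) {x y : B} (hx : x ∈ S) (hy : y ∈ S)
    (a b : Fin N × Fin N) : Rmat q N x y a b ∈ S := by
  rw [Rmat_eq_smul_add_smul, Algebra.smul_def, Algebra.smul_def]
  exact add_mem (mul_mem (hS _) hx) (mul_mem (hS _) hy)

theorem Sfac_mem (κ : TwistType N) (i : Fin N) :
    Sfac q κ i ∈ (coeffSubring (Ytw q κ).toSubring).matrix := by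
  refine onOne_mem _ i fun a b k => ?_
  by_cases hk : 0 ≤ k
  · obtain ⟨n, rfl⟩ := Int.eq_ofNat_of_zero_le hk
    rw [Sat, HahnSeries.ofPowerSeries_apply_coeff, PowerSeries.coeff_mk]
    exact (Ytw q κ).smul_mem (sCoeff_mem κ a b n) _
  · have : (Sat q κ (shift q i) a b).coeff k = 0 :=
      (PowerSeries.coeff_coe _ _).trans (if_pos (not_le.1 hk))
    rw [this]
    exact zero_mem _

theorem algebraMap_mem_coeffSubring (κ : TwistType N) (c : ℂ) :
    algebraMap ℂ (LaurentSeries (QAffine q N)) c ∈ coeffSubring (Ytw q κ).toSubring := by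
  rw [HahnSeries.algebraMap_apply, HahnSeries.C_apply]
  exact single_mem_coeffSubring _ ((Ytw q κ).algebraMap_mem c)

theorem RtFac_mem (κ : TwistType N) (i j : Fin N) :
    RtFac q i j ∈ (coeffSubring (Ytw q κ).toSubring).matrix :=
  onTwo_mem _ i j fun _ _ => Rmat_mem _ (algebraMap_mem_coeffSubring κ)
    (single_mem_coeffSubring _ ((Ytw q κ).algebraMap_mem _))
    (single_mem_coeffSubring _ ((Ytw q κ).algebraMap_mem _)) _ _

theorem sdetLeft_mem (κ : TwistType N) :
    sdetLeft q κ ∈ (coeffSubring (Ytw q κ).toSubring).matrix := by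
  refine mul_mem (fun a b => algebraMap_mem_coeffSubring κ _) (list_prod_mem fun M hM => ?_)
  obtain ⟨i, _, rfl⟩ := List.mem_map.1 hM
  refine mul_mem (Sfac_mem κ i) (list_prod_mem fun M hM => ?_)
  obtain ⟨j, _, rfl⟩ := List.mem_map.1 hM
  exact RtFac_mem κ i j

theorem coeff_normalized_mem (hq : q ≠ 0) {κ : TwistType N} {d : LaurentSeries (QAffine q N)}
    (hd : IsSklyaninDet q κ d) (k : ℤ) : (normalized q κ d).coeff k ∈ Ytw q κ := by
  refine coeff_mul_mem (Ytw q κ).toSubring (fun k => (Ytw q κ).algebraMap_mem _) (fun k => ?_) k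
  rw [hd.eq_sdetLeft hq]
  exact sdetLeft_mem κ id id k

end Membership

end TwistedQYangian

end

noncomputable section

namespace TwistedQYangian

open Matrix Function

/-! ## Algebraic independence -/

section QDifference

variable {A : Type*} [CommRing A] [Algebra ℂ A]

/-- The coefficients of the solution of `g(z) = p(z) g(cz)` with constant term `1`. -/
def qSolution (c : ℂ) (p : PowerSeries A) : ℕ → A
  | 0 => 1
  | n + 1 => (1 - c ^ (n + 1))⁻¹ •
      ∑ k : Fin (n + 1), c ^ k.val • (PowerSeries.coeff (n + 1 - k.val) p * qSolution c p k.val)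

/-- Comparison of the coefficients of z^n gives (1 - c^n) g_n = ∑_{k<n} c^k p_{n-k} g_k, which
determines g_n recursively since c^n ≠ 1. -/
theorem exists_eq_mul_rescale {c : ℂ} (hc : ∀ m : ℕ, 0 < m → c ^ m ≠ 1) {p : PowerSeries A}
    (hp : PowerSeries.constantCoeff p = 1) :
    ∃ g : PowerSeries A, PowerSeries.constantCoeff g = 1 ∧
      g = p * PowerSeries.rescale (algebraMap ℂ A c) g := by
  refine ⟨PowerSeries.mk (qSolution c p), ?_, ?_⟩
  · rw [← PowerSeries.coeff_zero_eq_constantCoeff_apply, PowerSeries.coeff_mk, qSolution]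
  · ext n
    rw [mul_comm, PowerSeries.coeff_mul, Finset.Nat.sum_antidiagonal_eq_sum_range_succ_mk]
    simp only [PowerSeries.coeff_rescale, PowerSeries.coeff_mk]
    cases n with
    | zero => simp [qSolution, hp]
    | succ n =>
      rw [Finset.sum_range_succ, Nat.sub_self, PowerSeries.coeff_zero_eq_constantCoeff_apply, hp,
        mul_one, ← map_pow, ← Algebra.smul_def, ← sub_eq_iff_eq_add]
      have h1 : (1 - c ^ (n + 1)) ≠ 0 := sub_ne_zero.2 (hc (n + 1) n.succ_pos).symm
      have h2 : qSolution c p (n + 1) - c ^ (n + 1) • qSolution c p (n + 1) =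
          (1 - c ^ (n + 1)) • qSolution c p (n + 1) := by rw [sub_smul, one_smul]
      rw [h2, qSolution, smul_inv_smul₀ h1, Finset.sum_range]
      refine Finset.sum_congr rfl fun k _ => ?_
      rw [← map_pow, mul_assoc, ← Algebra.smul_def, mul_comm (qSolution c p k.val)]

/-- Factorization of a power series into a `q`-shifted product. -/
theorem exists_prod_rescale_eq [IsDomain A] {c : ℂ} (hc : ∀ m : ℕ, 0 < m → c ^ m ≠ 1) {N : ℕ}
    (hN : 0 < N) {p : PowerSeries A} (hp : PowerSeries.constantCoeff p = 1) :
    ∃ f : PowerSeries A, PowerSeries.constantCoeff f = 1 ∧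
      ∏ i ∈ Finset.range N, PowerSeries.rescale (algebraMap ℂ A (c ^ i)) f = p := by
  -- For g(z) = p(z) g(c^N z) and f(z) = g(z)/g(cz), the product of the f(c^i z), 0 ≤ i < N,
  -- telescopes to g(z)/g(c^N z) = p(z).
  obtain ⟨g, hg1, hg⟩ := exists_eq_mul_rescale (c := c ^ N) (fun m hm => by
    rw [← pow_mul]
    exact hc _ (Nat.mul_pos hN hm)) hp
  have hcg : ∀ a : A, PowerSeries.constantCoeff (PowerSeries.rescale a g) = 1 := fun a => by
    rw [← PowerSeries.coeff_zero_eq_constantCoeff_apply, PowerSeries.coeff_rescale, pow_zero,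
      one_mul, PowerSeries.coeff_zero_eq_constantCoeff_apply, hg1]
  set h := PowerSeries.rescale (algebraMap ℂ A c) g with hh
  have hinv : h * h.invOfUnit 1 = 1 := PowerSeries.mul_invOfUnit h 1 (hcg _)
  have hf : g * h.invOfUnit 1 * h = g := by rw [mul_assoc, mul_comm (h.invOfUnit 1), hinv, mul_one]
  refine ⟨g * h.invOfUnit 1, ?_, ?_⟩
  · have := congrArg PowerSeries.constantCoeff hf
    rwa [map_mul, hcg, mul_one, hg1] at this
  · have step : ∀ i, PowerSeries.rescale (algebraMap ℂ A (c ^ i)) (g * h.invOfUnit 1) *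
        PowerSeries.rescale (algebraMap ℂ A (c ^ (i + 1))) g =
        PowerSeries.rescale (algebraMap ℂ A (c ^ i)) g := by
      intro i
      conv_rhs => rw [← hf, map_mul, hh, PowerSeries.rescale_rescale, ← map_mul, ← pow_succ']
    have tele : ∀ m, (∏ i ∈ Finset.range m,
        PowerSeries.rescale (algebraMap ℂ A (c ^ i)) (g * h.invOfUnit 1)) *
        PowerSeries.rescale (algebraMap ℂ A (c ^ m)) g = g := by
      intro m
      induction m with
      | zero => simp
      | succ m ih => rw [Finset.prod_range_succ, mul_assoc, step, ih]
    refine mul_right_cancel₀ (b := PowerSeries.rescale (algebraMap ℂ A (c ^ N)) g) ?_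
      ((tele N).trans hg)
    intro h0
    have := hcg (algebraMap ℂ A (c ^ N))
    rw [h0, map_zero] at this
    exact zero_ne_one this

end QDifference

/-! ### Homomorphisms from the quantum affine algebra to commutative algebras. -/

section Evaluation

variable {A : Type*} [CommRing A] [Algebra ℂ A] (q : ℂ) {N : ℕ}

theorem rttLeft_eq_rttRight_of_scalar {X Y : ℤ → Matrix (Fin N) (Fin N) A} {x y : ℤ → A}
    (hX : ∀ m, X m = x m • (1 : Matrix (Fin N) (Fin N) A))
    (hY : ∀ m, Y m = y m • (1 : Matrix (Fin N) (Fin N) A)) (m n : ℤ) :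
    rttLeft q X Y m n = rttRight q X Y m n := by
  simp only [rttLeft, rttRight, hX, hY, Matrix.smul_kronecker, Matrix.kronecker_smul,
    Matrix.one_kronecker_one, Matrix.mul_smul, Matrix.smul_mul, Matrix.mul_one, Matrix.one_mul,
    smul_smul, mul_comm]

/-- The values of the generators in the representation with `T(u) = f(u⁻¹)`, `T̄(u) = 1`. -/
def evalGen (N : ℕ) (f : PowerSeries A) : Gen N → A
  | .t i j r => (1 : Matrix (Fin N) (Fin N) A) i j * PowerSeries.coeff r f
  | .tbar i j r => (1 : Matrix (Fin N) (Fin N) A) i j * PowerSeries.coeff r (1 : PowerSeries A)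

theorem map_freeT (f : PowerSeries A) (m : ℤ) :
    (freeT N m).map (FreeAlgebra.lift ℂ (evalGen N f)) =
      (if m ≤ 0 then PowerSeries.coeff (-m).toNat f else 0) •
        (1 : Matrix (Fin N) (Fin N) A) := by
  ext i j
  rw [Matrix.map_apply, freeT, Matrix.smul_apply, smul_eq_mul]
  split_ifs
  · rw [FreeAlgebra.lift_ι_apply, evalGen, mul_comm]
  · rw [map_zero, zero_mul]

theorem map_freeTbar (f : PowerSeries A) (m : ℤ) :
    (freeTbar N m).map (FreeAlgebra.lift ℂ (evalGen N f)) =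
      (if 0 ≤ m then PowerSeries.coeff m.toNat (1 : PowerSeries A) else 0) •
        (1 : Matrix (Fin N) (Fin N) A) := by
  ext i j
  rw [Matrix.map_apply, freeTbar, Matrix.smul_apply, smul_eq_mul]
  split_ifs
  · rw [FreeAlgebra.lift_ι_apply, evalGen, mul_comm]
  · rw [map_zero, zero_mul]

theorem lift_evalGen_eq {f : PowerSeries A} (hf : PowerSeries.constantCoeff f = 1)
    {x y : FreeAlgebra ℂ (Gen N)} (h : Rel q N x y) :
    FreeAlgebra.lift ℂ (evalGen N f) x = FreeAlgebra.lift ℂ (evalGen N f) y := by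
  have hX := map_freeT (N := N) f
  have hY := map_freeTbar (N := N) f
  cases h with
  | t_zero i j h =>
    rw [FreeAlgebra.lift_ι_apply, evalGen, Matrix.one_apply_ne h.ne, zero_mul, map_zero]
  | tbar_zero i j h =>
    rw [FreeAlgebra.lift_ι_apply, evalGen, Matrix.one_apply_ne h.ne', zero_mul, map_zero]
  | t_mul_tbar i => simp [evalGen, hf]
  | tbar_mul_t i => simp [evalGen, hf]
  | rtt m n a b =>
    rw [map_rttLeft, map_rttRight, rttLeft_eq_rttRight_of_scalar q hX hX]
  | rtbtb m n a b =>
    rw [map_rttLeft, map_rttRight, rttLeft_eq_rttRight_of_scalar q hY hY]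
  | rtbt m n a b =>
    rw [map_rttLeft, map_rttRight, rttLeft_eq_rttRight_of_scalar q hY hX]

/-- The representation of `U_q(ĝl_N)` with `T(u) = f(u⁻¹)`, `T̄(u) = 1`. -/
def evalHom {f : PowerSeries A} (hf : PowerSeries.constantCoeff f = 1) : QAffine q N →ₐ[ℂ] A :=
  RingQuot.liftAlgHom ℂ ⟨FreeAlgebra.lift ℂ (evalGen N f), fun _ _ h => lift_evalGen_eq q hf h⟩

theorem evalHom_toQAffine {f : PowerSeries A} (hf : PowerSeries.constantCoeff f = 1)
    (g : Gen N) :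
    evalHom q hf (toQAffine q N (FreeAlgebra.ι ℂ g)) = evalGen N f g :=
  (RingQuot.liftAlgHom_mkAlgHom_apply ℂ (FreeAlgebra.lift ℂ (evalGen N f))
    (fun _ _ h => lift_evalGen_eq q hf h) (FreeAlgebra.ι ℂ g)).trans
      (FreeAlgebra.lift_ι_apply _ _)

variable {q}

/-- An algebra homomorphism applied to the coefficients of a Laurent series. -/
def laurentMap {A A' : Type*} [Ring A] [Algebra ℂ A] [Ring A'] [Algebra ℂ A'] (φ : A →ₐ[ℂ] A') :
    LaurentSeries A →+* LaurentSeries A' where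
  toFun z := z.map φ
  map_zero' := by ext; simp
  map_one' := HahnSeries.map_one (φ : A →+* A').toMonoidWithZeroHom
  map_add' z w := by ext; simp
  map_mul' z w := HahnSeries.map_mul (φ : A →+* A').toNonUnitalRingHom

theorem coeff_laurentMap {A A' : Type*} [Ring A] [Algebra ℂ A] [Ring A'] [Algebra ℂ A']
    (φ : A →ₐ[ℂ] A') (P : LaurentSeries A) (k : ℤ) :
    (laurentMap φ P).coeff k = φ (P.coeff k) := rfl

theorem laurentMap_scaleHom {A A' : Type*} [Ring A] [Algebra ℂ A] [Ring A'] [Algebra ℂ A']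
    (φ : A →ₐ[ℂ] A') (c : ℂ) {p : PowerSeries A} {p' : PowerSeries A'}
    (h : ∀ r, φ (PowerSeries.coeff r p) = PowerSeries.coeff r p') :
    laurentMap φ (scaleHom A c p) = scaleHom A' c p' := by
  ext k
  rw [coeff_laurentMap, coeff_scaleHom, coeff_scaleHom]
  split_ifs
  · rw [map_smul, h]
  · exact map_zero φ

theorem scaleHom_eq_rescale (c : ℂ) (p : PowerSeries A) :
    scaleHom A c p = HahnSeries.ofPowerSeries ℤ A (PowerSeries.rescale (algebraMap ℂ A c⁻¹) p) := by
  change HahnSeries.ofPowerSeries ℤ A _ = _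
  congr 1
  ext r
  rw [PowerSeries.coeff_mk, PowerSeries.coeff_rescale, Algebra.smul_def, map_pow]

/-- The image of a quantum determinant under a homomorphism which makes the matrices scalar. -/
theorem laurentMap_rowDet {A' : Type*} [Ring A'] [Algebra ℂ A'] (φ : A' →ₐ[ℂ] A)
    {X : Fin N → Matrix (Fin N) (Fin N) (LaurentSeries A')} {y : Fin N → LaurentSeries A}
    (hX : ∀ i a b, laurentMap φ (X i a b) = if a = b then y i else 0) :
    laurentMap φ (rowDet q X) = ∏ i, y i := by
  rw [rowDet_apply, map_sum, Fintype.sum_eq_single id]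
  · rw [map_mul, eta_id, map_one, one_mul, map_list_prod, List.map_map, Fin.prod_univ_def]
    refine congrArg List.prod (List.map_congr_left fun i _ => ?_)
    rw [Function.comp_apply, hX, id, if_pos rfl]
  · intro b hb
    obtain ⟨i, hi⟩ := Function.ne_iff.1 hb
    rw [map_mul, map_list_prod, List.prod_eq_zero, mul_zero]
    rw [List.map_map]
    exact List.mem_map.2 ⟨i, List.mem_finRange i, (hX i _ _).trans (if_neg hi)⟩

theorem laurentMap_detT (hq : q ≠ 0) {f : PowerSeries A}
    (hf : PowerSeries.constantCoeff f = 1) :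
    laurentMap (evalHom q hf) (detT q N) = HahnSeries.ofPowerSeries ℤ A
      (∏ i ∈ Finset.range N, PowerSeries.rescale (algebraMap ℂ A ((q ^ 2) ^ i)) f) := by
  rw [detT, laurentMap_rowDet _ (y := fun i => scaleHom A (shift q i) f), Finset.prod_range,
    map_prod]
  · refine Finset.prod_congr rfl fun i _ => ?_
    have e : (shift q i)⁻¹ = (q ^ 2) ^ i.val := by
      rw [shift, ← _root_.zpow_neg, ← pow_mul, ← zpow_natCast]
      congr 1
      push_cast
      ring
    rw [scaleHom_eq_rescale, e]
  · intro i a b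
    have h : ∀ r, evalHom q hf (PowerSeries.coeff r (Tser q N a b)) =
        PowerSeries.coeff r (if a = b then f else 0) := by
      intro r
      rw [Tser, PowerSeries.coeff_mk, tGen, evalHom_toQAffine, evalGen, Matrix.one_apply]
      split_ifs <;> simp
    rw [tMat, laurentMap_scaleHom _ _ h]
    split_ifs
    · rfl
    · exact map_zero _

theorem laurentMap_detTbar {f : PowerSeries A}
    (hf : PowerSeries.constantCoeff f = 1) :
    laurentMap (evalHom q hf) (detTbar q N) = 1 := by
  rw [detTbar, laurentMap_rowDet _ (y := fun _ => 1), Finset.prod_const_one]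
  intro i a b
  have h : ∀ r, evalHom q hf (PowerSeries.coeff r (TbarInvSer q N b a)) =
      PowerSeries.coeff r (if a = b then (1 : PowerSeries A) else 0) := by
    intro r
    rw [TbarInvSer, PowerSeries.coeff_mk, tbarGen, evalHom_toQAffine, evalGen, Matrix.one_apply]
    by_cases hab : a = b
    · rw [if_pos hab, if_pos hab.symm, one_mul]
    · rw [if_neg hab, if_neg (Ne.symm hab), zero_mul, map_zero]
  rw [Matrix.transpose_apply, tbarMat, laurentMap_scaleHom _ _ h]
  split_ifs
  · exact map_one _
  · exact map_zero _

/-- The coefficients of the product of the quantum determinants can take arbitrary values in a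
domain. -/
theorem exists_algHom_coeff_eq [IsDomain A] (hq0 : q ≠ 0) (hq : ∀ m : ℕ, 0 < m → q ^ m ≠ 1)
    (hN : 0 < N) (x : ℕ+ → A) :
    ∃ φ : QAffine q N →ₐ[ℂ] A, ∀ k : ℕ+, φ ((detT q N * detTbar q N).coeff (k : ℤ)) = x k := by
  obtain ⟨f, hf, hp⟩ := exists_prod_rescale_eq (A := A) (c := q ^ 2) (N := N)
    (p := PowerSeries.mk fun n => if h : 0 < n then x ⟨n, h⟩ else 1)
    (fun m hm => by rw [← pow_mul]; exact hq _ (by omega)) hN (by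
      rw [← PowerSeries.coeff_zero_eq_constantCoeff_apply, PowerSeries.coeff_mk,
        dif_neg (lt_irrefl 0)])
  refine ⟨evalHom q hf, fun k => ?_⟩
  rw [← coeff_laurentMap, map_mul, laurentMap_detT hq0, laurentMap_detTbar, mul_one, hp]
  exact (HahnSeries.ofPowerSeries_apply_coeff _ (k : ℕ)).trans
    ((PowerSeries.coeff_mk _ _).trans (dif_pos k.pos))

end Evaluation

end TwistedQYangian

end

theorem proposition4p4 (q : ℂ) (hq0 : q ≠ 0) (hq : ∀ m : ℕ, 0 < m → q ^ m ≠ 1)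
    (N : ℕ) (hN : 0 < N) (κ : TwistedQYangian.TwistType N) :
    (∃! d : LaurentSeries (TwistedQYangian.QAffine q N), TwistedQYangian.IsSklyaninDet q κ d) ∧
    ∀ d : LaurentSeries (TwistedQYangian.QAffine q N), TwistedQYangian.IsSklyaninDet q κ d →
      ∃ c : ℕ+ → Subalgebra.center ℂ (TwistedQYangian.Ytw q κ),
        (∀ m : ℤ, m < 0 → (TwistedQYangian.normalized q κ d).coeff m = 0) ∧
        (TwistedQYangian.normalized q κ d).coeff 0 = 1 ∧
        (∀ k : ℕ+, (TwistedQYangian.normalized q κ d).coeff (k : ℤ) =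
          ((c k : TwistedQYangian.Ytw q κ) : TwistedQYangian.QAffine q N)) ∧
        AlgebraicIndependent ℂ c := by
  have hq4 := hq 4 (by omega)
  refine ⟨⟨_, TwistedQYangian.isSklyaninDet hq0 hq κ, fun d hd =>
    hd.unique hq0 (TwistedQYangian.isSklyaninDet hq0 hq κ)⟩, fun d hd => ?_⟩
  have hn := TwistedQYangian.normalized_eq hq0 hq hd
  -- The values prescribed for the coefficients are the free variables of a polynomial ring.
  obtain ⟨φ, hφ⟩ := TwistedQYangian.exists_algHom_coeff_eq hq0 hq hN
    (MvPolynomial.X : ℕ+ → MvPolynomial ℕ+ ℂ)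
  refine ⟨fun k => ⟨⟨_, TwistedQYangian.coeff_normalized_mem hq0 hd (k : ℤ)⟩,
    Subalgebra.mem_center_iff.2 fun y => Subtype.ext ?_⟩, ?_, ?_, fun k => rfl, ?_⟩
  · have h := TwistedQYangian.commute_coeff_detT_mul_detTbar (N := N) hq0 hq4 (k : ℤ) y
    rw [← hn] at h
    exact h.eq
  · rw [hn]
    exact mul_mem TwistedQYangian.detT_mem TwistedQYangian.detTbar_mem
  · rw [hn]
    exact TwistedQYangian.coeff_zero_detT_mul_detTbar hq0 hq4
  -- A polynomial relation among the c_k in the center would be carried by φ to a relation among the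
  -- variables.
  · refine AlgebraicIndependent.of_comp
      ((φ.comp (TwistedQYangian.Ytw q κ).val).comp (Subalgebra.center ℂ _).val) ?_
    convert MvPolynomial.algebraicIndependent_X ℕ+ ℂ using 1
    funext k
    exact (congrArg (fun P : LaurentSeries (TwistedQYangian.QAffine q N) => φ (P.coeff (k : ℤ)))
      hn).trans (hφ k)
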